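/- Let $\mathcal G$ be a Hausdorff locally compact étale groupoid with unit space $\mathcal G^{(0)}$, range and source maps $r,s$, and put $\mathcal G_x=s^{-1}(x)$, $\mathcal G^x=r^{-1}(x)$, $\mathcal G^x_x=\mathcal G_x\cap\mathcal G^x$. (No second countability is assumed.) Assume that $\mathcal G$ is (topologically) amenable, that is, for every compact $K\subset\mathcal G$ and every $\varepsilon>0$ there is $f\in C_c(\mathcal G)$, $f\ge0$, such that for all $g\in K$ $$\Big|\sum_{h\in\mathcal G^{r(g)}}f(h)-1\Big|<\varepsilon\quad\text{and}\quad \sum_{h\in\mathcal G^{r(g)}}|f(g^{-1}h)-f(h)|<\varepsilon .$$ Notation. "Ideal" means closed two-sided ideal. * $C_c(\mathcal G)$ is a $*$-algebra with $(f_1*f_2)(g)=\sum_{h\in\mathcal G^{r(g)}}f_1(h)f_2(h^{-1}g)$ and $f^*(g)=\overline{f(g^{-1})}$; $C^*(\mathcal G)$ is its completion in the norm $\sup_\pi\|\pi(f)\|$, where $\pi$ runs through all representations of $C_c(\mathcal G)$ by bounded operators on Hilbert spaces. * For $x\in\mathcal G^{(0)}$, a subgroup $S\subset\mathcal G^x_x$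 and a unitary representation $\pi:S\to U(H)$, the induced representation $\mathrm{Ind}^{\mathcal G}_S\pi$ acts on the Hilbert space of functions $\xi:\mathcal G_x\to H$ with $\xi(gh)=\pi(h)^*\xi(g)$ for $g\in\mathcal G_x$, $h\in S$, and $\sum_{g\in\mathcal G_x/S}\|\xi(g)\|^2<\infty$, by $\big((\mathrm{Ind}\,\pi)(f)\xi\big)(g)=\sum_{h\in\mathcal G^{r(g)}}f(h)\xi(h^{-1}g)$ for $f\in C_c(\mathcal G)$; it is extended to $C^*(\mathcal G)$. * $C^*_r(\mathcal G)$ is the completion of $C_c(\mathcal G)$ in the norm $\|f\|_r=\sup_{x}\|\rho_x(f)\|$, where $\rho_x$ is induced from the trivial representation of the trivial subgroup $\{x\}\subset\mathcal G^x_x$; $C_0(\mathcal G^{(0)})\subset C^*_r(\mathcal G)$ is the closure of the set of functions in $C_c(\mathcal G)$ supported on $\mathcal G^{(0)}$. * For a closed invariant set $X\subset\mathcal G^{(0)}$, $\mathcal G_X$ is the groupoid of all $g\in\mathcal G$ with $r(g),s(g)\in X$, with the subspace topology. $\mathcal G$ is effective if the interior of $\{g: r(g)=s(g)\}$ is $\mathcal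 G^{(0)}$, and strongly effective if $\mathcal G_X$ is effective for every closed invariant $X\subset\mathcal G^{(0)}$. $\mathcal G$ has the residual intersection property if, for every closed invariant $X\subset\mathcal G^{(0)}$, every nonzero ideal $I\subset C^*_r(\mathcal G_X)$ satisfies $C_0(X)\cap I\ne0$. * $\mathrm{Prim}\,A$ is the set of primitive ideals of a C$^*$-algebra $A$ with the Jacobson topology (the closed sets are the sets $\{P\in\mathrm{Prim}\,A: J\subset P\}$ for ideals $J$). $\mathrm{Stab}(\mathcal G)^{\mathrm{prim}}$ is the set of pairs $(x,J)$ with $x\in\mathcal G^{(0)}$ and $J\in\mathrm{Prim}\,C^*(\mathcal G^x_x)$, and $\mathrm{Ind}(x,J)=\ker \mathrm{Ind}^{\mathcal G}_{\mathcal G^x_x}\pi_J$, where $\pi_J$ is any irreducible representation of $C^*(\mathcal G^x_x)$ with kernel $J$. **Proposition.** The following conditions are equivalent: 1. $\mathcal G$ is strongly effective; 2. $\mathcal G$ has the residual intersection property; 3. $\mathrm{Ind}(x,J)$ depends only on $x$, that is, $\mathrm{Ind}(x,J)=\mathrm{Ind}(x,J')$ for all $x\in\mathcal G^{(0)}$ and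 $J,J'\in\mathrm{Prim}\,C^*(\mathcal G^x_x)$. Moreover, if these conditions are satisfied, then $\mathrm{Ind}$ gives a map $\mathrm{Ind}_0:\mathcal G^{(0)}\to\mathrm{Prim}\,C^*(\mathcal G)$, with $\mathrm{Ind}_0(x)=\mathrm{Ind}(x,J)$ for all $J$; it defines a homeomorphism of $(\mathcal G\backslash\mathcal G^{(0)})^\sim$, the $T_0$-quotient (Kolmogorov quotient) of the orbit space $\mathcal G\backslash\mathcal G^{(0)}$, onto the subspace $\mathrm{Ind}_0(\mathcal G^{(0)})$ of $\mathrm{Prim}\,C^*(\mathcal G)$; and for every closed subset $\Omega\subset\mathrm{Prim}\,C^*(\mathcal G)$ the set $\mathrm{Ind}_0(\mathcal G^{(0)})\cap\Omega$ is dense in $\Omega$. -/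

import Mathlib

open scoped ComplexConjugate Topology

universe u v w

namespace EtaleCStar

/-! ## Representations and C⋆-completions of complex ⋆-algebras -/

section Representations

/-- A representation of a complex ⋆-algebra by bounded operators on a Hilbert space. -/
structure HilbertRep (A : Type w) [NonUnitalRing A] [StarRing A] [Module ℂ A] where
  /-- the underlying Hilbert space -/
  H : Type w
  [normed : NormedAddCommGroup H]
  [inner : InnerProductSpace ℂ H]
  [complete : CompleteSpace H]
  /-- the ⋆-homomorphism into the bounded operators -/
  rep : A →⋆ₙₐ[ℂ] (H →L[ℂ] H)

attribute [instance] HilbertRep.normed HilbertRep.inner HilbertRep.complete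

/-- A (topologically) irreducible representation: it is not zero, and there are no closed
invariant subspaces except for `0` and the whole space. -/
def IsIrreducibleRep {A : Type*} [NonUnitalRing A] [StarRing A] [Module ℂ A]
    {H : Type*} [NormedAddCommGroup H] [InnerProductSpace ℂ H] [CompleteSpace H]
    (π : A →⋆ₙₐ[ℂ] (H →L[ℂ] H)) : Prop :=
  (∃ a, π a ≠ 0) ∧ ∀ K : Submodule ℂ H, IsClosed (K : Set H) →
    (∀ a, ∀ ξ ∈ K, π a ξ ∈ K) → K = ⊥ ∨ K = ⊤

end Representations

section Seminorms

/-- A C⋆-seminorm on a complex ⋆-algebra. -/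
structure CStarSeminorm (A : Type*) [NonUnitalRing A] [StarRing A] [Module ℂ A]
    extends Seminorm ℂ A where
  mul_le' : ∀ a b : A, toFun (a * b) ≤ toFun a * toFun b
  star_mul_self' : ∀ a : A, toFun (star a * a) = toFun a * toFun a

variable {A : Type w} [NonUnitalRing A] [StarRing A] [Module ℂ A]

/-- The supremum `a ↦ sup_i ‖π_i(a)‖` over a pointwise bounded family of representations. -/
noncomputable def CStarSeminorm.ofFamily {ι : Type*} (π : ι → HilbertRep A)
    (hπ : ∀ a, BddAbove (Set.range fun i => ‖(π i).rep a‖)) : CStarSeminorm A where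
  toFun a := ⨆ i, ‖(π i).rep a‖
  map_zero' := by simp
  add_le' a b := by
    rcases isEmpty_or_nonempty ι with h | h
    · simp
    · refine ciSup_le fun i => ?_
      rw [map_add]
      exact (norm_add_le _ _).trans
        (add_le_add (le_ciSup (hπ a) i) (le_ciSup (hπ b) i))
  neg' a := by simp
  smul' c a := by
    simp only [map_smul, norm_smul]
    rw [Real.mul_iSup_of_nonneg (norm_nonneg c)]
  mul_le' a b := by
    rcases isEmpty_or_nonempty ι with h | h
    · simp
    · refine ciSup_le fun i => ?_
      rw [map_mul]
      exact (norm_mul_le _ _).trans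
        (mul_le_mul (le_ciSup (hπ a) i) (le_ciSup (hπ b) i) (norm_nonneg _)
          (Real.iSup_nonneg fun _ => norm_nonneg _))
  star_mul_self' a := by
    rcases isEmpty_or_nonempty ι with h | h
    · simp
    · have key : ∀ i, ‖(π i).rep (star a * a)‖ = ‖(π i).rep a‖ * ‖(π i).rep a‖ := fun i => by
        rw [map_mul, map_star, CStarRing.norm_star_mul_self]
      have h0 : (0 : ℝ) ≤ ⨆ i, ‖(π i).rep a‖ := Real.iSup_nonneg fun _ => norm_nonneg _
      apply le_antisymm
      · refine ciSup_le fun i => ?_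
        rw [key]
        exact mul_le_mul (le_ciSup (hπ a) i) (le_ciSup (hπ a) i) (norm_nonneg _) h0
      · have h1 : ∀ i, ‖(π i).rep a‖ ≤ √(⨆ i, ‖(π i).rep (star a * a)‖) := fun i => by
          apply Real.le_sqrt_of_sq_le
          rw [sq, ← key]
          exact le_ciSup (hπ (star a * a)) i
        have h2 := ciSup_le h1
        calc _ ≤ √(⨆ i, ‖(π i).rep (star a * a)‖) * √(⨆ i, ‖(π i).rep (star a * a)‖) :=
              mul_le_mul h2 h2 h0 (Real.sqrt_nonneg _)
          _ = _ := Real.mul_self_sqrt (Real.iSup_nonneg fun _ => norm_nonneg _)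

theorem CStarSeminorm.norm_rep_le_ofFamily {ι : Type*} (π : ι → HilbertRep A)
    (hπ : ∀ a, BddAbove (Set.range fun i => ‖(π i).rep a‖)) (i : ι) (a : A) :
    ‖(π i).rep a‖ ≤ (CStarSeminorm.ofFamily π hπ).toFun a :=
  le_ciSup (hπ a) i

end Seminorms

section Completion

variable {A : Type*} [NonUnitalRing A] [StarRing A] [Module ℂ A]

theorem CStarSeminorm.toFun_star (p : CStarSeminorm A) (a : A) : p.toFun (star a) = p.toFun a := by
  have key : ∀ a : A, p.toFun a ≤ p.toFun (star a) := fun a => by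
    have h0 : 0 ≤ p.toFun a := apply_nonneg p.toSeminorm a
    rcases h0.eq_or_lt with h | h
    · rw [← h]; exact apply_nonneg p.toSeminorm (star a)
    · have := p.mul_le' (star a) a
      rw [p.star_mul_self'] at this
      exact le_of_mul_le_mul_right this h
  exact le_antisymm (by simpa using key (star a)) (key a)

/-- A copy of `A`, to be equipped with the C⋆-seminorm `p`. -/
def CStarSeminorm.Carrier (_p : CStarSeminorm A) : Type _ := A

variable (p : CStarSeminorm A)

instance : NonUnitalRing p.Carrier := inferInstanceAs (NonUnitalRing A)
instance : StarRing p.Carrier := inferInstanceAs (StarRing A)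
instance : Module ℂ p.Carrier := inferInstanceAs (Module ℂ A)
instance [IsScalarTower ℂ A A] : IsScalarTower ℂ p.Carrier p.Carrier :=
  inferInstanceAs (IsScalarTower ℂ A A)
instance [SMulCommClass ℂ A A] : SMulCommClass ℂ p.Carrier p.Carrier :=
  inferInstanceAs (SMulCommClass ℂ A A)
instance [StarModule ℂ A] : StarModule ℂ p.Carrier := inferInstanceAs (StarModule ℂ A)

noncomputable instance : NonUnitalSeminormedRing p.Carrier where
  __ := (inferInstance : NonUnitalRing p.Carrier)
  __ := p.toSeminorm.toAddGroupSeminorm.toSeminormedAddCommGroup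
  norm_mul_le := p.mul_le'

noncomputable instance : NormedSpace ℂ p.Carrier where
  norm_smul_le c a := (p.toSeminorm.smul' c a).le

theorem CStarSeminorm.norm_carrier (a : A) : ‖(show p.Carrier from a)‖ = p.toFun a := rfl

theorem CStarSeminorm.norm_star_carrier (a : p.Carrier) : ‖star a‖ = ‖a‖ := p.toFun_star a

/-- The completion of `A` with respect to the C⋆-seminorm `p`
(elements of seminorm zero become zero). -/
def CStarSeminorm.Completion : Type _ := UniformSpace.Completion p.Carrier

namespace CStarSeminorm.Completion

open UniformSpace.Completion

noncomputable instance : NormedAddCommGroup p.Completion :=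
  inferInstanceAs (NormedAddCommGroup (UniformSpace.Completion p.Carrier))
noncomputable instance : NormedSpace ℂ p.Completion :=
  inferInstanceAs (NormedSpace ℂ (UniformSpace.Completion p.Carrier))
instance : CompleteSpace p.Completion :=
  inferInstanceAs (CompleteSpace (UniformSpace.Completion p.Carrier))

/-- The canonical map of `A` into its completion. -/
noncomputable def of (a : A) : p.Completion := ((show p.Carrier from a : p.Carrier) :
  UniformSpace.Completion p.Carrier)

theorem norm_of (a : A) : ‖of p a‖ = p.toFun a := norm_coe (E := p.Carrier) a

theorem denseRange_of : DenseRange (of p) := denseRange_coe (α := p.Carrier)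

theorem of_add (a b : A) : of p (a + b) = of p a + of p b := coe_add (α := p.Carrier) a b
theorem of_zero : of p 0 = 0 := coe_zero (α := p.Carrier)
theorem of_smul (c : ℂ) (a : A) : of p (c • a) = c • of p a :=
  coe_smul (X := p.Carrier) c a

theorem continuous_of : Continuous (fun a : p.Carrier => of p a) := continuous_coe p.Carrier

theorem isDenseInducing_of : IsDenseInducing (fun a : p.Carrier => of p a) :=
  isDenseInducing_coe (α := p.Carrier)

@[elab_as_elim]
theorem induction_on {q : p.Completion → Prop} (a : p.Completion)
    (hp : IsClosed {a | q a}) (ih : ∀ a : A, q (of p a)) : q a :=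
  UniformSpace.Completion.induction_on (α := p.Carrier) a hp ih

@[elab_as_elim]
theorem induction_on₂ {q : p.Completion → p.Completion → Prop} (a b : p.Completion)
    (hp : IsClosed {x : p.Completion × p.Completion | q x.1 x.2})
    (ih : ∀ a b : A, q (of p a) (of p b)) : q a b :=
  UniformSpace.Completion.induction_on₂ (α := p.Carrier) (β := p.Carrier) a b hp ih

@[elab_as_elim]
theorem induction_on₃ {q : p.Completion → p.Completion → p.Completion → Prop}
    (a b c : p.Completion)
    (hp : IsClosed {x : p.Completion × p.Completion × p.Completion | q x.1 x.2.1 x.2.2})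
    (ih : ∀ a b c : A, q (of p a) (of p b) (of p c)) : q a b c :=
  UniformSpace.Completion.induction_on₃ (α := p.Carrier) (β := p.Carrier) (γ := p.Carrier)
    a b c hp ih

/-- The product, extended by continuity. -/
noncomputable instance : Mul p.Completion :=
  ⟨Function.curry <| ((isDenseInducing_of p).prodMap (isDenseInducing_of p)).extend
    (fun x : p.Carrier × p.Carrier => of p (x.1 * x.2 : p.Carrier))⟩

theorem of_mul (a b : A) : of p (a * b) = of p a * of p b :=
  (((isDenseInducing_of p).prodMap (isDenseInducing_of p)).extend_eq
    (f := fun x : p.Carrier × p.Carrier => of p (x.1 * x.2 : p.Carrier))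
    ((continuous_of p).comp (continuous_mul (M := p.Carrier)))
    ((a, b) : p.Carrier × p.Carrier)).symm

instance : ContinuousMul p.Completion where
  continuous_mul := by
    let m := (AddMonoidHom.mul : p.Carrier →+ p.Carrier →+ p.Carrier).compr₂ toCompl
    have : Continuous fun x : p.Carrier × p.Carrier => m x.1 x.2 :=
      (continuous_of p).comp continuous_mul
    have di : IsDenseInducing (toCompl : p.Carrier → UniformSpace.Completion p.Carrier) :=
      isDenseInducing_coe
    exact (di.extend_Z_bilin di this :)

noncomputable instance : NonUnitalNormedRing p.Completion where
  __ := (inferInstance : NormedAddCommGroup p.Completion)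
  mul := (· * ·)
  zero_mul a := by
    refine induction_on p a (isClosed_eq (by fun_prop) continuous_const) fun a => ?_
    rw [← of_zero, ← of_mul, zero_mul]
  mul_zero a := by
    refine induction_on p a (isClosed_eq (by fun_prop) continuous_const) fun a => ?_
    rw [← of_zero, ← of_mul, mul_zero]
  mul_assoc a b c := by
    refine induction_on₃ p a b c (isClosed_eq (by fun_prop) (by fun_prop)) fun a b c => ?_
    simp only [← of_mul, mul_assoc]
  left_distrib a b c := by
    refine induction_on₃ p a b c (isClosed_eq (by fun_prop) (by fun_prop)) fun a b c => ?_
    simp only [← of_mul, ← of_add, mul_add]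
  right_distrib a b c := by
    refine induction_on₃ p a b c (isClosed_eq (by fun_prop) (by fun_prop)) fun a b c => ?_
    simp only [← of_mul, ← of_add, add_mul]
  norm_mul_le a b := by
    refine induction_on₂ p a b (isClosed_le (by fun_prop) (by fun_prop)) fun a b => ?_
    rw [← of_mul]
    simp only [norm_of]
    exact p.mul_le' a b

theorem uniformContinuous_star : UniformContinuous (star : p.Carrier → p.Carrier) := by
  have : Isometry (star : p.Carrier → p.Carrier) :=
    Isometry.of_dist_eq fun a b => by
      rw [dist_eq_norm, dist_eq_norm, ← star_sub, p.norm_star_carrier]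
  exact this.uniformContinuous

noncomputable instance : Star p.Completion :=
  ⟨UniformSpace.Completion.map (star : p.Carrier → p.Carrier)⟩

theorem of_star (a : A) : of p (star a) = star (of p a) :=
  (UniformSpace.Completion.map_coe (uniformContinuous_star p) a).symm

@[fun_prop]
theorem continuous_star : Continuous (star : p.Completion → p.Completion) :=
  UniformSpace.Completion.continuous_map

noncomputable instance : StarRing p.Completion where
  star_involutive a := by
    refine induction_on p a
      (isClosed_eq ((continuous_star p).comp (continuous_star p)) continuous_id) fun a => ?_
    simp only [← of_star, star_star]
  star_mul a b := by
    refine induction_on₂ p a b (isClosed_eq ((continuous_star p).comp continuous_mul)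
      (((continuous_star p).comp continuous_snd).mul
        ((continuous_star p).comp continuous_fst))) fun a b => ?_
    simp only [← of_star, ← of_mul, star_mul]
  star_add a b := by
    refine induction_on₂ p a b (isClosed_eq ((continuous_star p).comp continuous_add)
      (((continuous_star p).comp continuous_fst).add
        ((continuous_star p).comp continuous_snd))) fun a b => ?_
    simp only [← of_star, ← of_add, star_add]

theorem continuous_smul' (c : ℂ) : Continuous fun x : p.Completion => c • x :=
  continuous_const_smul c

section CStar

variable [IsScalarTower ℂ A A] [SMulCommClass ℂ A A] [StarModule ℂ A]

instance : IsScalarTower ℂ p.Completion p.Completion where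
  smul_assoc c a b := by
    refine induction_on₂ p a b (isClosed_eq
      (f := fun x : p.Completion × p.Completion => (c • x.1) * x.2)
      (g := fun x : p.Completion × p.Completion => c • (x.1 * x.2))
      (((continuous_smul' p c).comp continuous_fst).mul continuous_snd)
      ((continuous_smul' p c).comp continuous_mul)) fun a b => ?_
    change (c • of p a) * of p b = c • (of p a * of p b)
    rw [← of_smul, ← of_mul, ← of_mul, ← of_smul, smul_mul_assoc]

instance : SMulCommClass ℂ p.Completion p.Completion where
  smul_comm c a b := by
    refine induction_on₂ p a b (isClosed_eq
      (f := fun x : p.Completion × p.Completion => c • (x.1 * x.2))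
      (g := fun x : p.Completion × p.Completion => x.1 * (c • x.2))
      ((continuous_smul' p c).comp continuous_mul)
      (continuous_fst.mul ((continuous_smul' p c).comp continuous_snd))) fun a b => ?_
    change c • (of p a * of p b) = of p a * (c • of p b)
    rw [← of_smul, ← of_mul, ← of_mul, ← of_smul, mul_smul_comm]

instance : StarModule ℂ p.Completion where
  star_smul c a := by
    refine induction_on p a (isClosed_eq
      ((continuous_star p).comp (continuous_smul' p c))
      ((continuous_smul' p _).comp (continuous_star p))) fun a => ?_
    rw [← of_smul, ← of_star, star_smul, of_smul, of_star]

instance : CStarRing p.Completion where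
  norm_mul_self_le a := by
    refine induction_on p a (isClosed_le (by fun_prop) (by fun_prop)) fun a => ?_
    rw [← of_star, ← of_mul]
    simp only [norm_of]
    exact (p.star_mul_self' a).ge

noncomputable instance : NonUnitalCStarAlgebra p.Completion where

end CStar

/-- The canonical ⋆-homomorphism of `A` into its completion. -/
noncomputable def ofHom : A →⋆ₙₐ[ℂ] p.Completion where
  toFun := of p
  map_smul' := of_smul p
  map_zero' := of_zero p
  map_add' := of_add p
  map_mul' := of_mul p
  map_star' := of_star p

variable {p}

/-- The extension by continuity of a representation of `A` that is bounded by `p`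
to the completion. -/
noncomputable def lift {H : Type*} [NormedAddCommGroup H] [InnerProductSpace ℂ H] [CompleteSpace H]
    (π : A →⋆ₙₐ[ℂ] (H →L[ℂ] H)) (hπ : ∀ a, ‖π a‖ ≤ p.toFun a) :
    p.Completion →⋆ₙₐ[ℂ] (H →L[ℂ] H) :=
  let f : p.Carrier →L[ℂ] (H →L[ℂ] H) := LinearMap.mkContinuous
    { toFun := fun a => π a, map_add' := map_add π, map_smul' := map_smul π } 1
    (fun a => by rw [one_mul]; exact hπ a)
  have hu : UniformContinuous (fun a : p.Carrier => π a) := f.uniformContinuous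
  let F : p.Completion → (H →L[ℂ] H) := UniformSpace.Completion.extension
    (fun a : p.Carrier => π a)
  have hF : Continuous F := UniformSpace.Completion.continuous_extension
  have hof : ∀ a : A, F (of p a) = π a :=
    fun a => UniformSpace.Completion.extension_coe hu a
  { toFun := F
    map_smul' := fun c a => by
      refine induction_on p a (isClosed_eq (hF.comp (continuous_const_smul c))
        (g := fun a => c • F a) (hF.const_smul c)) fun a => ?_
      rw [← of_smul, hof, hof, map_smul]
      rfl
    map_zero' := by rw [← of_zero, hof, map_zero]
    map_add' := fun a b => by
      refine induction_on₂ p a b (isClosed_eq (hF.comp continuous_add)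
        ((hF.comp continuous_fst).add (hF.comp continuous_snd))) fun a b => ?_
      rw [← of_add, hof, hof, hof, map_add]
    map_mul' := fun a b => by
      refine induction_on₂ p a b (isClosed_eq (hF.comp continuous_mul)
        ((hF.comp continuous_fst).mul (hF.comp continuous_snd))) fun a b => ?_
      rw [← of_mul, hof, hof, hof, map_mul]
    map_star' := fun a => by
      refine induction_on p a (isClosed_eq (hF.comp (continuous_star p))
        (hF.star)) fun a => ?_
      rw [← of_star, hof, hof, map_star] }

theorem lift_of {H : Type*} [NormedAddCommGroup H] [InnerProductSpace ℂ H] [CompleteSpace H]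
    (π : A →⋆ₙₐ[ℂ] (H →L[ℂ] H)) (hπ : ∀ a, ‖π a‖ ≤ p.toFun a) (a : A) :
    lift π hπ (of p a) = π a := by
  let f : p.Carrier →L[ℂ] (H →L[ℂ] H) := LinearMap.mkContinuous
    { toFun := fun a => π a, map_add' := map_add π, map_smul' := map_smul π } 1
    (fun a => by rw [one_mul]; exact hπ a)
  have hu : UniformContinuous (fun a : p.Carrier => π a) := f.uniformContinuous
  exact UniformSpace.Completion.extension_coe hu a

theorem continuous_lift {H : Type*} [NormedAddCommGroup H] [InnerProductSpace ℂ H]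
    [CompleteSpace H] (π : A →⋆ₙₐ[ℂ] (H →L[ℂ] H)) (hπ : ∀ a, ‖π a‖ ≤ p.toFun a) :
    Continuous (lift (p := p) π hπ) :=
  UniformSpace.Completion.continuous_extension

end CStarSeminorm.Completion

end Completion

end EtaleCStar

namespace EtaleCStar

/-! ## Enveloping C⋆-algebras -/

section Envelope

variable (A : Type w) [NonUnitalRing A] [StarRing A] [Module ℂ A]

/-- `sup_π ‖π(a)‖` over all representations `π` of `A` is finite for every `a`. -/
class HasEnvelope : Prop where
  bddAbove : ∀ a : A, BddAbove (Set.range fun π : HilbertRep A => ‖π.rep a‖)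

/-- The seminorm `‖a‖ = sup_π ‖π(a)‖`, over all representations of `A` on Hilbert spaces. -/
noncomputable def fullSeminorm [HasEnvelope A] : CStarSeminorm A :=
  CStarSeminorm.ofFamily (fun π : HilbertRep A => π) HasEnvelope.bddAbove

/-- The completion of `A` in the norm `‖a‖ = sup_π ‖π(a)‖`. -/
abbrev Envelope [HasEnvelope A] : Type w := (fullSeminorm A).Completion

variable {A}

theorem norm_rep_le_fullSeminorm [HasEnvelope A] {H : Type w} [NormedAddCommGroup H]
    [InnerProductSpace ℂ H] [CompleteSpace H] (π : A →⋆ₙₐ[ℂ] (H →L[ℂ] H)) (a : A) :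
    ‖π a‖ ≤ (fullSeminorm A).toFun a :=
  CStarSeminorm.norm_rep_le_ofFamily (fun π : HilbertRep A => π) _ ⟨H, π⟩ a

/-- The extension of a representation of `A` to the enveloping C⋆-algebra. -/
noncomputable def extendRep [HasEnvelope A] {H : Type w} [NormedAddCommGroup H]
    [InnerProductSpace ℂ H] [CompleteSpace H] (π : A →⋆ₙₐ[ℂ] (H →L[ℂ] H)) :
    Envelope A →⋆ₙₐ[ℂ] (H →L[ℂ] H) :=
  CStarSeminorm.Completion.lift π (norm_rep_le_fullSeminorm π)

theorem extendRep_of [HasEnvelope A] {H : Type w} [NormedAddCommGroup H]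
    [InnerProductSpace ℂ H] [CompleteSpace H] (π : A →⋆ₙₐ[ℂ] (H →L[ℂ] H)) (a : A) :
    extendRep π (CStarSeminorm.Completion.of (fullSeminorm A) a) = π a :=
  CStarSeminorm.Completion.lift_of _ _ a

theorem continuous_extendRep [HasEnvelope A] {H : Type w} [NormedAddCommGroup H]
    [InnerProductSpace ℂ H] [CompleteSpace H] (π : A →⋆ₙₐ[ℂ] (H →L[ℂ] H)) :
    Continuous (extendRep π) :=
  CStarSeminorm.Completion.continuous_lift _ _

end Envelope

/-! ## The primitive ideal space -/

section Prim

variable (A : Type w) [NonUnitalCStarAlgebra A]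

/-- The set of primitive ideals of `A`: kernels of irreducible representations on Hilbert
spaces. -/
def Prim : Type w :=
  {P : TwoSidedIdeal A // ∃ π : HilbertRep A, IsIrreducibleRep π.rep ∧ TwoSidedIdeal.ker π.rep = P}

variable {A}

/-- The hull of an ideal: the set of primitive ideals containing it. -/
def hull (J : TwoSidedIdeal A) : Set (Prim A) := {P | J ≤ P.1}

theorem mem_hull {J : TwoSidedIdeal A} {P : Prim A} : P ∈ hull J ↔ J ≤ P.1 := Iff.rfl

theorem isClosed_ker {H : Type*} [NormedAddCommGroup H] [InnerProductSpace ℂ H]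
    [CompleteSpace H] (π : A →⋆ₙₐ[ℂ] (H →L[ℂ] H)) :
    IsClosed (TwoSidedIdeal.ker π : Set A) := by
  have hc : Continuous π := by
    have : LipschitzWith 1 π := LipschitzWith.of_dist_le_mul fun a b => by
      rw [dist_eq_norm, dist_eq_norm, ← map_sub, NNReal.coe_one, one_mul]
      exact NonUnitalStarAlgHom.norm_apply_le π (a - b)
    exact this.continuous
  have : (TwoSidedIdeal.ker π : Set A) = π ⁻¹' {0} := by
    ext a
    simp [TwoSidedIdeal.mem_ker]
  rw [this]
  exact isClosed_singleton.preimage hc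

theorem Prim.isClosed (P : Prim A) : IsClosed (P.1 : Set A) := by
  obtain ⟨P, π, -, rfl⟩ := P
  exact isClosed_ker π.rep

theorem isIrreducibleRep_not_top {H : Type*} [NormedAddCommGroup H] [InnerProductSpace ℂ H]
    [CompleteSpace H] {π : A →⋆ₙₐ[ℂ] (H →L[ℂ] H)} (hπ : IsIrreducibleRep π) :
    ¬ (⊤ : TwoSidedIdeal A) ≤ TwoSidedIdeal.ker π := by
  obtain ⟨⟨a, ha⟩, -⟩ := hπ
  exact fun h => ha ((TwoSidedIdeal.mem_ker _).1 (h trivial))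

/-- Primitive ideals are prime. -/
theorem Prim.le_or_le (P : Prim A) (I J : TwoSidedIdeal A) (h : I ⊓ J ≤ P.1) :
    I ≤ P.1 ∨ J ≤ P.1 := by
  obtain ⟨P, π, hirr, rfl⟩ := P
  by_contra! hcon
  obtain ⟨hI, hJ⟩ := hcon
  have hI' : ∃ a ∈ I, π.rep a ≠ 0 := by
    by_contra! hc
    exact hI fun a ha => (TwoSidedIdeal.mem_ker _).2 (hc a ha)
  have hJ' : ∃ b ∈ J, π.rep b ≠ 0 := by
    by_contra! hc
    exact hJ fun a ha => (TwoSidedIdeal.mem_ker _).2 (hc a ha)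
  obtain ⟨a, haI, ha⟩ := hI'
  obtain ⟨b, hbJ, hb⟩ := hJ'
  let K : Submodule ℂ π.H :=
    { carrier := {ξ | ∀ c : A, π.rep a (π.rep c ξ) = 0 }
      add_mem' := fun {x y} hx hy c => by
        rw [map_add, map_add, hx c, hy c, add_zero]
      zero_mem' := fun c => by rw [map_zero, map_zero]
      smul_mem' := fun r x hx c => by rw [map_smul, map_smul, hx c, smul_zero] }
  have hKclosed : IsClosed (K : Set π.H) := by
    have : (K : Set π.H) = ⋂ c : A, {ξ | π.rep a (π.rep c ξ) = 0} := by
      ext ξ; simp [K]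
    rw [this]
    exact isClosed_iInter fun c => isClosed_eq (by fun_prop) continuous_const
  have hKinv : ∀ c, ∀ ξ ∈ K, π.rep c ξ ∈ K := fun c ξ hξ d => by
    have := hξ (d * c)
    rwa [map_mul] at this
  have hbK : ∀ ξ, π.rep b ξ ∈ K := fun ξ c => by
    have h1 : a * (c * b) ∈ TwoSidedIdeal.ker π.rep := by
      apply h
      rw [TwoSidedIdeal.mem_inf]
      refine ⟨I.mul_mem_right _ _ haI, ?_⟩
      rw [← mul_assoc]
      exact J.mul_mem_left _ _ hbJ
    have h2 := (TwoSidedIdeal.mem_ker _).1 h1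
    rw [map_mul, map_mul] at h2
    exact congrArg (fun T : π.H →L[ℂ] π.H => T ξ) h2
  rcases hirr.2 K hKclosed hKinv with hK | hK
  · apply hb
    ext ξ
    have := hbK ξ
    rw [hK] at this
    simpa using this
  · -- then `π(a)π(c) = 0` for all `c`, in particular `π(a a⋆) = 0`
    apply ha
    have h3 : π.rep (a * star a) = 0 := by
      ext ξ
      have : ξ ∈ K := by rw [hK]; trivial
      rw [map_mul]
      exact this (star a)
    rw [map_mul, map_star] at h3
    exact CStarRing.mul_star_self_eq_zero_iff _ |>.1 h3

/-- The Jacobson topology: the closed sets are the hulls of the (closed two-sided) ideals. -/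
instance : TopologicalSpace (Prim A) :=
  TopologicalSpace.ofClosed {Ω | ∃ J : TwoSidedIdeal A, IsClosed (J : Set A) ∧ hull J = Ω}
    ⟨⊤, by
        have : ((⊤ : TwoSidedIdeal A) : Set A) = Set.univ := by ext; simp
        rw [this]; exact isClosed_univ, by
      refine Set.eq_empty_of_forall_notMem fun P hP => ?_
      obtain ⟨P, π, hirr, rfl⟩ := P
      exact isIrreducibleRep_not_top hirr (mem_hull.1 hP)⟩
    (fun 𝒜 h𝒜 => by
      refine ⟨sInf {I | IsClosed (I : Set A) ∧
        ∀ J : TwoSidedIdeal A, IsClosed (J : Set A) → hull J ∈ 𝒜 → J ≤ I}, ?_, ?_⟩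
      · have : ((sInf {I : TwoSidedIdeal A | IsClosed (I : Set A) ∧
            ∀ J : TwoSidedIdeal A, IsClosed (J : Set A) → hull J ∈ 𝒜 → J ≤ I} :
            TwoSidedIdeal A) : Set A) = ⋂ I ∈ {I : TwoSidedIdeal A | IsClosed (I : Set A) ∧
            ∀ J : TwoSidedIdeal A, IsClosed (J : Set A) → hull J ∈ 𝒜 → J ≤ I}, (I : Set A) := by
          ext a
          simp [TwoSidedIdeal.mem_sInf]
        rw [this]
        exact isClosed_biInter fun I hI => hI.1
      · ext P
        simp only [Set.mem_sInter]
        constructor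
        · intro h Ω hΩ
          obtain ⟨J, hJ, rfl⟩ := h𝒜 hΩ
          refine mem_hull.2 (le_trans ?_ (mem_hull.1 h))
          exact le_sInf fun I hI => hI.2 J hJ hΩ
        · intro h
          exact mem_hull.2 <| sInf_le ⟨P.isClosed, fun J _ hJ' => mem_hull.1 (h _ hJ')⟩)
    (by
      rintro _ ⟨I, hI, rfl⟩ _ ⟨J, hJ, rfl⟩
      refine ⟨I ⊓ J, ?_, ?_⟩
      · have : ((I ⊓ J : TwoSidedIdeal A) : Set A) = (I : Set A) ∩ J := by
          ext a
          simp [TwoSidedIdeal.mem_inf]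
        rw [this]
        exact hI.inter hJ
      · ext P
        constructor
        · exact fun h => P.le_or_le I J (mem_hull.1 h)
        · rintro (h | h)
          · exact mem_hull.2 (inf_le_left.trans (mem_hull.1 h))
          · exact mem_hull.2 (inf_le_right.trans (mem_hull.1 h)))

theorem Prim.isClosed_iff {Ω : Set (Prim A)} :
    IsClosed Ω ↔ ∃ J : TwoSidedIdeal A, IsClosed (J : Set A) ∧ hull J = Ω := by
  rw [← isOpen_compl_iff]
  change Ωᶜᶜ ∈ _ ↔ _
  rw [compl_compl]
  rfl

end Prim

/-! ## Group C⋆-algebras of discrete groups -/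

section Group

variable {Γ : Type w} [Group Γ]

/-- The involution of the complex group algebra, `f⋆(g) = conj (f(g⁻¹))`. -/
noncomputable instance : Star (MonoidAlgebra ℂ Γ) :=
  ⟨fun f => .ofCoeff ((f.coeff.equivMapDomain (Equiv.inv Γ)).mapRange (starRingEnd ℂ) (map_zero _))⟩

theorem monoidAlgebra_star_apply (f : MonoidAlgebra ℂ Γ) (g : Γ) :
    (star f).coeff g = conj (f.coeff g⁻¹) := rfl

theorem monoidAlgebra_star_single (g : Γ) (c : ℂ) :
    star (MonoidAlgebra.single g c) = MonoidAlgebra.single g⁻¹ (conj c) := by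
  classical
  ext h
  rw [monoidAlgebra_star_apply]
  simp only [MonoidAlgebra.coeff_single, Finsupp.single_apply]
  by_cases hg : g = h⁻¹
  · subst hg; simp
  · have : ¬ g⁻¹ = h := fun h' => hg (by rw [← h', inv_inv])
    simp [hg, this]

@[elab_as_elim]
theorem monoidAlgebra_induction {q : MonoidAlgebra ℂ Γ → Prop} (f : MonoidAlgebra ℂ Γ)
    (h0 : q 0) (hs : ∀ g c, q (MonoidAlgebra.single g c)) (ha : ∀ f g, q f → q g → q (f + g)) :
    q f := by
  rw [← MonoidAlgebra.sum_coeff_single f]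
  exact Finset.sum_induction _ q ha h0 fun g _ => hs g _

theorem monoidAlgebra_star_add (f g : MonoidAlgebra ℂ Γ) : star (f + g) = star f + star g := by
  ext h
  simp [monoidAlgebra_star_apply]

noncomputable instance : StarRing (MonoidAlgebra ℂ Γ) where
  star_involutive f := by
    ext h
    simp [monoidAlgebra_star_apply]
  star_add := monoidAlgebra_star_add
  star_mul f g := by
    have hz : star (0 : MonoidAlgebra ℂ Γ) = 0 := by
      ext h
      simp [monoidAlgebra_star_apply]
    refine monoidAlgebra_induction f (by simp [hz]) (fun a c => ?_) fun f₁ f₂ h₁ h₂ => by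
      rw [add_mul, monoidAlgebra_star_add, h₁, h₂, monoidAlgebra_star_add, mul_add]
    refine monoidAlgebra_induction g (by simp [hz]) (fun b d => ?_) fun f₁ f₂ h₁ h₂ => by
      rw [mul_add, monoidAlgebra_star_add, h₁, h₂, monoidAlgebra_star_add, add_mul]
    rw [MonoidAlgebra.single_mul_single]
    simp only [monoidAlgebra_star_single, MonoidAlgebra.single_mul_single, mul_inv_rev, map_mul]
    rw [mul_comm]

instance : StarModule ℂ (MonoidAlgebra ℂ Γ) where
  star_smul c f := by
    ext h
    simp [monoidAlgebra_star_apply]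

theorem norm_rep_single_le {H : Type*} [NormedAddCommGroup H] [InnerProductSpace ℂ H]
    [CompleteSpace H] (π : MonoidAlgebra ℂ Γ →⋆ₙₐ[ℂ] (H →L[ℂ] H)) (g : Γ) (c : ℂ) :
    ‖π (MonoidAlgebra.single g c)‖ ≤ ‖c‖ := by
  have h1 : ‖π (MonoidAlgebra.single 1 1)‖ ≤ 1 := by
    have : ‖π (MonoidAlgebra.single 1 1)‖ * ‖π (MonoidAlgebra.single 1 1)‖ =
        ‖π (MonoidAlgebra.single 1 1)‖ := by
      rw [← CStarRing.norm_star_mul_self, ← map_star, ← map_mul, monoidAlgebra_star_single,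
        MonoidAlgebra.single_mul_single]
      simp
    nlinarith [norm_nonneg (π (MonoidAlgebra.single 1 1))]
  have h2 : ‖π (MonoidAlgebra.single g 1)‖ * ‖π (MonoidAlgebra.single g 1)‖ ≤ 1 := by
    rw [← CStarRing.norm_star_mul_self, ← map_star, ← map_mul, monoidAlgebra_star_single,
      MonoidAlgebra.single_mul_single]
    simpa using! h1
  have h3 : ‖π (MonoidAlgebra.single g 1)‖ ≤ 1 := by
    nlinarith [norm_nonneg (π (MonoidAlgebra.single g 1))]
  have h4 : MonoidAlgebra.single g c = c • MonoidAlgebra.single g (1 : ℂ) := by simp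
  rw [h4, map_smul, norm_smul]
  exact mul_le_of_le_one_right (norm_nonneg _) h3

instance : HasEnvelope (MonoidAlgebra ℂ Γ) where
  bddAbove f := by
    have key : ∃ C : ℝ, ∀ π : HilbertRep (MonoidAlgebra ℂ Γ), ‖π.rep f‖ ≤ C := by
      refine monoidAlgebra_induction f ⟨0, fun π => by simp⟩
        (fun g c => ⟨‖c‖, fun π => norm_rep_single_le π.rep g c⟩) ?_
      rintro f₁ f₂ ⟨C₁, h₁⟩ ⟨C₂, h₂⟩
      exact ⟨C₁ + C₂, fun π => by
        rw [map_add]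
        exact (norm_add_le _ _).trans (add_le_add (h₁ π) (h₂ π))⟩
    obtain ⟨C, hC⟩ := key
    exact ⟨C, by rintro _ ⟨π, rfl⟩; exact hC π⟩

variable (Γ) in
/-- The full C⋆-algebra `C⋆(Γ)` of the discrete group `Γ`. -/
abbrev GroupCStar : Type w := Envelope (MonoidAlgebra ℂ Γ)

variable (Γ) in
/-- A unitary representation of the discrete group `Γ`. -/
structure UnitaryRep where
  /-- the underlying Hilbert space -/
  H : Type w
  [normed : NormedAddCommGroup H]
  [inner : InnerProductSpace ℂ H]
  [complete : CompleteSpace H]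
  /-- the homomorphism into the unitary group -/
  rep : Γ →* unitary (H →L[ℂ] H)

attribute [instance] UnitaryRep.normed UnitaryRep.inner UnitaryRep.complete

/-- The extension `∑ c_g g ↦ ∑ c_g π(g)` of a unitary representation to the group algebra. -/
noncomputable def UnitaryRep.toGroupAlgebra (π : UnitaryRep Γ) :
    MonoidAlgebra ℂ Γ →⋆ₙₐ[ℂ] (π.H →L[ℂ] π.H) where
  toFun := MonoidAlgebra.lift ℂ (π.H →L[ℂ] π.H) Γ ((unitary (π.H →L[ℂ] π.H)).subtype.comp π.rep)
  map_smul' := map_smul _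
  map_zero' := map_zero _
  map_add' := map_add _
  map_mul' := map_mul _
  map_star' f := by
    refine monoidAlgebra_induction f (by simp) (fun g c => ?_) fun f₁ f₂ h₁ h₂ => by
      rw [star_add, map_add, h₁, h₂, map_add, star_add]
    rw [monoidAlgebra_star_single, MonoidAlgebra.lift_single, MonoidAlgebra.lift_single]
    rw [star_smul]
    simp
    rfl

theorem UnitaryRep.toGroupAlgebra_single (π : UnitaryRep Γ) (g : Γ) (c : ℂ) :
    π.toGroupAlgebra (MonoidAlgebra.single g c) = c • (π.rep g : π.H →L[ℂ] π.H) :=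
  MonoidAlgebra.lift_single _ _ _

/-- The extension of a unitary representation of `Γ` to `C⋆(Γ)`. -/
noncomputable def UnitaryRep.toCStar (π : UnitaryRep Γ) :
    GroupCStar Γ →⋆ₙₐ[ℂ] (π.H →L[ℂ] π.H) :=
  extendRep π.toGroupAlgebra

/-- Every irreducible representation of `C⋆(Γ)` comes from a unitary representation of `Γ`. -/
theorem exists_unitaryRep (J : Prim (GroupCStar Γ)) :
    ∃ π : UnitaryRep Γ, IsIrreducibleRep π.toCStar ∧ TwoSidedIdeal.ker π.toCStar = J.1 := by
  obtain ⟨J, σ, hirr, rfl⟩ := J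
  let p := fullSeminorm (MonoidAlgebra ℂ Γ)
  let ι := CStarSeminorm.Completion.of p
  have ιmul := CStarSeminorm.Completion.of_mul p
  have hσc : Continuous σ.rep := by
    have : LipschitzWith 1 σ.rep := LipschitzWith.of_dist_le_mul fun a b => by
      rw [dist_eq_norm, dist_eq_norm, ← map_sub, NNReal.coe_one, one_mul]
      exact NonUnitalStarAlgHom.norm_apply_le σ.rep (a - b)
    exact this.continuous
  have hmulone : ∀ a : GroupCStar Γ, a * ι 1 = a := fun a => by
    refine CStarSeminorm.Completion.induction_on p a
      (isClosed_eq (by fun_prop) continuous_id) fun a => ?_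
    rw [← ιmul, mul_one]
  have honemul : ι 1 * ι 1 = ι 1 := by rw [← ιmul, mul_one]
  let e := σ.rep (ι 1)
  have he : ∀ ξ, e (e ξ) = e ξ := fun ξ => by
    have := congrArg σ.rep honemul
    rw [map_mul] at this
    exact congrArg (fun T : σ.H →L[ℂ] σ.H => T ξ) this
  have hae : ∀ a ξ, σ.rep a (e ξ) = σ.rep a ξ := fun a ξ => by
    have := congrArg σ.rep (hmulone a)
    rw [map_mul] at this
    exact congrArg (fun T : σ.H →L[ℂ] σ.H => T ξ) this
  have hker : LinearMap.ker e.toLinearMap = ⊥ := by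
    rcases hirr.2 (LinearMap.ker e.toLinearMap) (ContinuousLinearMap.isClosed_ker e)
      (fun a ξ hξ => by
        have h0 : e ξ = 0 := hξ
        have : σ.rep a ξ = 0 := by rw [← hae, h0, map_zero]
        rw [this]; exact zero_mem _) with h | h
    · exact h
    · exfalso
      obtain ⟨a, ha⟩ := hirr.1
      apply ha
      ext ξ
      have h0 : e ξ = 0 := by
        have : ξ ∈ LinearMap.ker e.toLinearMap := by rw [h]; trivial
        exact this
      rw [← hae, h0, map_zero]
      rfl
  have heone : e = 1 := by
    ext ξ
    have : e ξ - ξ ∈ LinearMap.ker e.toLinearMap := by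
      change e (e ξ - ξ) = 0
      rw [map_sub, he, sub_self]
    rw [hker, Submodule.mem_bot, sub_eq_zero] at this
    exact this
  have hg : ∀ g h : Γ, σ.rep (ι (MonoidAlgebra.single g 1)) * σ.rep (ι (MonoidAlgebra.single h 1))
      = σ.rep (ι (MonoidAlgebra.single (g * h) 1)) := fun g h => by
    rw [← map_mul, ← ιmul, MonoidAlgebra.single_mul_single, one_mul]
  have hst : ∀ g : Γ, star (σ.rep (ι (MonoidAlgebra.single g 1))) =
      σ.rep (ι (MonoidAlgebra.single g⁻¹ 1)) := fun g => by
    rw [← map_star, ← CStarSeminorm.Completion.of_star, monoidAlgebra_star_single, map_one]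
  have hone : σ.rep (ι (MonoidAlgebra.single 1 1)) = 1 := heone
  let π : UnitaryRep Γ :=
    { H := σ.H
      rep :=
        { toFun := fun g => ⟨σ.rep (ι (MonoidAlgebra.single g 1)), by
            rw [Unitary.mem_iff, hst, hg, hg, inv_mul_cancel, mul_inv_cancel]
            exact ⟨hone, hone⟩⟩
          map_one' := Subtype.ext hone
          map_mul' := fun g h => Subtype.ext (hg g h).symm } }
  have hπ : π.toCStar = σ.rep := by
    ext1 a
    refine CStarSeminorm.Completion.induction_on p a
      (isClosed_eq (continuous_extendRep _) hσc) fun a => ?_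
    rw [UnitaryRep.toCStar, extendRep_of]
    refine monoidAlgebra_induction a ?_ (fun g c => ?_) fun f₁ f₂ h₁ h₂ => ?_
    · rw [CStarSeminorm.Completion.of_zero, map_zero, map_zero]
    · rw [UnitaryRep.toGroupAlgebra_single]
      have h4 : MonoidAlgebra.single g c = c • MonoidAlgebra.single g (1 : ℂ) := by simp
      rw [h4, CStarSeminorm.Completion.of_smul, map_smul]
      rfl
    · rw [map_add, CStarSeminorm.Completion.of_add, map_add, h₁, h₂]
  exact ⟨π, by rw [hπ]; exact hirr, by rw [hπ]⟩

end Group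

end EtaleCStar

namespace EtaleCStar

open CategoryTheory Set
open Quiver (Total)

/-! ## Étale groupoids

A groupoid with unit space `X` is a Mathlib groupoid structure on `X`, its set of arrows is
`Quiver.Total X`. A morphism `g : x ⟶ y` is regarded as an arrow with range `x` and source `y`, so
that the product `g h` of arrows, defined when the source of `g` is the range of `h`, is `g ≫ h`
(in the same order), and the isotropy group at `x` is the vertex group `x ⟶ x`. -/

section Groupoid

variable {X : Type u} [Groupoid.{v} X]

/-- The range of an arrow. -/
abbrev rng (g : Total X) : X := g.left

/-- The source of an arrow. -/
abbrev src (g : Total X) : X := g.right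

/-- The unit at `x`. -/
def unit (x : X) : Total X := ⟨x, x, 𝟙 x⟩

/-- The inverse of an arrow. -/
def inverse (g : Total X) : Total X := ⟨g.right, g.left, Groupoid.inv g.hom⟩

variable (X) in
/-- The composable pairs of arrows. -/
abbrev Composable : Type _ := {p : Total X × Total X // src p.1 = rng p.2}

/-- The product of a composable pair of arrows. -/
def product (p : Composable X) : Total X :=
  ⟨p.1.1.left, p.1.2.right, p.1.1.hom ≫ eqToHom p.2 ≫ p.1.2.hom⟩

/-- A bisection: a set of arrows on which both the range and the source map are injective. -/
def IsBisection (W : Set (Total X)) : Prop := InjOn rng W ∧ InjOn src W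

/-- The arrows with source `x`. -/
abbrev SourceFiber (x : X) : Type _ := Σ y : X, (y ⟶ x)

/-- The arrows with range `x`. -/
abbrev RangeFiber (x : X) : Type _ := Σ y : X, (x ⟶ y)

@[simp] theorem range_inverse (g : Total X) : rng (inverse g) = src g := rfl
@[simp] theorem source_inverse (g : Total X) : src (inverse g) = rng g := rfl
@[simp] theorem inverse_inverse (g : Total X) : inverse (inverse g) = g := by
  obtain ⟨a, b, g⟩ := g
  simp [inverse]

end Groupoid

/-- A Hausdorff locally compact étale groupoid with unit space `X`. -/
class EtaleGroupoid (X : Type u) [TopologicalSpace X] [Groupoid.{v} X]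
    [TopologicalSpace (Total X)] : Prop where
  t2Space : T2Space (Total X)
  locallyCompactSpace : LocallyCompactSpace (Total X)
  continuous_product : Continuous (product : Composable X → Total X)
  continuous_inverse : Continuous (inverse : Total X → Total X)
  continuous_unit : Continuous (unit : X → Total X)
  isLocalHomeomorph_range : IsLocalHomeomorph (rng : Total X → X)
  isLocalHomeomorph_source : IsLocalHomeomorph (src : Total X → X)

attribute [instance] EtaleGroupoid.t2Space EtaleGroupoid.locallyCompactSpace

/-! ## The convolution algebra -/

/-- The space of continuous compactly supported functions on (the arrow space of) a groupoid. -/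
def ConvAlg (X : Type u) [Groupoid.{v} X] [TopologicalSpace (Total X)] : Type (max u v) :=
  CompactlySupportedContinuousMap (Total X) ℂ

section ConvAlg

variable {X : Type u} [Groupoid.{v} X] [TopologicalSpace (Total X)]

namespace ConvAlg

instance : FunLike (ConvAlg X) (Total X) ℂ :=
  inferInstanceAs (FunLike (CompactlySupportedContinuousMap (Total X) ℂ) _ _)
noncomputable instance : AddCommGroup (ConvAlg X) :=
  inferInstanceAs (AddCommGroup (CompactlySupportedContinuousMap (Total X) ℂ))
noncomputable instance : Module ℂ (ConvAlg X) :=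
  inferInstanceAs (Module ℂ (CompactlySupportedContinuousMap (Total X) ℂ))

@[ext] theorem ext {f g : ConvAlg X} (h : ∀ x, f x = g x) : f = g := DFunLike.ext _ _ h

@[simp] theorem add_apply (f g : ConvAlg X) (x : Total X) : (f + g) x = f x + g x := rfl
@[simp] theorem smul_apply (c : ℂ) (f : ConvAlg X) (x : Total X) : (c • f) x = c * f x := rfl
@[simp] theorem zero_apply (x : Total X) : (0 : ConvAlg X) x = 0 := rfl

theorem continuous (f : ConvAlg X) : Continuous f :=
  (f : CompactlySupportedContinuousMap (Total X) ℂ).toContinuousMap.continuous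
theorem hasCompactSupport (f : ConvAlg X) : HasCompactSupport f :=
  CompactlySupportedContinuousMap.hasCompactSupport
    (f : CompactlySupportedContinuousMap (Total X) ℂ)

/-- Constructor for elements of the convolution algebra. -/
def mk (f : Total X → ℂ) (hf : Continuous f) (hc : HasCompactSupport f) : ConvAlg X :=
  (⟨⟨f, hf⟩, hc⟩ : CompactlySupportedContinuousMap (Total X) ℂ)

@[simp] theorem mk_apply (f : Total X → ℂ) (hf : Continuous f) (hc : HasCompactSupport f)
    (x : Total X) : mk f hf hc x = f x := rfl

/-- The support of `f` is contained in the open bisection `W`. -/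
structure SupportedOn (f : ConvAlg X) (W : Set (Total X)) : Prop where
  isOpen : IsOpen W
  isBisection : IsBisection W
  tsupport_subset : tsupport f ⊆ W

theorem SupportedOn.mem {f : ConvAlg X} {W : Set (Total X)} (h : f.SupportedOn W) {g : Total X}
    (hg : f g ≠ 0) : g ∈ W :=
  h.tsupport_subset (subset_tsupport _ hg)

variable [TopologicalSpace X] [EtaleGroupoid X]

theorem exists_isBisection (g : Total X) : ∃ W, IsOpen W ∧ IsBisection W ∧ g ∈ W := by
  obtain ⟨U, hU, hgU, hi⟩ :=
    (EtaleGroupoid.isLocalHomeomorph_range (X := X)).isLocallyInjective g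
  obtain ⟨V, hV, hgV, hj⟩ :=
    (EtaleGroupoid.isLocalHomeomorph_source (X := X)).isLocallyInjective g
  exact ⟨U ∩ V, hU.inter hV, ⟨hi.mono inter_subset_left, hj.mono inter_subset_right⟩, hgU, hgV⟩

/-- Every element of the convolution algebra is a finite sum of functions supported on open
bisections. -/
theorem induction {q : ConvAlg X → Prop} (f : ConvAlg X) (h0 : q 0)
    (hadd : ∀ f g, q f → q g → q (f + g))
    (hs : ∀ f W, SupportedOn f W → q f) : q f := by
  choose W hWo hWb hgW using exists_isBisection (X := X)
  obtain ⟨t, ht⟩ := f.hasCompactSupport.elim_finite_subcover W hWo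
    (fun g _ => mem_iUnion.2 ⟨g, hgW g⟩)
  let e := t.equivFin
  obtain ⟨φ, hφ, hsum, -, -⟩ := exists_continuous_sum_one_of_isOpen_isCompact
    (s := fun i : Fin t.card => W (e.symm i)) (fun i => hWo _) f.hasCompactSupport (by
      intro g hg
      obtain ⟨a, ha⟩ := mem_iUnion.1 (ht hg)
      obtain ⟨hat, hga⟩ := mem_iUnion.1 ha
      exact mem_iUnion.2 ⟨e ⟨a, hat⟩, by simpa using hga⟩)
  let F : Fin t.card → ConvAlg X := fun i =>
    mk (fun g => (φ i g : ℂ) * f g)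
      ((Complex.continuous_ofReal.comp (φ i).continuous).mul f.continuous)
      f.hasCompactSupport.mul_left
  have hF : ∀ i, q (F i) := fun i => hs _ (W (e.symm i)) ⟨hWo _, hWb _, by
    refine (closure_mono ?_).trans (hφ i)
    intro g hg
    have : (φ i g : ℂ) * f g ≠ 0 := hg
    simp only [ne_eq, mul_eq_zero, not_or, Complex.ofReal_eq_zero] at this
    exact this.1⟩
  have hfF : f = ∑ i, F i := by
    ext g
    have h1 : (∑ i, F i) g = ∑ i, F i g :=
      CompactlySupportedContinuousMap.sum_apply (Finset.univ)
        (fun i => (F i : CompactlySupportedContinuousMap (Total X) ℂ)) g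
    rw [h1]
    simp only [F, mk_apply]
    rw [← Finset.sum_mul]
    by_cases hg : g ∈ tsupport f
    · have := hsum hg
      simp only [Finset.sum_apply, Pi.one_apply] at this
      rw [← Complex.ofReal_sum, this]
      simp
    · rw [image_eq_zero_of_notMem_tsupport hg, mul_zero]
  rw [hfF]
  exact Finset.sum_induction _ q (hadd) h0 fun i _ => hF i

end ConvAlg

/-! ### The action on functions on source fibres -/

section Act

variable {E : Type*} [AddCommGroup E] [Module ℂ E]

/-- The function `g ↦ ∑_{h ∈ G^{r(g)}} f(h) ξ(h⁻¹ g)` on `G_x`, for a function `ξ` on `G_x`. -/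
noncomputable def act {x : X} (f : ConvAlg X) (ξ : SourceFiber x → E) : SourceFiber x → E :=
  fun g => ∑ᶠ h : RangeFiber g.1, f ⟨g.1, h.1, h.2⟩ • ξ ⟨h.1, Groupoid.inv h.2 ≫ g.2⟩

variable {x : X}

theorem act_eq_zero {f : ConvAlg X} {ξ : SourceFiber x → E} {g : SourceFiber x}
    (h : ∀ k : RangeFiber g.1, f ⟨g.1, k.1, k.2⟩ = 0) : act f ξ g = 0 := by
  simp only [act, h, zero_smul, finsum_zero]

theorem act_eq_single {f : ConvAlg X} {W : Set (Total X)} (hf : f.SupportedOn W)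
    (ξ : SourceFiber x → E) (g : SourceFiber x) (k : RangeFiber g.1)
    (hk : (⟨g.1, k.1, k.2⟩ : Total X) ∈ W) :
    act f ξ g = f ⟨g.1, k.1, k.2⟩ • ξ ⟨k.1, Groupoid.inv k.2 ≫ g.2⟩ := by
  refine finsum_eq_single _ k fun l hl => ?_
  by_cases h0 : f ⟨g.1, l.1, l.2⟩ = 0
  · rw [h0, zero_smul]
  · exfalso
    apply hl
    have := hf.isBisection.1 (hf.mem h0) hk rfl
    obtain ⟨y, l⟩ := l
    obtain ⟨z, k⟩ := k
    simp only [Total.mk.injEq, true_and] at this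
    obtain ⟨rfl, h2⟩ := this
    rw [eq_of_heq h2]

variable [TopologicalSpace X] [EtaleGroupoid X]

theorem finite_rangeFiber (f : ConvAlg X) (x : X) :
    {h : RangeFiber x | f ⟨x, h.1, h.2⟩ ≠ 0}.Finite := by
  induction f using ConvAlg.induction with
  | h0 => simp
  | hadd f g hf hg =>
    refine (hf.union hg).subset fun h hh => ?_
    by_contra hcon
    simp only [mem_union, not_or] at hcon
    apply hh
    have h1 : f ⟨x, h.1, h.2⟩ = 0 := not_not.1 hcon.1
    have h2 : g ⟨x, h.1, h.2⟩ = 0 := not_not.1 hcon.2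
    rw [ConvAlg.add_apply, h1, h2, add_zero]
  | hs f W hf =>
    refine Set.Subsingleton.finite fun l hl k hk => ?_
    have := hf.isBisection.1 (hf.mem hl) (hf.mem hk) rfl
    obtain ⟨y, l⟩ := l
    obtain ⟨z, k⟩ := k
    simp only [Total.mk.injEq, true_and] at this
    obtain ⟨rfl, h2⟩ := this
    rw [eq_of_heq h2]

theorem finite_support_act (f : ConvAlg X) (ξ : SourceFiber x → E) (g : SourceFiber x) :
    Function.HasFiniteSupport fun h : RangeFiber g.1 =>
      f ⟨g.1, h.1, h.2⟩ • ξ ⟨h.1, Groupoid.inv h.2 ≫ g.2⟩ := by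
  refine (finite_rangeFiber f g.1).subset fun h hh h0 => hh ?_
  simp only [h0, zero_smul]

theorem act_add_left (f₁ f₂ : ConvAlg X) (ξ : SourceFiber x → E) :
    act (f₁ + f₂) ξ = act f₁ ξ + act f₂ ξ := by
  funext g
  simp only [act, ConvAlg.add_apply, add_smul, Pi.add_apply]
  exact finsum_add_distrib (finite_support_act f₁ ξ g) (finite_support_act f₂ ξ g)

theorem act_zero_left (ξ : SourceFiber x → E) : act (0 : ConvAlg X) ξ = 0 := by
  funext g
  simp [act]

theorem act_smul_left (c : ℂ) (f : ConvAlg X) (ξ : SourceFiber x → E) :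
    act (c • f) ξ = c • act f ξ := by
  funext g
  simp only [act, ConvAlg.smul_apply, mul_smul, Pi.smul_apply]
  exact (smul_finsum' c (finite_support_act f ξ g)).symm

theorem act_add_right (f : ConvAlg X) (ξ η : SourceFiber x → E) :
    act f (ξ + η) = act f ξ + act f η := by
  funext g
  simp only [act, Pi.add_apply, smul_add]
  exact finsum_add_distrib (finite_support_act f ξ g) (finite_support_act f η g)

theorem act_smul_right (c : ℂ) (f : ConvAlg X) (ξ : SourceFiber x → E) :
    act f (c • ξ) = c • act f ξ := by
  funext g
  simp only [act, Pi.smul_apply]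
  rw [smul_finsum' c (finite_support_act f ξ g)]
  exact finsum_congr fun h => smul_comm _ _ _

end Act

namespace ConvAlg

/-- The convolution `(f₁ * f₂)(g) = ∑_{h ∈ G^{r(g)}} f₁(h) f₂(h⁻¹ g)`. -/
noncomputable def conv (f₁ f₂ : ConvAlg X) (g : Total X) : ℂ :=
  ∑ᶠ h : RangeFiber (rng g),
    f₁ ⟨rng g, h.1, h.2⟩ * f₂ ⟨h.1, src g, Groupoid.inv h.2 ≫ g.hom⟩

theorem conv_eq_act (f₁ f₂ : ConvAlg X) (g : Total X) :
    conv f₁ f₂ g =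
      act f₁ (fun k : SourceFiber (src g) => f₂ ⟨k.1, src g, k.2⟩) ⟨g.left, g.hom⟩ := rfl

theorem conv_eq_single {f₁ : ConvAlg X} {W : Set (Total X)} (hf : f₁.SupportedOn W)
    (f₂ : ConvAlg X) (g k : Total X) (hk : k ∈ W) (hkg : src (inverse k) = rng g) :
    conv f₁ f₂ g = f₁ k * f₂ (product ⟨(inverse k, g), hkg⟩) := by
  obtain ⟨a, b, k⟩ := k
  obtain ⟨c, d, g⟩ := g
  obtain rfl : a = c := hkg
  rw [conv_eq_act]
  have := act_eq_single hf (fun k : SourceFiber d => f₂ ⟨k.1, d, k.2⟩) ⟨a, g⟩ ⟨b, k⟩ hk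
  rw [this, smul_eq_mul]
  congr 3
  simp [inverse]

variable [TopologicalSpace X] [EtaleGroupoid X]

theorem t2Space_units : T2Space X :=
  T2Space.of_injective_continuous
    (f := (unit : X → Total X)) (fun _ _ h => congrArg Total.left h) EtaleGroupoid.continuous_unit

theorem continuous_range : Continuous (rng : Total X → X) :=
  (EtaleGroupoid.isLocalHomeomorph_range (X := X)).continuous

theorem continuous_source : Continuous (src : Total X → X) :=
  (EtaleGroupoid.isLocalHomeomorph_source (X := X)).continuous

theorem conv_add_left (f₁ f₂ f₃ : ConvAlg X) :
    conv (f₁ + f₂) f₃ = conv f₁ f₃ + conv f₂ f₃ := by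
  funext g
  simp only [conv_eq_act, act_add_left, Pi.add_apply]

theorem continuous_conv (f₁ f₂ : ConvAlg X) : Continuous (conv f₁ f₂) := by
  have := t2Space_units (X := X)
  induction f₁ using ConvAlg.induction with
  | h0 =>
    have : conv 0 f₂ = fun _ => 0 := by
      funext g
      rw [conv_eq_act, act_zero_left]
      rfl
    rw [this]
    exact continuous_const
  | hadd f g hf hg =>
    rw [conv_add_left]
    exact hf.add hg
  | hs f W hf =>
    rw [continuous_iff_continuousAt]
    intro g
    have hK : IsCompact (rng '' tsupport f) :=
      f.hasCompactSupport.isCompact.image continuous_range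
    by_cases hg : rng g ∈ rng '' tsupport f
    · obtain ⟨k, hk, hkg⟩ := hg
      obtain ⟨e, hke, he⟩ := EtaleGroupoid.isLocalHomeomorph_range (X := X) k
      let e' := e.restr W
      have hW : interior W = W := hf.isOpen.interior_eq
      have hke' : k ∈ e'.source := by
        rw [e.restr_source, hW]
        exact ⟨hke, hf.tsupport_subset hk⟩
      let V : Set (Total X) := rng ⁻¹' e'.target
      have hVo : IsOpen V := e'.open_target.preimage continuous_range
      have hgV : g ∈ V := by
        change rng g ∈ e'.target
        rw [← hkg]
        have := e'.map_source hke'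
        have h2 : e' k = rng k := by
          change e k = rng k
          rw [he]
        rwa [h2] at this
      have hs : ∀ l : V, src (inverse (e'.symm (rng l.1))) = rng l.1 := fun l => by
        have h1 := e'.right_inv l.2
        have h2 : e' (e'.symm (rng l.1)) = rng (e'.symm (rng l.1)) := by
          change e _ = rng _
          rw [he]
        rw [source_inverse, ← h2, h1]
      have hmem : ∀ l : V, e'.symm (rng l.1) ∈ W := fun l => by
        have := e'.map_target l.2
        rw [e.restr_source, hW] at this
        exact this.2
      have hcσ : Continuous fun l : V => e'.symm (rng l.1) := by
        have := e'.continuousOn_symm.comp_continuous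
          (continuous_range.comp (continuous_subtype_val : Continuous ((↑) : V → Total X)))
          (fun l => l.2)
        exact this
      have hc : ContinuousOn (conv f f₂) V := by
        rw [continuousOn_iff_continuous_domRestrict]
        have heq : V.domRestrict (conv f f₂) = fun l : V => f (e'.symm (rng l.1)) *
            f₂ (product ⟨(inverse (e'.symm (rng l.1)), l.1), hs l⟩) := by
          funext l
          exact conv_eq_single hf f₂ l.1 _ (hmem l) (hs l)
        rw [heq]
        refine (f.continuous.comp hcσ).mul (f₂.continuous.comp ?_)
        refine EtaleGroupoid.continuous_product.comp (Continuous.subtype_mk ?_ _)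
        exact (EtaleGroupoid.continuous_inverse.comp hcσ).prodMk continuous_subtype_val
      exact hc.continuousAt (hVo.mem_nhds hgV)
    · have hev : ∀ᶠ l in 𝓝 g, conv f f₂ l = 0 := by
        have hO : IsOpen (rng ⁻¹' (rng '' tsupport f)ᶜ : Set (Total X)) :=
          hK.isClosed.isOpen_compl.preimage continuous_range
        filter_upwards [hO.mem_nhds hg] with l hl
        rw [conv_eq_act]
        refine act_eq_zero fun k => ?_
        by_contra h0
        exact hl ⟨_, subset_tsupport _ h0, rfl⟩
      have : conv f f₂ =ᶠ[𝓝 g] fun _ => 0 := hev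
      exact (continuousAt_congr this).2 continuousAt_const

theorem hasCompactSupport_conv (f₁ f₂ : ConvAlg X) : HasCompactSupport (conv f₁ f₂) := by
  have := t2Space_units (X := X)
  have hcl : IsClosed {p : Total X × Total X | src p.1 = rng p.2} :=
    isClosed_eq (continuous_source.comp continuous_fst) (continuous_range.comp continuous_snd)
  have hK : IsCompact {p : Composable X | p.1.1 ∈ tsupport f₁ ∧ p.1.2 ∈ tsupport f₂} :=
    hcl.isClosedEmbedding_subtypeVal.isCompact_preimage
      (f₁.hasCompactSupport.isCompact.prod f₂.hasCompactSupport.isCompact)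
  refine HasCompactSupport.intro (hK.image EtaleGroupoid.continuous_product) fun g hg => ?_
  refine (finsum_congr fun h => ?_).trans finsum_zero
  by_contra h0
  obtain ⟨h1, h2⟩ := mul_ne_zero_iff.1 h0
  apply hg
  refine ⟨⟨(⟨rng g, h.1, h.2⟩, ⟨h.1, src g, Groupoid.inv h.2 ≫ g.hom⟩), rfl⟩,
    ⟨subset_tsupport _ h1, subset_tsupport _ h2⟩, ?_⟩
  obtain ⟨a, b, g⟩ := g
  simp [product]

noncomputable instance : Mul (ConvAlg X) :=
  ⟨fun f₁ f₂ => mk (conv f₁ f₂) (continuous_conv f₁ f₂) (hasCompactSupport_conv f₁ f₂)⟩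

theorem mul_apply (f₁ f₂ : ConvAlg X) (g : Total X) : (f₁ * f₂) g = conv f₁ f₂ g := rfl

/-- The involution `f⋆(g) = conj (f(g⁻¹))`. -/
noncomputable instance : Star (ConvAlg X) :=
  ⟨fun f => mk (fun g => conj (f (inverse g)))
    (Complex.continuous_conj.comp (f.continuous.comp EtaleGroupoid.continuous_inverse)) (by
      let e : Total X ≃ₜ Total X :=
        ⟨⟨inverse, inverse, inverse_inverse, inverse_inverse⟩,
          EtaleGroupoid.continuous_inverse, EtaleGroupoid.continuous_inverse⟩
      have h1 : HasCompactSupport (f ∘ e) :=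
        f.hasCompactSupport.comp_isClosedEmbedding e.isClosedEmbedding
      exact h1.comp_left (g := starRingEnd ℂ) (map_zero _))⟩

theorem star_apply (f : ConvAlg X) (g : Total X) : (star f) g = conj (f (inverse g)) := rfl

end ConvAlg

section ActMul

variable [TopologicalSpace X] [EtaleGroupoid X] {E : Type*} [AddCommGroup E] [Module ℂ E] {x : X}

theorem ConvAlg.add_mul' (f₁ f₂ f₃ : ConvAlg X) : (f₁ + f₂) * f₃ = f₁ * f₃ + f₂ * f₃ := by
  ext g
  rw [ConvAlg.add_apply]
  simp only [ConvAlg.mul_apply, ConvAlg.conv_add_left, Pi.add_apply]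

theorem ConvAlg.zero_mul' (f : ConvAlg X) : 0 * f = 0 := by
  ext g
  rw [ConvAlg.mul_apply, ConvAlg.conv_eq_act, act_zero_left]
  rfl

/-- Composition with an arrow, as a bijection of range fibres. -/
def compRangeFiber {y z : X} (k : y ⟶ z) : RangeFiber z ≃ RangeFiber y where
  toFun l := ⟨l.1, k ≫ l.2⟩
  invFun l := ⟨l.1, Groupoid.inv k ≫ l.2⟩
  left_inv l := by simp
  right_inv l := by simp

theorem act_mul (f₁ f₂ : ConvAlg X) (ξ : SourceFiber x → E) :
    act (f₁ * f₂) ξ = act f₁ (act f₂ ξ) := by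
  induction f₁ using ConvAlg.induction with
  | h0 => rw [ConvAlg.zero_mul', act_zero_left, act_zero_left]
  | hadd f g hf hg => rw [ConvAlg.add_mul', act_add_left, act_add_left, hf, hg]
  | hs f W hf =>
    funext g
    obtain ⟨y, g⟩ := g
    by_cases hk : ∃ k : RangeFiber y, (⟨y, k.1, k.2⟩ : Total X) ∈ W
    · obtain ⟨k, hk⟩ := hk
      rw [act_eq_single hf _ ⟨y, g⟩ k hk]
      simp only [act]
      rw [smul_finsum' _ (finite_support_act f₂ ξ ⟨k.1, Groupoid.inv k.2 ≫ g⟩)]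
      rw [← finsum_comp_equiv (compRangeFiber k.2)]
      refine finsum_congr fun l => ?_
      rw [ConvAlg.mul_apply, ConvAlg.conv_eq_act, act_eq_single hf _ ⟨y, _⟩ k hk]
      simp [compRangeFiber, mul_smul]
    · have h0 : ∀ k : RangeFiber y, f ⟨y, k.1, k.2⟩ = 0 := fun k => by
        by_contra h
        exact hk ⟨k, hf.mem h⟩
      rw [act_eq_zero (g := ⟨y, g⟩) h0]
      refine act_eq_zero fun l => ?_
      rw [ConvAlg.mul_apply, ConvAlg.conv_eq_act, act_eq_zero]
      exact h0

noncomputable instance : NonUnitalRing (ConvAlg X) where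
  mul_assoc f₁ f₂ f₃ := by
    ext g
    rw [ConvAlg.mul_apply, ConvAlg.conv_eq_act, act_mul]
    rfl
  left_distrib f₁ f₂ f₃ := by
    ext g
    rw [ConvAlg.add_apply]
    simp only [ConvAlg.mul_apply, ConvAlg.conv_eq_act]
    rw [← Pi.add_apply, ← act_add_right]
    rfl
  right_distrib := ConvAlg.add_mul'
  zero_mul := ConvAlg.zero_mul'
  mul_zero f := by
    ext g
    rw [ConvAlg.mul_apply]
    simp [ConvAlg.conv]

instance : IsScalarTower ℂ (ConvAlg X) (ConvAlg X) where
  smul_assoc c f₁ f₂ := by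
    ext g
    change ((c • f₁) * f₂) g = (c • (f₁ * f₂)) g
    rw [ConvAlg.smul_apply, ConvAlg.mul_apply, ConvAlg.mul_apply, ConvAlg.conv_eq_act,
      act_smul_left]
    rfl

instance : SMulCommClass ℂ (ConvAlg X) (ConvAlg X) where
  smul_comm c f₁ f₂ := by
    ext g
    change (c • (f₁ * f₂)) g = (f₁ * (c • f₂)) g
    rw [ConvAlg.smul_apply, ConvAlg.mul_apply, ConvAlg.mul_apply, ConvAlg.conv_eq_act,
      ConvAlg.conv_eq_act, ← smul_eq_mul, ← Pi.smul_apply, ← act_smul_right]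
    rfl

noncomputable instance : StarRing (ConvAlg X) where
  star_involutive f := by
    ext g
    simp [ConvAlg.star_apply]
  star_add f₁ f₂ := by
    ext g
    simp [ConvAlg.star_apply]
  star_mul f₁ f₂ := by
    ext g
    obtain ⟨a, b, g⟩ := g
    rw [ConvAlg.star_apply, ConvAlg.mul_apply, ConvAlg.mul_apply]
    simp only [ConvAlg.conv, inverse]
    have hfin := (finite_support_act f₁ (fun k : SourceFiber a => f₂ ⟨k.1, a, k.2⟩)
      ⟨b, Groupoid.inv g⟩)
    have h1 := (starRingEnd ℂ).toAddMonoidHom.map_finsum hfin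
    simp only [smul_eq_mul] at h1
    refine h1.trans ?_
    rw [← finsum_comp_equiv (compRangeFiber g)]
    refine finsum_congr fun h => ?_
    simp [compRangeFiber, ConvAlg.star_apply, inverse, mul_comm]

instance : StarModule ℂ (ConvAlg X) where
  star_smul c f := by
    ext g
    simp [ConvAlg.star_apply]

end ActMul

end ConvAlg

end EtaleCStar

namespace EtaleCStar

open CategoryTheory Set
open Quiver (Total)

/-! ## The full groupoid C⋆-algebra -/

section Bound

variable {X : Type u} [Groupoid.{v} X] [TopologicalSpace (Total X)] [TopologicalSpace X]
  [EtaleGroupoid X]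

namespace ConvAlg

/-- A function vanishing outside the unit space. -/
def UnitSupported (f : ConvAlg X) : Prop := ∀ g, f g ≠ 0 → g ∈ Set.range (unit : X → Total X)

theorem exists_norm_le (f : ConvAlg X) : ∃ c : ℝ, 0 ≤ c ∧ ∀ g, ‖f g‖ ≤ c := by
  obtain ⟨c, hc⟩ := f.hasCompactSupport.exists_bound_of_continuous f.continuous
  exact ⟨max c 0, le_max_right _ _, fun g => (hc g).trans (le_max_left _ _)⟩

theorem UnitSupported.mul_apply {f : ConvAlg X} (hf : f.UnitSupported) (f' : ConvAlg X)
    (g : Total X) : (f * f') g = f (unit (rng g)) * f' g := by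
  obtain ⟨a, b, g⟩ := g
  rw [ConvAlg.mul_apply, conv]
  rw [finsum_eq_single _ (⟨a, 𝟙 a⟩ : RangeFiber a)]
  · simp [unit]
  · intro h hh
    by_cases h0 : f ⟨a, h.1, h.2⟩ = 0
    · rw [h0, zero_mul]
    · obtain ⟨y, hy⟩ := hf _ h0
      exfalso
      apply hh
      obtain ⟨z, h⟩ := h
      simp only [unit, Total.mk.injEq] at hy
      obtain ⟨rfl, rfl, h3⟩ := hy
      rw [eq_of_heq h3]

/-- The function `c - √(c² - |f|²)`. -/
noncomputable def aux (f : ConvAlg X) (c : ℝ) (hc : 0 ≤ c) : ConvAlg X :=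
  mk (fun g => ((c - √(c ^ 2 - ‖f g‖ ^ 2) : ℝ) : ℂ))
    (Complex.continuous_ofReal.comp (continuous_const.sub (Real.continuous_sqrt.comp
      (continuous_const.sub (f.continuous.norm.pow 2)))))
    (HasCompactSupport.intro f.hasCompactSupport fun g hg => by
      rw [image_eq_zero_of_notMem_tsupport hg, norm_zero, zero_pow two_ne_zero, sub_zero,
        Real.sqrt_sq hc, sub_self, Complex.ofReal_zero])

theorem norm_apply_le_of_unitSupported {H : Type*} [NormedAddCommGroup H] [InnerProductSpace ℂ H]
    [CompleteSpace H] (π : ConvAlg X →⋆ₙₐ[ℂ] (H →L[ℂ] H)) (f : ConvAlg X)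
    (hf : f.UnitSupported) (c : ℝ) (hc : 0 ≤ c) (hfc : ∀ g, ‖f g‖ ≤ c) : ‖π f‖ ≤ c := by
  let k := aux f c hc
  have hk : k.UnitSupported := fun g hg => by
    apply hf
    intro h0
    apply hg
    simp [k, aux, h0, Real.sqrt_sq hc]
  have hunit : ∀ x : X, inverse (unit x) = unit x := fun x => by simp [inverse, unit]
  have hsf : (star f).UnitSupported := fun g hg => by
    rw [star_apply] at hg
    obtain ⟨x, hx⟩ := hf (inverse g) (fun h => hg (by rw [h, map_zero]))
    exact ⟨x, by rw [← inverse_inverse g, ← hx, hunit]⟩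
  have hstark : star k = k := by
    ext g
    by_cases hg : g ∈ Set.range (unit : X → Total X)
    · obtain ⟨x, rfl⟩ := hg
      rw [star_apply, hunit]
      simp only [k, aux, mk_apply, Complex.conj_ofReal]
    · have h1 : k g = 0 := not_not.1 fun h => hg (hk g h)
      have h2 : k (inverse g) = 0 := not_not.1 fun h => by
        obtain ⟨x, hx⟩ := hk _ h
        exact hg ⟨x, by rw [← inverse_inverse g, ← hx, hunit]⟩
      rw [star_apply, h1, h2, map_zero]
  have hrel : star f * f = (2 * c : ℂ) • k - k * k := by
    rw [eq_sub_iff_add_eq]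
    ext g
    rw [add_apply, smul_apply, hsf.mul_apply, hk.mul_apply]
    by_cases hg : g ∈ Set.range (unit : X → Total X)
    · obtain ⟨x, rfl⟩ := hg
      have h1 : rng (unit x) = x := rfl
      rw [h1, star_apply, hunit]
      simp only [k, aux, mk_apply]
      rw [← Complex.normSq_eq_conj_mul_self, Complex.normSq_eq_norm_sq]
      have h2 : 0 ≤ c ^ 2 - ‖f (unit x)‖ ^ 2 := by
        have := hfc (unit x)
        nlinarith [norm_nonneg (f (unit x))]
      have h3 := Real.sq_sqrt h2
      norm_cast
      nlinarith
    · have h1 : k g = 0 := not_not.1 fun h => hg (hk g h)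
      have h2 : f g = 0 := not_not.1 fun h => hg (hf g h)
      rw [h1, h2]
      simp
  have hrel' := congrArg π hrel
  rw [map_mul, map_star, map_sub, map_smul, map_mul] at hrel'
  refine ContinuousLinearMap.opNorm_le_bound _ hc fun ξ => ?_
  have hsa : ∀ ξ η : H, inner ℂ (π k ξ) η = inner ℂ ξ (π k η) := fun ξ η => by
    have : star (π k) = π k := by rw [← map_star, hstark]
    rw [ContinuousLinearMap.star_eq_adjoint] at this
    conv_lhs => rw [← this]
    rw [ContinuousLinearMap.adjoint_inner_left]
  have h1 : ‖π f ξ‖ ^ 2 = 2 * c * RCLike.re (inner ℂ ξ (π k ξ)) - ‖π k ξ‖ ^ 2 := by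
    have h2 : (inner ℂ ξ ((star (π f) * π f) ξ)) =
        inner ℂ ξ (((2 * c : ℂ) • π k - π k * π k) ξ) := by rw [hrel']
    have h6 : (star (π f) * π f) ξ = ContinuousLinearMap.adjoint (π f) (π f ξ) := rfl
    have h7 : ((2 * c : ℂ) • π k - π k * π k) ξ = (2 * c : ℂ) • π k ξ - π k (π k ξ) := rfl
    rw [h6, h7, ContinuousLinearMap.adjoint_inner_right, inner_sub_right,
      inner_smul_right] at h2
    rw [← hsa ξ (π k ξ)] at h2
    rw [inner_self_eq_norm_sq_to_K, inner_self_eq_norm_sq_to_K] at h2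
    have h3 := congrArg Complex.re h2
    simpa [← Complex.ofReal_pow] using! h3
  have h4 : ‖(c : ℂ) • ξ - π k ξ‖ ^ 2 =
      c ^ 2 * ‖ξ‖ ^ 2 - 2 * c * RCLike.re (inner ℂ ξ (π k ξ)) + ‖π k ξ‖ ^ 2 := by
    rw [@norm_sub_sq ℂ, norm_smul, inner_smul_left]
    simp [mul_pow]
    ring
  have h5 : ‖π f ξ‖ ^ 2 ≤ (c * ‖ξ‖) ^ 2 := by
    nlinarith [sq_nonneg ‖(c : ℂ) • ξ - π k ξ‖]
  exact le_of_sq_le_sq h5 (by positivity)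

theorem SupportedOn.star_mul_self {f : ConvAlg X} {W : Set (Total X)} (hf : f.SupportedOn W) :
    (star f * f).UnitSupported ∧
      ∀ c : ℝ, (∀ g, ‖f g‖ ≤ c) → ∀ g, ‖(star f * f) g‖ ≤ c ^ 2 := by
  have key : ∀ g, (star f * f) g ≠ 0 → ∃ k : RangeFiber (rng g), 
      f (inverse ⟨rng g, k.1, k.2⟩) ≠ 0 ∧ f ⟨k.1, src g, Groupoid.inv k.2 ≫ g.hom⟩ ≠ 0 := by
    intro g hg
    by_contra! hcon
    apply hg
    rw [ConvAlg.mul_apply, conv]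
    refine (finsum_congr fun k => ?_).trans finsum_zero
    by_cases h0 : f (inverse ⟨rng g, k.1, k.2⟩) = 0
    · rw [star_apply, h0, map_zero, zero_mul]
    · rw [hcon k h0, mul_zero]
  have hu : (star f * f).UnitSupported := by
    intro g hg
    obtain ⟨k, h1, h2⟩ := key g hg
    have h3 := hf.isBisection.1 (hf.mem h1) (hf.mem h2) rfl
    obtain ⟨a, b, g⟩ := g
    obtain ⟨z, k⟩ := k
    simp only [inverse, Total.mk.injEq, true_and] at h3
    obtain ⟨hab, h3⟩ := h3
    have hab' : a = b := hab
    subst hab'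
    have h4 := eq_of_heq h3
    refine ⟨a, ?_⟩
    have : g = 𝟙 a := by
      have h5 : k ≫ Groupoid.inv k = k ≫ (Groupoid.inv k ≫ g) := congrArg (fun t => k ≫ t) h4
      simpa using h5.symm
    rw [this]
    rfl
  refine ⟨hu, fun c hc g => ?_⟩
  by_cases hg : (star f * f) g = 0
  · rw [hg, norm_zero]; positivity
  · obtain ⟨k, h1, h2⟩ := key g hg
    have h3 : (star f * f) g = conj (f (inverse ⟨rng g, k.1, k.2⟩)) *
        f ⟨k.1, src g, Groupoid.inv k.2 ≫ g.hom⟩ := by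
      rw [ConvAlg.mul_apply, conv]
      rw [finsum_eq_single _ k]
      · rw [star_apply]
      · intro l hl
        by_cases h0 : f (inverse ⟨rng g, l.1, l.2⟩) = 0
        · rw [star_apply, h0, map_zero, zero_mul]
        · exfalso
          apply hl
          have h6 := hf.isBisection.2 (hf.mem h0) (hf.mem h1) rfl
          obtain ⟨y, l⟩ := l
          obtain ⟨z, k⟩ := k
          have h7 := congrArg inverse h6
          rw [inverse_inverse, inverse_inverse] at h7
          simp only [Total.mk.injEq, true_and] at h7
          obtain ⟨rfl, h8⟩ := h7
          rw [eq_of_heq h8]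
    have hc0 : 0 ≤ c := (norm_nonneg _).trans (hc g)
    rw [h3, norm_mul, RCLike.norm_conj, sq]
    exact mul_le_mul (hc _) (hc _) (norm_nonneg _) hc0

theorem SupportedOn.norm_rep_le {f : ConvAlg X} {W : Set (Total X)} (hf : f.SupportedOn W)
    {c : ℝ} (hc : 0 ≤ c) (hfc : ∀ g, ‖f g‖ ≤ c) {H : Type*} [NormedAddCommGroup H]
    [InnerProductSpace ℂ H] [CompleteSpace H] (π : ConvAlg X →⋆ₙₐ[ℂ] (H →L[ℂ] H)) :
    ‖π f‖ ≤ c := by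
  have h1 := norm_apply_le_of_unitSupported π (star f * f) hf.star_mul_self.1 (c ^ 2)
    (by positivity) (hf.star_mul_self.2 c hfc)
  rw [map_mul, map_star, CStarRing.norm_star_mul_self, ← sq] at h1
  exact le_of_sq_le_sq h1 hc

/-- Every element of the convolution algebra has uniformly bounded norm in all representations. -/
theorem exists_norm_rep_le (f : ConvAlg X) :
    ∃ C : ℝ, ∀ π : HilbertRep (ConvAlg X), ‖π.rep f‖ ≤ C := by
  induction f using ConvAlg.induction with
  | h0 => exact ⟨0, fun π => by simp⟩
  | hadd f g hf hg =>
    obtain ⟨C₁, h₁⟩ := hf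
    obtain ⟨C₂, h₂⟩ := hg
    exact ⟨C₁ + C₂, fun π => by
      rw [map_add]
      exact (norm_add_le _ _).trans (add_le_add (h₁ π) (h₂ π))⟩
  | hs f W hf =>
    obtain ⟨c, hc, hfc⟩ := exists_norm_le f
    exact ⟨c, fun π => hf.norm_rep_le hc hfc π.rep⟩

end ConvAlg

instance : HasEnvelope (ConvAlg X) where
  bddAbove f := by
    obtain ⟨C, hC⟩ := f.exists_norm_rep_le
    exact ⟨C, by rintro _ ⟨π, rfl⟩; exact hC π⟩

variable (X) in
/-- The full groupoid C⋆-algebra: the completion of the convolution algebra in the norm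
`‖f‖ = sup_π ‖π(f)‖`, the supremum being over all representations on Hilbert spaces. -/
abbrev GroupoidCStar : Type (max u v) := Envelope (ConvAlg X)

end Bound

end EtaleCStar

namespace EtaleCStar

open CategoryTheory Set
open Quiver (Total)

/-! ## Induced representations -/

section Induced

variable {X : Type u} [Groupoid.{v} X] {x : X} (S : Subgroup (x ⟶ x))

/-- The equivalence relation on `G_x` whose classes are the cosets `g S`. -/
def cosetSetoid : Setoid (SourceFiber x) where
  r g g' := ∃ h ∈ S, g' = ⟨g.1, g.2 ≫ h⟩
  iseqv :=
    { refl := fun g => ⟨1, S.one_mem, by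
        obtain ⟨y, g⟩ := g
        change (⟨y, g⟩ : SourceFiber x) = ⟨y, g ≫ 𝟙 x⟩
        simp⟩
      symm := by
        rintro g _ ⟨h, hh, rfl⟩
        refine ⟨h⁻¹, S.inv_mem hh, ?_⟩
        obtain ⟨y, g⟩ := g
        change (⟨y, g⟩ : SourceFiber x) = ⟨y, (g ≫ h) ≫ Groupoid.inv h⟩
        simp
      trans := by
        rintro g _ _ ⟨h, hh, rfl⟩ ⟨k, hk, rfl⟩
        refine ⟨h * k, S.mul_mem hh hk, ?_⟩
        obtain ⟨y, g⟩ := g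
        change (⟨y, (g ≫ h) ≫ k⟩ : SourceFiber x) = ⟨y, g ≫ h ≫ k⟩
        simp }

/-- The coset space `G_x / S`. -/
abbrev CosetSpace : Type (max u v) := Quotient (cosetSetoid S)

variable {S} {H : Type w} [NormedAddCommGroup H] [InnerProductSpace ℂ H] [CompleteSpace H]
  (π : S →* unitary (H →L[ℂ] H))

/-- The functions `ξ : G_x → H` with `ξ(g h) = π(h)⋆ ξ(g)` for `h ∈ S` and
`∑_{g ∈ G_x/S} ‖ξ(g)‖² < ∞`. The sum is over any system of representatives of the cosets. -/
noncomputable def indSubmodule : Submodule ℂ (SourceFiber x → H) where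
  carrier := {ξ | (∀ (g : SourceFiber x) (h : S),
      ξ ⟨g.1, g.2 ≫ (h : x ⟶ x)⟩ = star (π h : H →L[ℂ] H) (ξ g)) ∧
    Summable fun q : CosetSpace S => ‖ξ q.out‖ ^ 2}
  add_mem' := by
    rintro ξ η ⟨hξ, hξ'⟩ ⟨hη, hη'⟩
    refine ⟨fun g h => by simp only [Pi.add_apply, hξ, hη, map_add], ?_⟩
    refine Summable.of_nonneg_of_le (fun q => sq_nonneg _) (fun q => ?_)
      ((hξ'.add hη').mul_left 2)
    have h1 := norm_add_le (ξ q.out) (η q.out)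
    have h2 : ‖(ξ + η) q.out‖ = ‖ξ q.out + η q.out‖ := rfl
    rw [h2]
    nlinarith [sq_nonneg (‖ξ q.out‖ - ‖η q.out‖), norm_nonneg (ξ q.out + η q.out)]
  zero_mem' := ⟨fun g h => by simp, by simpa using summable_zero⟩
  smul_mem' := by
    rintro c ξ ⟨hξ, hξ'⟩
    refine ⟨fun g h => by simp only [Pi.smul_apply, hξ, map_smul], ?_⟩
    simp only [Pi.smul_apply, norm_smul, mul_pow]
    exact hξ'.mul_left _

/-- The Hilbert space `Ind H` of the representation induced from the unitary representation `π`
of the subgroup `S` of the isotropy group at `x`. -/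
def IndSpace : Type (max u v w) := ↥(indSubmodule π)

namespace IndSpace

noncomputable instance : AddCommGroup (IndSpace π) := inferInstanceAs (AddCommGroup (indSubmodule π))
noncomputable instance : Module ℂ (IndSpace π) := inferInstanceAs (Module ℂ (indSubmodule π))

variable {π}

/-- The underlying function on `G_x`. -/
def toFun (ξ : IndSpace π) : SourceFiber x → H := ξ.1

theorem ext {ξ η : IndSpace π} (h : ∀ g, ξ.toFun g = η.toFun g) : ξ = η :=
  Subtype.ext (funext h)

theorem toFun_add (ξ η : IndSpace π) : (ξ + η).toFun = ξ.toFun + η.toFun := rfl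
theorem toFun_smul (c : ℂ) (ξ : IndSpace π) : (c • ξ).toFun = c • ξ.toFun := rfl

theorem covariant (ξ : IndSpace π) (g : SourceFiber x) (h : S) :
    ξ.toFun ⟨g.1, g.2 ≫ (h : x ⟶ x)⟩ = star (π h : H →L[ℂ] H) (ξ.toFun g) := ξ.2.1 g h

theorem summable (ξ : IndSpace π) : Summable fun q : CosetSpace S => ‖ξ.toFun q.out‖ ^ 2 := ξ.2.2

theorem inner_star_unitary (u : unitary (H →L[ℂ] H)) (ξ η : H) :
    inner ℂ (star (u : H →L[ℂ] H) ξ) (star (u : H →L[ℂ] H) η) = inner ℂ ξ η := by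
  rw [ContinuousLinearMap.star_eq_adjoint, ContinuousLinearMap.adjoint_inner_left,
    ← ContinuousLinearMap.star_eq_adjoint]
  have h1 : (u : H →L[ℂ] H) * star (u : H →L[ℂ] H) = 1 := Unitary.coe_mul_star_self u
  have h2 : (u : H →L[ℂ] H) (star (u : H →L[ℂ] H) η) = η :=
    congrArg (fun T : H →L[ℂ] H => T η) h1
  rw [h2]

/-- `⟪ξ(g), η(g)⟫` depends only on the coset `g S`. -/
theorem inner_eq_of_rel (ξ η : IndSpace π) {g g' : SourceFiber x} (h : (cosetSetoid S).r g g') :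
    inner ℂ (ξ.toFun g) (η.toFun g) = inner ℂ (ξ.toFun g') (η.toFun g') := by
  obtain ⟨h, hh, rfl⟩ := h
  have h1 := ξ.covariant g ⟨h, hh⟩
  have h2 := η.covariant g ⟨h, hh⟩
  simp only at h1 h2
  rw [h1, h2, inner_star_unitary]

theorem norm_eq_of_rel (ξ : IndSpace π) {g g' : SourceFiber x} (h : (cosetSetoid S).r g g') :
    ‖ξ.toFun g‖ = ‖ξ.toFun g'‖ := by
  have := inner_eq_of_rel ξ ξ h
  rw [inner_self_eq_norm_sq_to_K, inner_self_eq_norm_sq_to_K] at this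
  have h2 : ‖ξ.toFun g‖ ^ 2 = ‖ξ.toFun g'‖ ^ 2 := by exact_mod_cast this
  exact (sq_eq_sq₀ (norm_nonneg _) (norm_nonneg _)).1 h2

theorem out_rel (g : SourceFiber x) :
    (cosetSetoid S).r (Quotient.mk (cosetSetoid S) g).out g :=
  Quotient.exact (Quotient.out_eq (Quotient.mk (cosetSetoid S) g))

theorem memlp_iff (f : CosetSpace S → H) : Memℓp f 2 ↔ Summable fun q => ‖f q‖ ^ 2 := by
  rw [memℓp_gen_iff (by norm_num)]
  simp

/-- The element `k` of `S` such that `g = g' k`, where `g'` represents the coset `g S`. -/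
noncomputable def outElt (g : SourceFiber x) : S :=
  ⟨Exists.choose (p := fun h : x ⟶ x => h ∈ S ∧
      g = ⟨(Quotient.mk (cosetSetoid S) g).out.1, (Quotient.mk (cosetSetoid S) g).out.2 ≫ h⟩)
    (out_rel g),
    (Exists.choose_spec (p := fun h : x ⟶ x => h ∈ S ∧
      g = ⟨(Quotient.mk (cosetSetoid S) g).out.1, (Quotient.mk (cosetSetoid S) g).out.2 ≫ h⟩)
    (out_rel g)).1⟩

theorem outElt_spec (g : SourceFiber x) :
    g = ⟨(Quotient.mk (cosetSetoid S) g).out.1,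
      (Quotient.mk (cosetSetoid S) g).out.2 ≫ (outElt (S := S) g : x ⟶ x)⟩ :=
  (Exists.choose_spec (p := fun h : x ⟶ x => h ∈ S ∧
      g = ⟨(Quotient.mk (cosetSetoid S) g).out.1, (Quotient.mk (cosetSetoid S) g).out.2 ≫ h⟩)
    (out_rel g)).2

theorem outElt_unique {g : SourceFiber x} {q : CosetSpace S} (hq : Quotient.mk (cosetSetoid S) g = q)
    (k : S) (hk : g = ⟨q.out.1, q.out.2 ≫ (k : x ⟶ x)⟩) : outElt g = k := by
  subst hq
  have h2 := (outElt_spec (S := S) g).symm.trans hk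
  simp only [Sigma.mk.injEq, heq_eq_eq, true_and] at h2
  exact Subtype.ext ((cancel_epi _).1 h2)

theorem mk_comp (g : SourceFiber x) (h : S) :
    Quotient.mk (cosetSetoid S) (⟨g.1, g.2 ≫ (h : x ⟶ x)⟩ : SourceFiber x) =
      Quotient.mk (cosetSetoid S) g :=
  (Quotient.sound (s := cosetSetoid S) ⟨h, h.2, rfl⟩).symm

theorem outElt_comp (g : SourceFiber x) (h : S) :
    outElt (S := S) ⟨g.1, g.2 ≫ (h : x ⟶ x)⟩ = outElt g * h := by
  refine outElt_unique (mk_comp g h) _ ?_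
  change _ = (⟨_, _ ≫ ((outElt (S := S) g : x ⟶ x) ≫ (h : x ⟶ x))⟩ : SourceFiber x)
  rw [← Category.assoc]
  have h3 : ∀ a b : SourceFiber x, a = b → (⟨a.1, a.2 ≫ (h : x ⟶ x)⟩ : SourceFiber x) =
    ⟨b.1, b.2 ≫ (h : x ⟶ x)⟩ := by rintro a _ rfl; rfl
  exact h3 _ _ (outElt_spec (S := S) g)

theorem outElt_out (q : CosetSpace S) : outElt (S := S) q.out = 1 := by
  refine outElt_unique (Quotient.out_eq q) _ ?_
  change _ = (⟨_, _ ≫ 𝟙 x⟩ : SourceFiber x)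
  rw [Category.comp_id]

variable (π) in
/-- `Ind H` is identified with `ℓ²(G_x/S, H)` by restriction to a system of representatives. -/
noncomputable def toL2 : IndSpace π ≃ₗ[ℂ] lp (fun _ : CosetSpace S => H) 2 where
  toFun ξ := ⟨fun q => ξ.toFun q.out, (memlp_iff _).2 ξ.summable⟩
  map_add' ξ η := rfl
  map_smul' c ξ := rfl
  invFun η := ⟨fun g => star (π (outElt g) : H →L[ℂ] H) (η (Quotient.mk (cosetSetoid S) g)), by
    refine ⟨fun g h => ?_, ?_⟩
    · change star (π (outElt (S := S) ⟨g.1, g.2 ≫ (h : x ⟶ x)⟩) : H →L[ℂ] H)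
        (η (Quotient.mk (cosetSetoid S) ⟨g.1, g.2 ≫ (h : x ⟶ x)⟩)) = _
      rw [outElt_comp, mk_comp, map_mul, Submonoid.coe_mul, star_mul]
      rfl
    · refine ((memlp_iff _).1 η.2).congr fun q => ?_
      symm
      change ‖star (π (outElt q.out) : H →L[ℂ] H) (η (Quotient.mk (cosetSetoid S) q.out))‖ ^ 2 =
        ‖η q‖ ^ 2
      have h2 : (Quotient.mk (cosetSetoid S) q.out) = q := Quotient.out_eq q
      rw [outElt_out, h2, map_one]
      simp⟩
  left_inv ξ := by
    refine ext fun g => ?_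
    have h2 := ξ.covariant (Quotient.mk (cosetSetoid S) g).out (outElt g)
    exact h2.symm.trans (congrArg ξ.toFun (outElt_spec (S := S) g).symm)
  right_inv η := by
    refine Subtype.ext (funext fun q : CosetSpace S => ?_)
    change star (π (outElt q.out) : H →L[ℂ] H) (η (Quotient.mk (cosetSetoid S) q.out)) = η q
    have h2 : (Quotient.mk (cosetSetoid S) q.out) = q := Quotient.out_eq q
    rw [outElt_out, h2, map_one]
    simp

noncomputable instance : NormedAddCommGroup (IndSpace π) :=
  NormedAddCommGroup.induced _ _ (toL2 π).toLinearMap (toL2 π).injective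

/-- The inner product `⟪ξ, η⟫ = ∑_{g ∈ G_x/S} ⟪ξ(g), η(g)⟫`. -/
noncomputable instance : InnerProductSpace ℂ (IndSpace π) where
  inner ξ η := inner ℂ (toL2 π ξ) (toL2 π η)
  norm_smul_le c ξ := by
    change ‖toL2 π (c • ξ)‖ ≤ ‖c‖ * ‖toL2 π ξ‖
    rw [map_smul, norm_smul]
  norm_sq_eq_re_inner ξ := norm_sq_eq_re_inner (𝕜 := ℂ) (toL2 π ξ)
  conj_inner_symm ξ η := inner_conj_symm _ _
  add_left ξ η ζ := by rw [map_add, inner_add_left]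
  smul_left ξ η c := by rw [map_smul, inner_smul_left]

theorem inner_def (ξ η : IndSpace π) :
    inner ℂ ξ η = ∑' q : CosetSpace S, inner ℂ (ξ.toFun q.out) (η.toFun q.out) :=
  lp.inner_eq_tsum _ _

theorem norm_sq_def (ξ : IndSpace π) : ‖ξ‖ ^ 2 = ∑' q : CosetSpace S, ‖ξ.toFun q.out‖ ^ 2 := by
  have h := lp.norm_rpow_eq_tsum (p := 2) (by norm_num) (toL2 π ξ)
  have h1 : ‖ξ‖ = ‖toL2 π ξ‖ := rfl
  rw [h1]
  simp at h
  exact h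

instance : CompleteSpace (IndSpace π) := by
  let e : IndSpace π ≃ₗᵢ[ℂ] lp (fun _ : CosetSpace S => H) 2 := ⟨toL2 π, fun _ => rfl⟩
  exact (completeSpace_congr (e := e.toEquiv) e.isometry.isUniformEmbedding).2 inferInstance

end IndSpace

end Induced

section InducedRep

variable {X : Type u} [Groupoid.{v} X] [TopologicalSpace (Total X)] [TopologicalSpace X]
  [EtaleGroupoid X] {x : X} {S : Subgroup (x ⟶ x)}
  {H : Type w} [NormedAddCommGroup H] [InnerProductSpace ℂ H] [CompleteSpace H]
  {π : S →* unitary (H →L[ℂ] H)}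

/-- `k⁻¹ g` -/
def move (g : SourceFiber x) (k : RangeFiber g.1) : SourceFiber x :=
  ⟨k.1, Groupoid.inv k.2 ≫ g.2⟩

theorem move_rel_inj {W : Set (Total X)} (hW : IsBisection W) {g₁ g₂ : SourceFiber x}
    {k₁ : RangeFiber g₁.1} {k₂ : RangeFiber g₂.1} (h₁ : (⟨g₁.1, k₁.1, k₁.2⟩ : Total X) ∈ W)
    (h₂ : (⟨g₂.1, k₂.1, k₂.2⟩ : Total X) ∈ W)
    (h : (cosetSetoid S).r (move g₁ k₁) (move g₂ k₂)) : (cosetSetoid S).r g₁ g₂ := by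
  obtain ⟨s, hs, h⟩ := h
  obtain ⟨y₁, g₁⟩ := g₁
  obtain ⟨y₂, g₂⟩ := g₂
  obtain ⟨z₁, k₁⟩ := k₁
  obtain ⟨z₂, k₂⟩ := k₂
  simp only [move, Sigma.mk.injEq] at h
  obtain ⟨h3, h4⟩ := h
  have h3' : z₂ = z₁ := h3
  subst h3'
  have h5 := hW.2 h₁ h₂ rfl
  simp only [Total.mk.injEq, true_and] at h5
  obtain ⟨h6, h7⟩ := h5
  have h6' : y₁ = y₂ := h6
  subst h6'
  have h8 : k₁ = k₂ := eq_of_heq h7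
  subst h8
  refine ⟨s, hs, ?_⟩
  have h9 := eq_of_heq h4
  rw [Category.assoc] at h9
  have h10 : g₂ = g₁ ≫ s := (cancel_epi _).1 h9
  rw [h10]

theorem move_rel {W : Set (Total X)} (hW : IsBisection W) {g₁ g₂ : SourceFiber x}
    {k₁ : RangeFiber g₁.1} {k₂ : RangeFiber g₂.1} (h₁ : (⟨g₁.1, k₁.1, k₁.2⟩ : Total X) ∈ W)
    (h₂ : (⟨g₂.1, k₂.1, k₂.2⟩ : Total X) ∈ W)
    (h : (cosetSetoid S).r g₁ g₂) : (cosetSetoid S).r (move g₁ k₁) (move g₂ k₂) := by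
  obtain ⟨s, hs, rfl⟩ := h
  obtain ⟨y₁, g₁⟩ := g₁
  obtain ⟨z₁, k₁⟩ := k₁
  obtain ⟨z₂, k₂⟩ := k₂
  have h5 := hW.1 h₁ h₂ rfl
  simp only [Total.mk.injEq, true_and] at h5
  obtain ⟨h6, h7⟩ := h5
  have h6' : z₁ = z₂ := h6
  subst h6'
  have h8 : k₁ = k₂ := eq_of_heq h7
  subst h8
  refine ⟨s, hs, ?_⟩
  simp [move]

theorem act_covariant (f : ConvAlg X) (ξ : IndSpace π) (g : SourceFiber x) (h : S) :
    act f ξ.toFun ⟨g.1, g.2 ≫ (h : x ⟶ x)⟩ = star (π h : H →L[ℂ] H) (act f ξ.toFun g) := by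
  have hfin := finite_support_act f ξ.toFun g
  have h1 := (star (π h : H →L[ℂ] H)).toLinearMap.toAddMonoidHom.map_finsum hfin
  refine Eq.trans (finsum_congr fun k => ?_) h1.symm
  have h2 := ξ.covariant (move g k) h
  simp only [move, Category.assoc] at h2
  change f _ • ξ.toFun ⟨k.1, Groupoid.inv k.2 ≫ g.2 ≫ (h : x ⟶ x)⟩ = star (π h : H →L[ℂ] H) _
  rw [h2, map_smul]

theorem summable_and_tsum_le {Q : Type*} {a b : Q → ℝ} (ha : ∀ q, 0 ≤ a q) (hb : ∀ q, 0 ≤ b q)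
    {C : ℝ} (hC : 0 ≤ C) (D : Set Q) (φ : D → Q) (hφ : Function.Injective φ)
    (hD : ∀ q, q ∉ D → a q = 0) (hab : ∀ q : D, a q ≤ C * b (φ q)) (hs : Summable b) :
    Summable a ∧ ∑' q, a q ≤ C * ∑' q, b q := by
  have hsupp : Function.support a ⊆ Set.range ((↑) : D → Q) := fun q hq => by
    rw [Subtype.range_coe]
    by_contra h
    exact hq (hD q h)
  have h1 : Summable fun q : D => C * b (φ q) := (hs.comp_injective hφ).mul_left C
  have h2 : Summable fun q : D => a q := Summable.of_nonneg_of_le (fun q => ha q) hab h1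
  have h3 : Summable a :=
    (Function.Injective.summable_iff Subtype.val_injective
      (fun q hq => hD q (by rwa [Subtype.range_coe] at hq))).1 h2
  refine ⟨h3, ?_⟩
  rw [← Function.Injective.tsum_eq Subtype.val_injective hsupp]
  calc ∑' q : D, a q ≤ ∑' q : D, C * b (φ q) := h2.tsum_le_tsum hab h1
    _ = C * ∑' q : D, b (φ q) := tsum_mul_left
    _ ≤ C * ∑' q, b q :=
      mul_le_mul_of_nonneg_left (tsum_comp_le_tsum_of_inj hs hb hφ) hC

theorem act_bound {f : ConvAlg X} {W : Set (Total X)} (hf : f.SupportedOn W) {c : ℝ}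
    (hc : 0 ≤ c) (hfc : ∀ g, ‖f g‖ ≤ c) (ξ : IndSpace π) :
    (Summable fun q : CosetSpace S => ‖act f ξ.toFun q.out‖ ^ 2) ∧
    ∑' q : CosetSpace S, ‖act f ξ.toFun q.out‖ ^ 2 ≤ c ^ 2 * ‖ξ‖ ^ 2 := by
  let D : Set (CosetSpace S) :=
    {q | ∃ k : RangeFiber q.out.1, (⟨q.out.1, k.1, k.2⟩ : Total X) ∈ W}
  rw [IndSpace.norm_sq_def]
  refine summable_and_tsum_le (fun q => sq_nonneg _) (fun q => sq_nonneg _) (sq_nonneg c) D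
    (fun q => Quotient.mk (cosetSetoid S) (move q.1.out q.2.choose)) ?_ ?_ ?_ ξ.summable
  · intro q₁ q₂ h
    have h1 := Quotient.exact h
    have h2 := move_rel_inj hf.isBisection q₁.2.choose_spec q₂.2.choose_spec h1
    have h3 := Quotient.sound (s := cosetSetoid S) h2
    rw [Quotient.out_eq, Quotient.out_eq] at h3
    exact Subtype.ext h3
  · intro q hq
    have : act f ξ.toFun q.out = 0 := act_eq_zero fun k => by
      by_contra h0
      exact hq ⟨k, hf.mem h0⟩
    rw [this, norm_zero, zero_pow two_ne_zero]
  · intro q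
    rw [act_eq_single hf _ _ _ q.2.choose_spec, norm_smul, mul_pow]
    have h1 := IndSpace.norm_eq_of_rel ξ (IndSpace.out_rel (S := S) (move q.1.out q.2.choose))
    rw [h1]
    exact mul_le_mul_of_nonneg_right (pow_le_pow_left₀ (norm_nonneg _) (hfc _) 2) (sq_nonneg _)

theorem act_mem (f : ConvAlg X) (ξ : IndSpace π) : act f ξ.toFun ∈ indSubmodule π := by
  induction f using ConvAlg.induction with
  | h0 => rw [act_zero_left]; exact zero_mem _
  | hadd f g hf hg => rw [act_add_left]; exact add_mem hf hg
  | hs f W hf =>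
    obtain ⟨c, hc, hfc⟩ := f.exists_norm_le
    exact ⟨act_covariant f ξ, (act_bound hf hc hfc ξ).1⟩

/-- The operator `((Ind π)(f) ξ)(g) = ∑_{h ∈ G^{r(g)}} f(h) ξ(h⁻¹ g)` on `Ind H`. -/
noncomputable def indLinear (π : S →* unitary (H →L[ℂ] H)) (f : ConvAlg X) :
    IndSpace π →ₗ[ℂ] IndSpace π where
  toFun ξ := (⟨act f ξ.toFun, act_mem f ξ⟩ : indSubmodule π)
  map_add' ξ η := Subtype.ext (act_add_right f ξ.toFun η.toFun)
  map_smul' c ξ := Subtype.ext (act_smul_right c f ξ.toFun)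

theorem indLinear_toFun (f : ConvAlg X) (ξ : IndSpace π) :
    (indLinear π f ξ).toFun = act f ξ.toFun := rfl

theorem indLinear_add (f₁ f₂ : ConvAlg X) :
    indLinear π (f₁ + f₂) = indLinear π f₁ + indLinear π f₂ := by
  ext1 ξ
  exact Subtype.ext (act_add_left f₁ f₂ ξ.toFun)

theorem exists_indLinear_bound (f : ConvAlg X) :
    ∃ C : ℝ, ∀ ξ : IndSpace π, ‖indLinear π f ξ‖ ≤ C * ‖ξ‖ := by
  induction f using ConvAlg.induction with
  | h0 =>
    refine ⟨0, fun ξ => ?_⟩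
    have : indLinear π (0 : ConvAlg X) ξ = 0 := Subtype.ext (act_zero_left ξ.toFun)
    rw [this, norm_zero, zero_mul]
  | hadd f g hf hg =>
    obtain ⟨C₁, h₁⟩ := hf
    obtain ⟨C₂, h₂⟩ := hg
    refine ⟨C₁ + C₂, fun ξ => ?_⟩
    rw [indLinear_add, LinearMap.add_apply, add_mul]
    exact (norm_add_le _ _).trans (add_le_add (h₁ ξ) (h₂ ξ))
  | hs f W hf =>
    obtain ⟨c, hc, hfc⟩ := f.exists_norm_le
    refine ⟨c, fun ξ => ?_⟩
    have h1 := (act_bound hf hc hfc ξ).2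
    have h2 := IndSpace.norm_sq_def (indLinear π f ξ)
    simp only [indLinear_toFun] at h2
    rw [← h2, ← mul_pow] at h1
    exact le_of_sq_le_sq h1 (by positivity)

theorem ConvAlg.SupportedOn.star {f : ConvAlg X} {W : Set (Total X)} (hf : f.SupportedOn W) :
    (star f).SupportedOn (inverse ⁻¹' W) where
  isOpen := hf.isOpen.preimage EtaleGroupoid.continuous_inverse
  isBisection := by
    constructor
    · intro g hg g' hg' h
      have := hf.isBisection.2 hg hg' h
      rw [← inverse_inverse g, this, inverse_inverse]
    · intro g hg g' hg' h
      have := hf.isBisection.1 hg hg' h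
      rw [← inverse_inverse g, this, inverse_inverse]
  tsupport_subset := by
    refine Set.Subset.trans ?_ (Set.preimage_mono (f := inverse) hf.tsupport_subset)
    refine closure_minimal (fun g hg => ?_)
      ((isClosed_tsupport f).preimage EtaleGroupoid.continuous_inverse)
    refine subset_tsupport _ fun h0 => hg ?_
    rw [ConvAlg.star_apply, h0, map_zero]

theorem inner_indLinear_left (f : ConvAlg X) (ξ η : IndSpace π) :
    inner ℂ (indLinear π f ξ) η = inner ℂ ξ (indLinear π (star f) η) := by
  induction f using ConvAlg.induction with
  | h0 =>
    have h1 : ∀ ξ, indLinear π (0 : ConvAlg X) ξ = 0 := fun ξ =>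
      Subtype.ext (act_zero_left ξ.toFun)
    rw [star_zero, h1, h1, inner_zero_left, inner_zero_right]
  | hadd f g hf hg =>
    rw [star_add, indLinear_add, indLinear_add, LinearMap.add_apply, LinearMap.add_apply,
      inner_add_left, inner_add_right, hf, hg]
  | hs f W hf =>
    rw [IndSpace.inner_def, IndSpace.inner_def]
    simp only [indLinear_toFun]
    have hD : ∀ q : CosetSpace S, inner ℂ (act f ξ.toFun q.out) (η.toFun q.out) ≠ 0 →
        ∃ k : RangeFiber q.out.1, (⟨q.out.1, k.1, k.2⟩ : Total X) ∈ W := fun q hq => by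
      by_contra hcon
      apply hq
      rw [act_eq_zero, inner_zero_left]
      intro k
      by_contra h0
      exact hcon ⟨k, hf.mem h0⟩
    -- the value of the right hand side summand at `k⁻¹ g`
    have hval : ∀ (g : SourceFiber x) (k : RangeFiber g.1)
        (_ : (⟨g.1, k.1, k.2⟩ : Total X) ∈ W),
        inner ℂ (ξ.toFun (move g k)) (act (star f) η.toFun (move g k)) =
          inner ℂ (act f ξ.toFun g) (η.toFun g) := by
      intro g k hk
      have h1 : (⟨(move g k).1, g.1, Groupoid.inv k.2⟩ : Total X) ∈ inverse ⁻¹' W := by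
        change (⟨g.1, k.1, Groupoid.inv (Groupoid.inv k.2)⟩ : Total X) ∈ W
        simpa using hk
      rw [act_eq_single hf.star η.toFun (move g k) ⟨g.1, Groupoid.inv k.2⟩ h1,
        act_eq_single hf ξ.toFun g k hk, inner_smul_left, inner_smul_right, ConvAlg.star_apply]
      simp [move, inverse]
    symm
    refine tsum_eq_tsum_of_ne_zero_bij
      (fun q => Quotient.mk (cosetSetoid S) (move q.1.out (hD q.1 q.2).choose)) ?_ ?_ ?_
    · intro q₁ q₂ h
      have h1 := Quotient.exact h
      have h2 := move_rel_inj hf.isBisection (hD q₁.1 q₁.2).choose_spec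
        (hD q₂.1 q₂.2).choose_spec h1
      have h3 := Quotient.sound (s := cosetSetoid S) h2
      rw [Quotient.out_eq, Quotient.out_eq] at h3
      exact Subtype.ext h3
    · intro q' hq'
      have h1 : ∃ l : RangeFiber q'.out.1, (⟨q'.out.1, l.1, l.2⟩ : Total X) ∈ inverse ⁻¹' W := by
        by_contra hcon
        apply hq'
        have : act (star f) η.toFun q'.out = 0 := act_eq_zero fun l => by
          by_contra h0
          exact hcon ⟨l, hf.star.mem h0⟩
        change inner ℂ _ (act (star f) η.toFun q'.out) = 0
        rw [this, inner_zero_right]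
      obtain ⟨l, hl⟩ := h1
      let g : SourceFiber x := move q'.out l
      let k : RangeFiber g.1 := ⟨q'.out.1, Groupoid.inv l.2⟩
      have hk : (⟨g.1, k.1, k.2⟩ : Total X) ∈ W := hl
      have hgk : move g k = q'.out := by
        simp [g, k, move]
      let q : CosetSpace S := Quotient.mk (cosetSetoid S) g
      have hv := hval g k hk
      rw [hgk] at hv
      have hv2 := IndSpace.inner_eq_of_rel (indLinear π f ξ) η (IndSpace.out_rel (S := S) g)
      simp only [indLinear_toFun] at hv2
      have hq : inner ℂ (act f ξ.toFun q.out) (η.toFun q.out) ≠ 0 := by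
        change inner ℂ (act f ξ.toFun (Quotient.mk (cosetSetoid S) g).out)
          (η.toFun (Quotient.mk (cosetSetoid S) g).out) ≠ 0
        rw [hv2, ← hv]
        exact hq'
      refine ⟨⟨q, hq⟩, ?_⟩
      have h3 := move_rel (S := S) hf.isBisection (hD q hq).choose_spec hk
        (IndSpace.out_rel (S := S) g)
      rw [hgk] at h3
      have h4 := Quotient.sound (s := cosetSetoid S) h3
      rw [Quotient.out_eq] at h4
      exact h4
    · intro q
      have h1 := IndSpace.inner_eq_of_rel ξ (indLinear π (star f) η)
        (IndSpace.out_rel (S := S) (move q.1.out (hD q.1 q.2).choose))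
      simp only [indLinear_toFun] at h1
      exact h1.trans (hval _ _ (hD q.1 q.2).choose_spec)

/-- The induced representation `Ind π` of the convolution algebra. -/
noncomputable def indRep (π : S →* unitary (H →L[ℂ] H)) :
    ConvAlg X →⋆ₙₐ[ℂ] (IndSpace π →L[ℂ] IndSpace π) where
  toFun f := (indLinear π f).mkContinuousOfExistsBound (exists_indLinear_bound f)
  map_smul' c f := by
    ext1 ξ
    exact Subtype.ext (act_smul_left c f ξ.toFun)
  map_zero' := by
    ext1 ξ
    exact Subtype.ext (act_zero_left ξ.toFun)
  map_add' f₁ f₂ := by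
    ext1 ξ
    exact Subtype.ext (act_add_left f₁ f₂ ξ.toFun)
  map_mul' f₁ f₂ := by
    ext1 ξ
    exact Subtype.ext (act_mul f₁ f₂ ξ.toFun)
  map_star' f := by
    rw [ContinuousLinearMap.star_eq_adjoint]
    refine (ContinuousLinearMap.eq_adjoint_iff _ _).2 fun ξ η => ?_
    have := inner_indLinear_left (star f) ξ η
    rw [star_star] at this
    exact this

theorem indRep_apply (f : ConvAlg X) (ξ : IndSpace π) (g : SourceFiber x) :
    (indRep π f ξ).toFun g =
      ∑ᶠ h : RangeFiber g.1, f ⟨g.1, h.1, h.2⟩ • ξ.toFun ⟨h.1, Groupoid.inv h.2 ≫ g.2⟩ := rfl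

end InducedRep

end EtaleCStar

namespace EtaleCStar

open CategoryTheory Set
open Quiver (Total)

/-! ## The reduced C⋆-algebra and the ideal intersection property -/

section Reduced

variable (X : Type u) [TopologicalSpace X] [Groupoid.{v} X] [TopologicalSpace (Total X)]
  [EtaleGroupoid X]

/-- The representation `ρ_x` of the convolution algebra induced from the trivial representation of
the trivial subgroup `{x}` of the isotropy group at `x`. -/
noncomputable def regularRep (x : X) : HilbertRep (ConvAlg X) where
  H := IndSpace (1 : (⊥ : Subgroup (x ⟶ x)) →* unitary (ℂ →L[ℂ] ℂ))
  rep := indRep 1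

/-- The reduced norm `‖f‖_r = sup_x ‖ρ_x(f)‖`. -/
noncomputable def reducedSeminorm : CStarSeminorm (ConvAlg X) :=
  CStarSeminorm.ofFamily (regularRep X) fun f => by
    obtain ⟨C, hC⟩ := f.exists_norm_rep_le
    exact ⟨C, by rintro _ ⟨x, rfl⟩; exact hC _⟩

/-- The reduced groupoid C⋆-algebra. -/
abbrev ReducedCStar : Type (max u v) := (reducedSeminorm X).Completion

/-- The subalgebra `C₀(G⁰)` of the reduced groupoid C⋆-algebra: the closure of the set of functions
in the convolution algebra that are supported on the set of units. -/
def unitSubalgebra : Set (ReducedCStar X) :=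
  closure (CStarSeminorm.Completion.of (reducedSeminorm X) '' {f | f.UnitSupported})

/-- Every nonzero (closed two-sided) ideal of the reduced groupoid C⋆-algebra has a nonzero
intersection with `C₀(G⁰)`. -/
def IdealIntersectionProperty : Prop :=
  ∀ I : TwoSidedIdeal (ReducedCStar X), IsClosed (I : Set (ReducedCStar X)) → I ≠ ⊥ →
    ∃ a ∈ unitSubalgebra X, a ∈ I ∧ a ≠ 0

end Reduced

/-! ## Reductions to closed invariant subsets -/

/-- A closed invariant subset of the unit space of a groupoid. -/
structure ClosedInvariantSet (X : Type u) [TopologicalSpace X] [Groupoid.{v} X] where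
  /-- the underlying set -/
  carrier : Set X
  isClosed : IsClosed carrier
  invariant : ∀ {x y : X}, (x ⟶ y) → x ∈ carrier → y ∈ carrier

section Reduction

variable {X : Type u} [TopologicalSpace X] [Groupoid.{v} X]

/-- The unit space of the reduction `G_Y` of a groupoid `G` to a closed invariant set `Y` of units:
the arrows of `G_Y` are all arrows of `G` with source and range in `Y`. -/
def Reduction (Y : ClosedInvariantSet X) : Type u := ↥Y.carrier

variable (Y : ClosedInvariantSet X)

instance : TopologicalSpace (Reduction Y) := inferInstanceAs (TopologicalSpace ↥Y.carrier)

instance : Groupoid.{v} (Reduction Y) where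
  Hom x y := x.1 ⟶ y.1
  id x := 𝟙 x.1
  comp g h := CategoryStruct.comp (obj := X) g h
  id_comp g := @Category.id_comp X _ _ _ g
  comp_id g := @Category.comp_id X _ _ _ g
  assoc g h k := @Category.assoc X _ _ _ _ _ g h k
  inv g := @Groupoid.inv X _ _ _ g
  inv_comp g := @Groupoid.inv_comp X _ _ _ g
  comp_inv g := @Groupoid.comp_inv X _ _ _ g

/-- The inclusion of the arrows of the reduction into the arrows of the groupoid. -/
def Reduction.incl (g : Total (Reduction Y)) : Total X := ⟨g.left.1, g.right.1, g.hom⟩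

theorem Reduction.incl_injective : Function.Injective (Reduction.incl Y) := by
  rintro ⟨⟨a, ha⟩, ⟨b, hb⟩, g⟩ ⟨⟨c, hc⟩, ⟨d, hd⟩, h⟩ heq
  simp only [Reduction.incl, Total.mk.injEq] at heq
  obtain ⟨h1, h2, h3⟩ := heq
  subst h1
  subst h2
  rw [eq_of_heq h3]

variable [TopologicalSpace (Total X)]

/-- The subspace topology on the arrows of the reduction. -/
instance : TopologicalSpace (Total (Reduction Y)) :=
  TopologicalSpace.induced (Reduction.incl Y) inferInstance

theorem Reduction.isEmbedding_incl : Topology.IsEmbedding (Reduction.incl Y) :=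
  ⟨⟨rfl⟩, Reduction.incl_injective Y⟩

theorem Reduction.range_incl_range :
    Set.range (Reduction.incl Y) = rng ⁻¹' Y.carrier := by
  ext g
  constructor
  · rintro ⟨h, rfl⟩
    exact h.left.2
  · obtain ⟨a, b, g⟩ := g
    intro h
    exact ⟨⟨⟨a, h⟩, ⟨b, Y.invariant g h⟩, g⟩, rfl⟩

theorem Reduction.range_incl_source :
    Set.range (Reduction.incl Y) = src ⁻¹' Y.carrier := by
  ext g
  constructor
  · rintro ⟨h, rfl⟩
    exact h.right.2
  · obtain ⟨a, b, g⟩ := g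
    intro h
    exact ⟨⟨⟨a, Y.invariant (Groupoid.inv g) h⟩, ⟨b, h⟩, g⟩, rfl⟩

/-- Restrictions of local homeomorphisms to full preimages are local homeomorphisms. -/
theorem isLocalHomeomorph_of_restrict {A B A' B' : Type*} [TopologicalSpace A]
    [TopologicalSpace B] [TopologicalSpace A'] [TopologicalSpace B'] {f : A → B} {f' : A' → B'}
    {i : A' → A} {j : B' → B} (hf : IsLocalHomeomorph f) (hi : Topology.IsEmbedding i)
    (hj : Topology.IsEmbedding j) (hij : ∀ a, j (f' a) = f (i a))
    (hr : Set.range i = f ⁻¹' Set.range j) : IsLocalHomeomorph f' := by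
  have hc : Continuous f' := by
    rw [hj.continuous_iff]
    have : j ∘ f' = f ∘ i := funext hij
    rw [this]
    exact hf.continuous.comp hi.continuous
  have ho : IsOpenMap f' := by
    intro U' hU'
    obtain ⟨U, hU, rfl⟩ := hi.isOpen_iff.1 hU'
    refine hj.isOpen_iff.2 ⟨f '' U, hf.isOpenMap U hU, ?_⟩
    ext b
    constructor
    · rintro ⟨a, haU, hab⟩
      have : a ∈ Set.range i := by
        rw [hr]
        exact ⟨b, hab.symm⟩
      obtain ⟨a', rfl⟩ := this
      exact ⟨a', haU, hj.injective (by rw [hij, hab])⟩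
    · rintro ⟨a', ha', rfl⟩
      exact ⟨i a', ha', (hij a').symm⟩
  rw [isLocalHomeomorph_iff_isOpenEmbedding_restrict]
  intro a
  obtain ⟨U, hU, haU, hinj⟩ := hf.isLocallyInjective (i a)
  have hU' : IsOpen (i ⁻¹' U) := hU.preimage hi.continuous
  refine ⟨i ⁻¹' U, hU'.mem_nhds haU, ?_⟩
  refine Topology.IsOpenEmbedding.of_continuous_injective_isOpenMap
    (hc.comp continuous_subtype_val) ?_ (ho.comp hU'.isOpenMap_subtype_val)
  rintro ⟨b, hb⟩ ⟨c, hc⟩ h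
  have h1 : f' b = f' c := h
  have h2 := hinj hb hc (by rw [← hij, ← hij, h1])
  exact Subtype.ext (hi.injective h2)

variable [EtaleGroupoid X]

instance : EtaleGroupoid (Reduction Y) where
  t2Space := (Reduction.isEmbedding_incl Y).t2Space
  locallyCompactSpace := by
    have hcl : Topology.IsClosedEmbedding (Reduction.incl Y) :=
      ⟨Reduction.isEmbedding_incl Y, by
        rw [Reduction.range_incl_range]
        exact Y.isClosed.preimage ConvAlg.continuous_range⟩
    exact hcl.locallyCompactSpace
  continuous_product := by
    rw [(Reduction.isEmbedding_incl Y).continuous_iff]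
    let F : Composable (Reduction Y) → Composable X := fun p =>
      ⟨(Reduction.incl Y p.1.1, Reduction.incl Y p.1.2), congrArg Subtype.val p.2⟩
    have hF : Continuous F := by
      have hi := (Reduction.isEmbedding_incl Y).continuous
      exact Continuous.subtype_mk ((hi.comp (continuous_fst.comp continuous_subtype_val)).prodMk
        (hi.comp (continuous_snd.comp continuous_subtype_val))) _
    have heq : Reduction.incl Y ∘ product = product ∘ F := by
      funext ⟨⟨⟨a, b, g⟩, ⟨c, d, h⟩⟩, hp⟩
      obtain rfl : b = c := hp
      change (⟨a.1, d.1, CategoryStruct.comp (obj := X) g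
        (CategoryStruct.comp (obj := X) (𝟙 b.1) h)⟩ : Total X) = _
      simp [product, F, Reduction.incl]
    rw [heq]
    exact EtaleGroupoid.continuous_product.comp hF
  continuous_inverse := by
    rw [(Reduction.isEmbedding_incl Y).continuous_iff]
    exact EtaleGroupoid.continuous_inverse.comp (Reduction.isEmbedding_incl Y).continuous
  continuous_unit := by
    rw [(Reduction.isEmbedding_incl Y).continuous_iff]
    exact EtaleGroupoid.continuous_unit.comp (continuous_subtype_val (p := (· ∈ Y.carrier)))
  isLocalHomeomorph_range :=
    isLocalHomeomorph_of_restrict EtaleGroupoid.isLocalHomeomorph_range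
      (Reduction.isEmbedding_incl Y) (Topology.IsEmbedding.subtypeVal (p := (· ∈ Y.carrier)))
      (fun _ => rfl) (by
        rw [Reduction.range_incl_range]
        exact congrArg (preimage rng) Subtype.range_coe.symm)
  isLocalHomeomorph_source :=
    isLocalHomeomorph_of_restrict EtaleGroupoid.isLocalHomeomorph_source
      (Reduction.isEmbedding_incl Y) (Topology.IsEmbedding.subtypeVal (p := (· ∈ Y.carrier)))
      (fun _ => rfl) (by
        rw [Reduction.range_incl_source]
        exact congrArg (preimage src) Subtype.range_coe.symm)

end Reduction

section Properties

variable (X : Type u) [TopologicalSpace X] [Groupoid.{v} X] [TopologicalSpace (Total X)]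

/-- A groupoid is effective if the interior of its isotropy bundle is the set of units. -/
def IsEffective : Prop := interior {g : Total X | rng g = src g} = Set.range (unit : X → Total X)

/-- A groupoid is strongly effective if its reductions to closed invariant sets of units are
effective. -/
def StronglyEffective : Prop := ∀ Y : ClosedInvariantSet X, IsEffective (Reduction Y)

/-- The ideal intersection property for the reductions to all closed invariant sets of units. -/
def ResidualIntersectionProperty [EtaleGroupoid X] : Prop :=
  ∀ Y : ClosedInvariantSet X, IdealIntersectionProperty (Reduction Y)

/-- Topological amenability of an étale groupoid: there are nonnegative functions `f ∈ C_c(G)` such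
that `∑_{h ∈ G^{r(g)}} f(h)` is close to `1` and `∑_{h ∈ G^{r(g)}} |f(g⁻¹ h) - f(h)|` is close to
`0`, uniformly for `g` in a given compact set. -/
def IsAmenable : Prop :=
  ∀ K : Set (Total X), IsCompact K → ∀ ε : ℝ, 0 < ε → ∃ f : C(Total X, ℝ),
    HasCompactSupport f ∧ (∀ g, 0 ≤ f g) ∧ ∀ g ∈ K,
      |(∑ᶠ h : RangeFiber (rng g), f ⟨rng g, h.1, h.2⟩) - 1| < ε ∧
      ∑ᶠ h : RangeFiber (rng g),
        |f ⟨src g, h.1, Groupoid.inv g.hom ≫ h.2⟩ - f ⟨rng g, h.1, h.2⟩| < ε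

end Properties

/-! ## The induction map and the quasi-orbit space -/

section Induction

variable (X : Type u) [TopologicalSpace X] [Groupoid.{v} X] [TopologicalSpace (Total X)]
  [EtaleGroupoid X]

/-- The pairs `(x, J)` of a unit `x` and a primitive ideal `J` of the C⋆-algebra of the isotropy
group at `x`. -/
abbrev StabPrim : Type (max u v) := Σ x : X, Prim (GroupCStar (x ⟶ x))

variable {X}

/-- The representation of the full groupoid C⋆-algebra induced from a unitary representation of the
isotropy group at `x`. -/
noncomputable def isotropyInd {x : X} (π : UnitaryRep (x ⟶ x)) :
    GroupoidCStar X →⋆ₙₐ[ℂ] (IndSpace (π.rep.comp (⊤ : Subgroup (x ⟶ x)).subtype) →L[ℂ]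
      IndSpace (π.rep.comp (⊤ : Subgroup (x ⟶ x)).subtype)) :=
  extendRep (indRep (π.rep.comp (⊤ : Subgroup (x ⟶ x)).subtype))

/-- The induction map: `Ind(x, J)` is the kernel of `Ind π_J`, where `π_J` is an irreducible
unitary representation of the isotropy group at `x` with kernel `J`. -/
noncomputable def Ind (p : StabPrim X) : TwoSidedIdeal (GroupoidCStar X) :=
  TwoSidedIdeal.ker (isotropyInd (exists_unitaryRep p.2).choose)

variable (X)

/-- The relation of lying on the same orbit. -/
def orbitSetoid : Setoid X where
  r x y := Nonempty (x ⟶ y)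
  iseqv := ⟨fun x => ⟨𝟙 x⟩, fun ⟨g⟩ => ⟨Groupoid.inv g⟩, fun ⟨g⟩ ⟨h⟩ => ⟨g ≫ h⟩⟩

/-- The orbit space, with the quotient topology. -/
abbrev OrbitSpace : Type u := Quotient (orbitSetoid X)

/-- The quasi-orbit space: the largest `T₀` quotient of the orbit space. -/
abbrev QuasiOrbitSpace : Type u := SeparationQuotient (OrbitSpace X)

variable {X}

/-- The quasi-orbit of a unit. -/
def quasiOrbit (x : X) : QuasiOrbitSpace X :=
  SeparationQuotient.mk (Quotient.mk (orbitSetoid X) x)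

end Induction

end EtaleCStar

open EtaleCStar CategoryTheory

set_option linter.unusedSectionVars false

namespace EtaleCStar

open CategoryTheory Set
open Quiver (Total)

/-! ## Elementary facts about the convolution algebra -/

section Toolkit

variable {X : Type u} [Groupoid.{v} X] [TopologicalSpace (Total X)] [TopologicalSpace X]
  [EtaleGroupoid X]

/-! Norms in the regular representations are read off from values at units. The restrictions of
convolution functions `b` to `G_x` are dense in `ℓ²(G_x)`, with inner product `(b⋆ b')(x)`. Hence
`‖ρ_x(f)‖ ≤ c` says that `((fb)⋆(fb))(x) ≤ c² (b⋆b)(x)` for all `b`. This condition, `RegBound`, is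
closed in `x` and invariant along arrows.

The heart of the matter is a norm formula. For a representation `π`, let `Y` (`hullSet`) be the
closed invariant set of units that is dual to the kernel of `π` on functions supported on units.
Amenability gives `‖π(f)‖ ≤ sup_{x ∈ Y} ‖ρ_x(f)‖` (`IsAmenable.norm_rep_le`): multiplying `f⋆f`
pointwise by a function `ξξ⋆` close to `1` turns it into a finite matrix of functions on the unit
space, and such a matrix has a positive image as soon as it is positive at the points of `Y`. So `π`
factors through `C⋆_r(G_Y)`, and is isometric on `C₀(Y)`. If `G_Y` has the intersection property,
`π` is then injective on `C⋆_r(G_Y)`, hence isometric, and the bound is an equality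
(`norm_rep_le_iff`).

2 ⇒ 3. A representation induced from the isotropy group at `x` has the closure of the orbit of `x`
as its hull. By closedness and invariance of `RegBound`, its norm is that of `ρ_x`, so its kernel
does not depend on `J`.

1 ⇒ 2. Let `a ≥ 0` be in an ideal of the reduced algebra of an effective groupoid, with positive
expectation at some unit, and let `f` be a convolution function near `a`. By effectiveness there is
a small open set of units over which `f` has no arrows except for units. For a bump `h` there,
`h⋆fh` is a function on the unit space that dominates a multiple of `h⋆h`, hence so does `h⋆ah`, and
closed ideals are hereditary.

3 ⇒ 1. If strong effectiveness fails, there are an isotropy element `γ ≠ 1` at some `x` and a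
neighbourhood of `γ` in which all arrows with range in the orbit of `x` are loops. With `χ = 1` near
`γ` and a bump `h` at `x`, the element `hχ - h` is killed by the representation induced from the
trivial one, but not by one induced from `π` with `π(γ) ≠ 1`. An irreducible `π` of this kind exists
by Krein-Milman and the construction of Gelfand, Naimark and Segal.

For the last part, under the same norm formula, membership `a ∈ Ind₀(x)` is a closed condition on
`x`, which gives continuity. Bump functions on the unit space show that every closed invariant set
is the preimage of a closed set of primitive ideals. The kernel of any representation is the
intersection of the ideals `Ind₀(x)` over its hull, which gives density. -/

theorem inverse_unit (x : X) : inverse (unit x) = unit x := by simp [inverse, unit]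

/-- If `g` and the unit at its range both lie in one bisection, they coincide, having the same
range. For `g` near a unit this is automatic. -/
theorem isOpen_range_unit : IsOpen (range (unit : X → Total X)) := by
  rw [isOpen_iff_mem_nhds]
  rintro _ ⟨x, rfl⟩
  obtain ⟨W, hW, hb, hx⟩ := ConvAlg.exists_isBisection (unit x)
  have h1 : IsOpen (W ∩ rng ⁻¹' (unit ⁻¹' W) : Set (Total X)) :=
    hW.inter ((hW.preimage EtaleGroupoid.continuous_unit).preimage ConvAlg.continuous_range)
  refine Filter.mem_of_superset (h1.mem_nhds ⟨hx, hx⟩) ?_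
  rintro g ⟨hg, hg'⟩
  exact ⟨rng g, hb.1 hg' hg rfl⟩

theorem isClosed_range_unit : IsClosed (range (unit : X → Total X)) := by
  have : range (unit : X → Total X) = {g | unit (rng g) = g} := by
    ext g
    constructor
    · rintro ⟨x, rfl⟩; rfl
    · intro h; exact ⟨_, h⟩
  rw [this]
  exact isClosed_eq (EtaleGroupoid.continuous_unit.comp ConvAlg.continuous_range) continuous_id

theorem isOpenMap_range : IsOpenMap (rng : Total X → X) :=
  (EtaleGroupoid.isLocalHomeomorph_range (X := X)).isOpenMap

namespace ConvAlg

@[simp] theorem sub_apply (f f' : ConvAlg X) (g : Total X) : (f - f') g = f g - f' g := rfl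

theorem sum_apply {ι : Type*} (s : Finset ι) (F : ι → ConvAlg X) (g : Total X) :
    (∑ i ∈ s, F i) g = ∑ i ∈ s, F i g :=
  CompactlySupportedContinuousMap.sum_apply s
    (fun i => (F i : CompactlySupportedContinuousMap (Total X) ℂ)) g

/-- The product of a continuous function and a function in the convolution algebra. -/
noncomputable def pmul (φ : C(Total X, ℂ)) (f : ConvAlg X) : ConvAlg X :=
  mk (fun g => φ g * f g) (φ.continuous.mul f.continuous) f.hasCompactSupport.mul_left

@[simp] theorem pmul_apply (φ : C(Total X, ℂ)) (f : ConvAlg X) (g : Total X) :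
    pmul φ f g = φ g * f g := rfl

/-- The underlying continuous function. -/
def toCont (f : ConvAlg X) : C(Total X, ℂ) := ⟨f, f.continuous⟩

@[simp] theorem toCont_apply (f : ConvAlg X) (g : Total X) : f.toCont g = f g := rfl

/-- Composition with a continuous function vanishing at zero. -/
noncomputable def post (φ : C(ℂ, ℂ)) (hφ : φ 0 = 0) (f : ConvAlg X) : ConvAlg X :=
  mk (fun g => φ (f g)) (φ.continuous.comp f.continuous) (f.hasCompactSupport.comp_left hφ)

@[simp] theorem post_apply (φ : C(ℂ, ℂ)) (hφ : φ 0 = 0) (f : ConvAlg X) (g : Total X) :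
    post φ hφ f g = φ (f g) := rfl

variable (X) in
open Classical in
/-- The indicator function of the unit space. -/
noncomputable def unitIndicator : C(Total X, ℂ) :=
  ⟨(range (unit : X → Total X)).indicator 1,
    (IsClopen.continuous_indicator ⟨isClosed_range_unit, isOpen_range_unit⟩ continuous_one)⟩

/-- The restriction of a function to the unit space. -/
noncomputable def diag (f : ConvAlg X) : ConvAlg X := pmul (unitIndicator X) f

@[simp] theorem diag_unit (f : ConvAlg X) (x : X) : diag f (unit x) = f (unit x) := by
  simp [diag, unitIndicator]

theorem diag_unitSupported (f : ConvAlg X) : (diag f).UnitSupported := fun g hg => by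
  by_contra h
  exact hg (by simp only [diag, pmul_apply, unitIndicator, ContinuousMap.coe_mk,
    indicator_of_notMem h, zero_mul])

theorem UnitSupported.eq_zero {f : ConvAlg X} (hf : f.UnitSupported) {g : Total X}
    (hg : g ∉ range (unit : X → Total X)) : f g = 0 := not_not.1 fun h => hg (hf g h)

theorem UnitSupported.ext {f f' : ConvAlg X} (hf : f.UnitSupported) (hf' : f'.UnitSupported)
    (h : ∀ x, f (unit x) = f' (unit x)) : f = f' := by
  ext g
  by_cases hg : g ∈ range (unit : X → Total X)
  · obtain ⟨x, rfl⟩ := hg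
    exact h x
  · rw [hf.eq_zero hg, hf'.eq_zero hg]

theorem UnitSupported.add {f f' : ConvAlg X} (hf : f.UnitSupported) (hf' : f'.UnitSupported) :
    (f + f').UnitSupported := fun g hg => by
  by_contra h
  exact hg (by rw [add_apply, hf.eq_zero h, hf'.eq_zero h, add_zero])

theorem UnitSupported.sub {f f' : ConvAlg X} (hf : f.UnitSupported) (hf' : f'.UnitSupported) :
    (f - f').UnitSupported := fun g hg => by
  by_contra h
  exact hg (by rw [sub_apply, hf.eq_zero h, hf'.eq_zero h, sub_zero])

theorem UnitSupported.smul (c : ℂ) {f : ConvAlg X} (hf : f.UnitSupported) :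
    (c • f).UnitSupported := fun g hg => by
  by_contra h
  exact hg (by rw [smul_apply, hf.eq_zero h, mul_zero])

theorem unitSupported_zero : (0 : ConvAlg X).UnitSupported := fun _ hg => absurd rfl hg

theorem unitSupported_sum {ι : Type*} (s : Finset ι) (F : ι → ConvAlg X)
    (hF : ∀ i ∈ s, (F i).UnitSupported) : (∑ i ∈ s, F i).UnitSupported :=
  Finset.sum_induction _ UnitSupported (fun _ _ => UnitSupported.add) unitSupported_zero hF

theorem UnitSupported.adjoint {f : ConvAlg X} (hf : f.UnitSupported) : (star f).UnitSupported :=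
  fun g hg => by
    rw [star_apply] at hg
    obtain ⟨x, hx⟩ := hf (inverse g) (fun h => hg (by rw [h, map_zero]))
    exact ⟨x, by rw [← inverse_inverse g, ← hx, inverse_unit]⟩

theorem UnitSupported.pmul {f : ConvAlg X} (hf : f.UnitSupported) (φ : C(Total X, ℂ)) :
    (pmul φ f).UnitSupported := fun g hg => hf g (right_ne_zero_of_mul hg)

theorem UnitSupported.post {f : ConvAlg X} (hf : f.UnitSupported) (φ : C(ℂ, ℂ)) (hφ : φ 0 = 0) :
    (post φ hφ f).UnitSupported := fun g hg => hf g fun h => hg (by rw [post_apply, h, hφ])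

theorem star_unit (f : ConvAlg X) (x : X) : star f (unit x) = conj (f (unit x)) := by
  rw [star_apply, inverse_unit]

theorem UnitSupported.mul_unit {f : ConvAlg X} (hf : f.UnitSupported) (f' : ConvAlg X) (x : X) :
    (f * f') (unit x) = f (unit x) * f' (unit x) := hf.mul_apply f' _

/-- Right multiplication by a function supported on the unit space. -/
theorem UnitSupported.mul_apply_right {h : ConvAlg X} (hh : h.UnitSupported) (f : ConvAlg X)
    (g : Total X) : (f * h) g = f g * h (unit (src g)) := by
  have : f * h = star (star h * star f) := by rw [star_mul, star_star, star_star]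
  rw [this, star_apply, hh.adjoint.mul_apply, star_apply, star_apply, inverse_inverse, inverse_unit,
    map_mul]
  simp [mul_comm]

theorem UnitSupported.mul {f f' : ConvAlg X} (hf : f.UnitSupported) (hf' : f'.UnitSupported) :
    (f * f').UnitSupported := fun g hg => by
  rw [hf.mul_apply] at hg
  exact hf' g (right_ne_zero_of_mul hg)

theorem mul_apply_of_mem {f : ConvAlg X} {W : Set (Total X)} (hf : f.SupportedOn W)
    (f' : ConvAlg X) {a b t : X} (w : a ⟶ t) (hw : (⟨a, t, w⟩ : Total X) ∈ W) (g : a ⟶ b) :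
    (f * f') ⟨a, b, g⟩ = f ⟨a, t, w⟩ * f' ⟨t, b, Groupoid.inv w ≫ g⟩ := by
  rw [mul_apply, conv_eq_act, act_eq_single hf _ ⟨a, g⟩ ⟨t, w⟩ hw, smul_eq_mul]

theorem mul_apply_eq_zero {f : ConvAlg X} (f' : ConvAlg X) {a b : X}
    (h : ∀ t (w : a ⟶ t), f ⟨a, t, w⟩ = 0) (g : a ⟶ b) : (f * f') ⟨a, b, g⟩ = 0 := by
  rw [mul_apply, conv_eq_act]
  exact act_eq_zero (g := ⟨a, g⟩) fun k => h k.1 k.2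

theorem star_mk (f : ConvAlg X) {a b : X} (g : a ⟶ b) :
    star f ⟨a, b, g⟩ = conj (f ⟨b, a, Groupoid.inv g⟩) := rfl

theorem star_mul_apply_of_mem {f : ConvAlg X} {W : Set (Total X)} (hf : f.SupportedOn W)
    (f' : ConvAlg X) {a b t : X} (w : t ⟶ a) (hw : (⟨t, a, w⟩ : Total X) ∈ W) (g : a ⟶ b) :
    (star f * f') ⟨a, b, g⟩ = conj (f ⟨t, a, w⟩) * f' ⟨t, b, w ≫ g⟩ := by
  rw [mul_apply_of_mem hf.star f' (Groupoid.inv w) (by simpa [inverse] using hw), star_mk]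
  simp

theorem star_mul_apply_eq_zero {f : ConvAlg X} (f' : ConvAlg X) {a b : X}
    (h : ∀ t (w : t ⟶ a), f ⟨t, a, w⟩ = 0) (g : a ⟶ b) : (star f * f') ⟨a, b, g⟩ = 0 :=
  mul_apply_eq_zero f' (fun t w => by rw [star_mk, h, map_zero]) g

theorem mul_apply_of_mem_right {f' : ConvAlg X} {W : Set (Total X)} (hf : f'.SupportedOn W)
    (f : ConvAlg X) {a b t : X} (w : t ⟶ b) (hw : (⟨t, b, w⟩ : Total X) ∈ W) (g : a ⟶ b) :
    (f * f') ⟨a, b, g⟩ = f ⟨a, t, g ≫ Groupoid.inv w⟩ * f' ⟨t, b, w⟩ := by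
  have : f * f' = star (star f' * star f) := by rw [star_mul, star_star, star_star]
  rw [this, star_mk, star_mul_apply_of_mem hf _ w hw, star_mk, map_mul]
  simp [_root_.mul_comm]

/-- The value of `a⋆ * b` at a unit, for functions supported on a bisection. -/
theorem star_mul_unit_of_mem {f : ConvAlg X} {W : Set (Total X)} (hf : f.SupportedOn W)
    (f' : ConvAlg X) {y t : X} (w : t ⟶ y) (hw : (⟨t, y, w⟩ : Total X) ∈ W) :
    (star f * f') (unit y) = conj (f ⟨t, y, w⟩) * f' ⟨t, y, w⟩ := by
  rw [unit, star_mul_apply_of_mem hf f' w hw, Category.comp_id]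

/-- `f₁⋆ * f₂` is supported on the unit space if `f₁` and `f₂` are supported on one bisection. -/
theorem star_mul_unitSupported {f₁ f₂ : ConvAlg X} {W : Set (Total X)}
    (h₁ : f₁.SupportedOn W) (h₂ : ∀ g, f₂ g ≠ 0 → g ∈ W) : (star f₁ * f₂).UnitSupported := by
  rintro ⟨a, b, g⟩ hg
  by_cases hw : ∃ t, ∃ w : t ⟶ a, (⟨t, a, w⟩ : Total X) ∈ W
  · obtain ⟨t, w, hw⟩ := hw
    rw [star_mul_apply_of_mem h₁ f₂ w hw] at hg
    have h3 := h₁.isBisection.1 hw (h₂ _ (right_ne_zero_of_mul hg)) rfl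
    simp only [Total.mk.injEq, true_and] at h3
    obtain ⟨hab, h3⟩ := h3
    have hab' : a = b := hab
    subst hab'
    have h4 : g = 𝟙 a := by
      have := eq_of_heq h3
      rw [← cancel_epi w, ← this, Category.comp_id]
    exact ⟨a, by rw [h4]; rfl⟩
  · exact absurd (star_mul_apply_eq_zero f₂ (fun t w => by
      by_contra h
      exact hw ⟨t, w, h₁.mem h⟩) g) hg

/-- Urysohn functions in the convolution algebra. -/
theorem exists_bump {K V : Set (Total X)} (hK : IsCompact K) (hV : IsOpen V) (hKV : K ⊆ V) :
    ∃ χ : ConvAlg X, (∀ g ∈ K, χ g = 1) ∧ tsupport χ ⊆ V ∧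
      ∀ g, ∃ r : ℝ, 0 ≤ r ∧ r ≤ 1 ∧ χ g = r := by
  obtain ⟨k, h1, h2, h3, h4⟩ := exists_continuousMap_one_of_isCompact_subset_isOpen hK hV hKV
  have hs : HasCompactSupport k := h2
  refine ⟨mk (fun g => (k g : ℂ)) (Complex.continuous_ofReal.comp k.continuous)
    (hs.comp_left (g := ((↑) : ℝ → ℂ)) Complex.ofReal_zero), fun g hg => ?_, ?_, fun g => ?_⟩
  · simp [h1 hg]
  · refine (closure_mono ?_).trans h3
    intro g hg
    simpa using hg
  · exact ⟨k g, (h4 g).1, (h4 g).2, rfl⟩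

theorem exists_bump_supportedOn (g : Total X) {V : Set (Total X)} (hV : IsOpen V) (hg : g ∈ V) :
    ∃ (χ : ConvAlg X) (W : Set (Total X)), W ⊆ V ∧ χ.SupportedOn W ∧ χ g = 1 ∧ g ∈ W := by
  obtain ⟨W, hW, hb, hgW⟩ := exists_isBisection g
  obtain ⟨χ, h1, h2, -⟩ := exists_bump (isCompact_singleton (x := g)) (hW.inter hV)
    (singleton_subset_iff.2 ⟨hgW, hg⟩)
  exact ⟨χ, W ∩ V, inter_subset_right, ⟨hW.inter hV, ⟨hb.1.mono inter_subset_left,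
    hb.2.mono inter_subset_left⟩, h2⟩, h1 g rfl, hgW, hg⟩

/-- Urysohn functions on the unit space. -/
theorem exists_unit_bump {K U : Set X} (hK : IsCompact K) (hU : IsOpen U) (hKU : K ⊆ U) :
    ∃ h : ConvAlg X, h.UnitSupported ∧ (∀ x ∈ K, h (unit x) = 1) ∧
      (∀ x, h (unit x) ≠ 0 → x ∈ U) ∧ ∀ g, ∃ r : ℝ, 0 ≤ r ∧ r ≤ 1 ∧ h g = r := by
  obtain ⟨χ, h1, h2, h3⟩ := exists_bump (hK.image (EtaleGroupoid.continuous_unit (X := X)))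
    (hU.preimage (continuous_range (X := X))) (by rintro _ ⟨x, hx, rfl⟩; exact hKU hx)
  refine ⟨diag χ, diag_unitSupported χ, fun x hx => ?_, fun x hx => ?_, fun g => ?_⟩
  · rw [diag_unit, h1 _ ⟨x, hx, rfl⟩]
  · rw [diag_unit] at hx
    exact h2 (subset_tsupport _ hx)
  · by_cases hg : g ∈ range (unit : X → Total X)
    · obtain ⟨x, rfl⟩ := hg
      rw [diag_unit]
      exact h3 _
    · exact ⟨0, le_rfl, zero_le_one, by rw [(diag_unitSupported χ).eq_zero hg, Complex.ofReal_zero]⟩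

theorem continuous_unit_apply (f : ConvAlg X) : Continuous fun x : X => f (unit x) :=
  f.continuous.comp EtaleGroupoid.continuous_unit

end ConvAlg

end Toolkit

/-! ## Vectors in the regular representations -/

section Regular

variable {X : Type u} [Groupoid.{v} X] [TopologicalSpace (Total X)] [TopologicalSpace X]
  [EtaleGroupoid X]

theorem finite_sourceFiber (f : ConvAlg X) (x : X) :
    {h : SourceFiber x | f ⟨h.1, x, h.2⟩ ≠ 0}.Finite := by
  have h1 := finite_rangeFiber (star f) x
  let e : SourceFiber x → RangeFiber x := fun h => ⟨h.1, Groupoid.inv h.2⟩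
  refine (h1.preimage (f := e) (Function.Injective.injOn ?_)).subset ?_
  · rintro ⟨a, g⟩ ⟨b, h⟩ heq
    simp only [e, Sigma.mk.injEq] at heq
    obtain ⟨rfl, h2⟩ := heq
    have h3 : Groupoid.inv (Groupoid.inv g) = Groupoid.inv (Groupoid.inv h) := by
      rw [eq_of_heq h2]
    simpa using h3
  · intro h hh
    simp only [mem_preimage, mem_ofPred_eq, e, ConvAlg.star_mk]
    simpa using hh

/-- The Hilbert space `ℓ²(G_x)` of the regular representation. -/
abbrev RegSpace (x : X) : Type (max u v) :=
  IndSpace (1 : (⊥ : Subgroup (x ⟶ x)) →* unitary (ℂ →L[ℂ] ℂ))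

theorem out_eq_of_bot {x : X} (g : SourceFiber x) :
    (Quotient.mk (cosetSetoid (⊥ : Subgroup (x ⟶ x))) g).out = g := by
  obtain ⟨h, hh, h1⟩ := IndSpace.out_rel (S := (⊥ : Subgroup (x ⟶ x))) g
  have h2 : h = 𝟙 x := Subgroup.mem_bot.1 hh
  subst h2
  rw [Category.comp_id] at h1
  exact h1.symm

/-- The restriction of a function in the convolution algebra to `G_x`. -/
noncomputable def regVec (b : ConvAlg X) (x : X) : RegSpace x :=
  (⟨fun g => b ⟨g.1, x, g.2⟩, by
    refine ⟨fun g h => ?_, ?_⟩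
    · have h2 : (h : x ⟶ x) = 𝟙 x := Subgroup.mem_bot.1 h.2
      rw [h2, Category.comp_id]
      simp
    · refine summable_of_hasFiniteSupport ?_
      refine ((finite_sourceFiber b x).preimage (f := fun q : CosetSpace (⊥ : Subgroup (x ⟶ x)) =>
        q.out) (Function.Injective.injOn fun q q' h => ?_)).subset fun q hq => ?_
      · exact Quotient.out_injective h
      · intro h0
        apply hq
        change b ⟨q.out.1, x, q.out.2⟩ = 0 at h0
        change ‖b ⟨q.out.1, x, q.out.2⟩‖ ^ 2 = 0
        rw [h0, norm_zero, zero_pow two_ne_zero]⟩ :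
    indSubmodule (1 : (⊥ : Subgroup (x ⟶ x)) →* unitary (ℂ →L[ℂ] ℂ)))

theorem regVec_toFun (b : ConvAlg X) (x : X) (g : SourceFiber x) :
    (regVec b x).toFun g = b ⟨g.1, x, g.2⟩ := rfl

theorem regVec_add (b b' : ConvAlg X) (x : X) : regVec (b + b') x = regVec b x + regVec b' x := rfl

theorem regVec_zero (x : X) : regVec (0 : ConvAlg X) x = 0 := rfl

theorem regularRep_regVec (f b : ConvAlg X) (x : X) :
    (regularRep X x).rep f (regVec b x) = regVec (f * b) x := rfl

/-- A bisection meets `G_x` in at most one arrow, so the vector of `b` is a multiple of one basis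
vector. -/
theorem inner_regVec_of_mem {b : ConvAlg X} {W : Set (Total X)} (hb : b.SupportedOn W) {x : X}
    (η : RegSpace x) (g : SourceFiber x) (hg : (⟨g.1, x, g.2⟩ : Total X) ∈ W) :
    inner ℂ (regVec b x) η = conj (b ⟨g.1, x, g.2⟩) * η.toFun g := by
  rw [IndSpace.inner_def, tsum_eq_single (Quotient.mk _ g)]
  · rw [out_eq_of_bot, regVec_toFun, RCLike.inner_apply, mul_comm]
  · intro q hq
    have : b ⟨q.out.1, x, q.out.2⟩ = 0 := by
      by_contra h0
      apply hq
      have h1 := hb.isBisection.2 (hb.mem h0) hg rfl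
      have h2 : q.out = g := by
        generalize q.out = k at h1
        obtain ⟨a, k⟩ := k
        obtain ⟨c, g⟩ := g
        simp only [Total.mk.injEq, true_and] at h1
        obtain ⟨rfl, h3⟩ := h1
        rw [eq_of_heq h3]
      rw [← h2]
      exact (Quotient.out_eq q).symm
    rw [regVec_toFun, this, inner_zero_left]

/-- This turns statements about Hilbert spaces that vary with `x` into statements about continuous
functions of `x`. -/
theorem inner_regVec (b b' : ConvAlg X) (x : X) :
    inner ℂ (regVec b x) (regVec b' x) = (star b * b') (unit x) := by
  induction b using ConvAlg.induction with
  | h0 => rw [regVec_zero, inner_zero_left, star_zero, zero_mul, ConvAlg.zero_apply]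
  | hadd f g hf hg =>
    rw [regVec_add, inner_add_left, hf, hg, star_add, add_mul, ConvAlg.add_apply]
  | hs f W hf =>
    by_cases hw : ∃ t, ∃ w : t ⟶ x, (⟨t, x, w⟩ : Total X) ∈ W
    · obtain ⟨t, w, hw⟩ := hw
      rw [ConvAlg.star_mul_unit_of_mem hf b' w hw, inner_regVec_of_mem hf _ ⟨t, w⟩ hw, regVec_toFun]
    · have h0 : ∀ t (w : t ⟶ x), f ⟨t, x, w⟩ = 0 := fun t w => by
        by_contra h
        exact hw ⟨t, w, hf.mem h⟩
      rw [unit, ConvAlg.star_mul_apply_eq_zero b' h0, IndSpace.inner_def]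
      refine (tsum_congr fun q => ?_).trans tsum_zero
      rw [regVec_toFun, h0, inner_zero_left]

theorem norm_regVec_sq (b : ConvAlg X) (x : X) :
    ‖regVec b x‖ ^ 2 = ((star b * b) (unit x)).re := by
  rw [← inner_regVec, inner_self_eq_norm_sq_to_K]
  norm_cast

/-- The restrictions of functions in the convolution algebra are dense in `ℓ²(G_x)`. -/
theorem dense_range_regVec (x : X) : Dense (range fun b : ConvAlg X => regVec b x) := by
  let V : Submodule ℂ (RegSpace x) :=
    { carrier := range fun b : ConvAlg X => regVec b x
      add_mem' := by
        rintro _ _ ⟨b, rfl⟩ ⟨b', rfl⟩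
        exact ⟨b + b', rfl⟩
      zero_mem' := ⟨0, rfl⟩
      smul_mem' := by
        rintro c _ ⟨b, rfl⟩
        exact ⟨c • b, rfl⟩ }
  -- Testing against a bump at an arrow recovers the value of a vector there, so nothing is
  -- orthogonal to all restrictions.
  have h1 : Vᗮ = ⊥ := by
    rw [eq_bot_iff]
    intro η hη
    rw [Submodule.mem_bot]
    refine IndSpace.ext fun g => ?_
    obtain ⟨χ, W, -, hχ, h1, hg⟩ :=
      ConvAlg.exists_bump_supportedOn (⟨g.1, x, g.2⟩ : Total X) isOpen_univ trivial
    have h2 := (Submodule.mem_orthogonal V η).1 hη (regVec χ x) ⟨χ, rfl⟩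
    rw [inner_regVec_of_mem hχ η g hg, h1, map_one, one_mul] at h2
    exact h2
  have h2 := (Submodule.topologicalClosure_eq_top_iff (K := V)).2 h1
  exact (Submodule.dense_iff_topologicalClosure_eq_top (s := V)).2 h2

/-- The inequality `‖ρ_x(f)‖ ≤ c`, expressed in the convolution algebra. -/
def RegBound (c : ℝ) (f : ConvAlg X) (x : X) : Prop :=
  ∀ b : ConvAlg X, ((star (f * b) * (f * b)) (unit x)).re ≤ c ^ 2 * ((star b * b) (unit x)).re

/-- It suffices to test the operator norm on the dense set of restrictions. -/
theorem regBound_iff {c : ℝ} (hc : 0 ≤ c) (f : ConvAlg X) (x : X) :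
    RegBound c f x ↔ ‖(regularRep X x).rep f‖ ≤ c := by
  simp only [RegBound, ← norm_regVec_sq, ← regularRep_regVec, ← mul_pow]
  constructor
  · intro h
    refine ContinuousLinearMap.opNorm_le_bound _ hc fun ξ => ?_
    refine (dense_range_regVec x).induction (P := fun ξ : RegSpace x =>
      ‖(regularRep X x).rep f ξ‖ ≤ c * ‖ξ‖) ?_ ?_ ξ
    · rintro _ ⟨b, rfl⟩
      exact le_of_sq_le_sq (h b) (by positivity)
    · exact isClosed_le (((regularRep X x).rep f).continuous.norm) (by fun_prop)
  · intro h b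
    exact pow_le_pow_left₀ (norm_nonneg _) (ContinuousLinearMap.le_of_opNorm_le _ h _) 2

theorem isClosed_regBound (c : ℝ) (f : ConvAlg X) : IsClosed {x | RegBound c f x} := by
  simp only [RegBound, ofPred_forall]
  refine isClosed_iInter fun b => isClosed_le ?_ (continuous_const.mul ?_)
  · exact Complex.continuous_re.comp (ConvAlg.continuous_unit_apply _)
  · exact Complex.continuous_re.comp (ConvAlg.continuous_unit_apply _)

/-- Conjugation by a function on a bisection transports values from one end of an arrow to the
other. All invariance statements below rest on this. -/
theorem star_mul_conj_unit {β : ConvAlg X} {W : Set (Total X)} (hβ : β.SupportedOn W)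
    (f : ConvAlg X) {t y : X} (w : t ⟶ y) (hw : (⟨t, y, w⟩ : Total X) ∈ W) :
    (star β * (f * β)) (unit y) = conj (β ⟨t, y, w⟩) * (f (unit t) * β ⟨t, y, w⟩) := by
  rw [ConvAlg.star_mul_unit_of_mem hβ _ w hw, ConvAlg.mul_apply_of_mem_right hβ f w hw]
  simp [unit]

/-- `RegBound` is invariant. -/
theorem RegBound.of_hom {c : ℝ} {f : ConvAlg X} {x y : X} (h : RegBound c f x) (g : y ⟶ x) :
    RegBound c f y := by
  intro b
  -- Right multiplication by a bump at `g` carries test functions at `y` to test functions at `x`,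
  -- and preserves the values that are compared.
  obtain ⟨β, W, -, hβ, h1, hg⟩ :=
      ConvAlg.exists_bump_supportedOn (⟨y, x, g⟩ : Total X) isOpen_univ trivial
  have h2 := h (b * β)
  have h3 : ∀ k : ConvAlg X, (star (k * β) * (k * β)) (unit x) = (star k * k) (unit y) := fun k => by
    have : star (k * β) * (k * β) = star β * ((star k * k) * β) := by
      rw [star_mul]; simp only [mul_assoc]
    rw [this, star_mul_conj_unit hβ _ g hg, h1]
    simp
  rwa [show f * (b * β) = f * b * β from (mul_assoc _ _ _).symm, h3, h3] at h2

theorem reducedSeminorm_le_iff {c : ℝ} (hc : 0 ≤ c) (f : ConvAlg X) :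
    (reducedSeminorm X).toFun f ≤ c ↔ ∀ x, RegBound c f x := by
  constructor
  · intro h x
    rw [regBound_iff hc]
    refine le_trans ?_ h
    exact CStarSeminorm.norm_rep_le_ofFamily (regularRep X) _ x f
  · intro h
    change (⨆ x, ‖(regularRep X x).rep f‖) ≤ c
    rcases isEmpty_or_nonempty X with hX | hX
    · simpa using hc
    · exact ciSup_le fun x => (regBound_iff hc f x).1 (h x)

theorem CStarSeminorm.toFun_nonneg {A : Type*} [NonUnitalRing A] [StarRing A] [Module ℂ A]
    (p : CStarSeminorm A) (a : A) : 0 ≤ p.toFun a := apply_nonneg p.toSeminorm a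

end Regular

/-! ## The hull of a representation in the unit space -/

section Hull

variable {X : Type u} [Groupoid.{v} X] [TopologicalSpace (Total X)] [TopologicalSpace X]
  [EtaleGroupoid X] {H : Type*} [NormedAddCommGroup H] [InnerProductSpace ℂ H] [CompleteSpace H]

theorem norm_rep_apply_sq {A : Type*} [NonUnitalRing A] [StarRing A] [Module ℂ A]
    (π : A →⋆ₙₐ[ℂ] (H →L[ℂ] H)) (a : A) (ξ : H) :
    ‖π a ξ‖ ^ 2 = (inner ℂ ξ (π (star a * a) ξ)).re := by
  rw [map_mul, map_star, ContinuousLinearMap.star_eq_adjoint]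
  change _ = (inner ℂ ξ (ContinuousLinearMap.adjoint (π a) (π a ξ))).re
  rw [ContinuousLinearMap.adjoint_inner_right, inner_self_eq_norm_sq_to_K]
  norm_cast

theorem inner_rep_star {A : Type*} [NonUnitalRing A] [StarRing A] [Module ℂ A]
    (π : A →⋆ₙₐ[ℂ] (H →L[ℂ] H)) (a : A) (ξ η : H) :
    inner ℂ (π (star a) ξ) η = inner ℂ ξ (π a η) := by
  rw [map_star, ContinuousLinearMap.star_eq_adjoint, ContinuousLinearMap.adjoint_inner_left]

variable (π : ConvAlg X →⋆ₙₐ[ℂ] (H →L[ℂ] H))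

/-- The hull in the unit space of the kernel of a representation of the convolution algebra. -/
def hullSet : ClosedInvariantSet X where
  carrier := {x | ∀ h : ConvAlg X, h.UnitSupported → π h = 0 → h (unit x) = 0}
  isClosed := by
    simp only [ofPred_forall]
    exact isClosed_iInter fun h => isClosed_iInter fun _ => isClosed_iInter fun _ =>
      isClosed_eq (ConvAlg.continuous_unit_apply h) continuous_const
  invariant := by
    intro x y w hx h hh hπ
    -- The function `β⋆hβ` is again in the kernel and supported on units, and its value at `x` is
    -- `h(y)`.
    obtain ⟨β, W, -, hβ, h1, hg⟩ :=
      ConvAlg.exists_bump_supportedOn (⟨y, x, Groupoid.inv w⟩ : Total X) isOpen_univ trivial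
    have h2 : (star β * (h * β)).UnitSupported := ConvAlg.star_mul_unitSupported hβ fun g hg => by
      rw [hh.mul_apply] at hg
      exact hβ.mem (right_ne_zero_of_mul hg)
    have h3 := hx _ h2 (by rw [map_mul, map_mul, hπ, zero_mul, mul_zero])
    rw [star_mul_conj_unit hβ _ _ hg, h1] at h3
    simpa using h3

variable {π}

/-- The Gelfand correspondence between ideals and closed sets, inside the compactly supported
functions. Up to a small error, `h` is a multiple of a function from the kernel that is bounded
below on the compact set where `h` is not small. -/
theorem rep_eq_zero_of_hullSet {h : ConvAlg X} (hh : h.UnitSupported)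
    (h0 : ∀ x ∈ (hullSet π).carrier, h (unit x) = 0) : π h = 0 := by
  rw [← norm_le_zero_iff]
  refine le_of_forall_pos_le_add fun ε hε => ?_
  rw [zero_add]
  -- Soft thresholding: it shortens `z` by `ε`, and sends the disc of radius `ε` to `0`. The maximum
  -- in the denominator only serves to avoid dividing by zero.
  let φ : C(ℂ, ℂ) := ⟨fun z => z * ((max (‖z‖ - ε) 0 / max ‖z‖ ε : ℝ) : ℂ), by
    refine continuous_id.mul (Complex.continuous_ofReal.comp (Continuous.div (by fun_prop)
      (by fun_prop) fun z => ?_))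
    exact (hε.trans_le (le_max_right _ _)).ne'⟩
  have hφ0 : φ 0 = 0 := by simp [φ]
  have hφ1 : ∀ z, ‖z‖ ≤ ε → φ z = 0 := fun z hz => by
    simp [φ, max_eq_right (sub_nonpos.2 hz)]
  have hφ2 : ∀ z, ‖z - φ z‖ ≤ ε := fun z => by
    rcases le_total ‖z‖ ε with hz | hz
    · rwa [hφ1 z hz, sub_zero]
    · have hz0 : 0 < ‖z‖ := hε.trans_le hz
      have : z - φ z = z * ((ε / ‖z‖ : ℝ) : ℂ) := by
        simp only [φ, ContinuousMap.coe_mk, max_eq_left (sub_nonneg.2 hz), max_eq_left hz]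
        rw [sub_div, div_self hz0.ne']
        push_cast
        ring
      rw [this, norm_mul, Complex.norm_real, Real.norm_of_nonneg (by positivity)]
      rw [mul_div_cancel₀ _ hz0.ne']
  let k : ConvAlg X := ConvAlg.post φ hφ0 h
  have hk : k.UnitSupported := hh.post φ hφ0
  have hkh : ‖π (h - k)‖ ≤ ε :=
    ConvAlg.norm_apply_le_of_unitSupported π _ (hh.sub hk) ε hε.le fun g => hφ2 _
  suffices hπk : π k = 0 by rwa [map_sub, hπk, sub_zero] at hkh
  let K : Set (Total X) := {g | ε ≤ ‖h g‖}
  have hKc : IsCompact K := by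
    refine h.hasCompactSupport.isCompact.of_isClosed_subset
      (isClosed_le continuous_const h.continuous.norm) fun g hg => subset_tsupport _ fun h0 => ?_
    have h1 : ε ≤ ‖h g‖ := hg
    rw [h0, norm_zero] at h1
    linarith
  have hex : ∀ g : K, ∃ h' : ConvAlg X, h'.UnitSupported ∧ π h' = 0 ∧ h' g ≠ 0 := by
    rintro ⟨g, hg⟩
    have hg' : ε ≤ ‖h g‖ := hg
    have hgne : h g ≠ 0 := fun h0 => by rw [h0, norm_zero] at hg'; linarith
    obtain ⟨x, rfl⟩ := hh g hgne
    have hx : x ∉ (hullSet π).carrier := fun hx => hgne (h0 x hx)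
    simp only [hullSet, mem_ofPred_eq, not_forall] at hx
    obtain ⟨h', h1, h2, h3⟩ := hx
    exact ⟨h', h1, h2, h3⟩
  choose F hF1 hF2 hF3 using hex
  obtain ⟨t, ht⟩ := hKc.elim_finite_subcover (fun g : K => {g' | F g g' ≠ 0})
    (fun g => isOpen_ne_fun (F g).continuous continuous_const)
    (fun g hg => mem_iUnion.2 ⟨⟨g, hg⟩, hF3 _⟩)
  -- An element of the kernel that is strictly positive on all of `K`.
  let p : ConvAlg X := ∑ i ∈ t, star (F i) * F i
  have hp : p.UnitSupported :=
    ConvAlg.unitSupported_sum t _ fun i _ => (hF1 i).adjoint.mul (hF1 i)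
  have hπp : π p = 0 := by
    simp only [p, map_sum, map_mul, hF2, mul_zero, Finset.sum_const_zero]
  have hpval : ∀ x, p (unit x) = ((∑ i ∈ t, ‖F i (unit x)‖ ^ 2 : ℝ) : ℂ) := fun x => by
    simp only [p, ConvAlg.sum_apply, Complex.ofReal_sum]
    refine Finset.sum_congr rfl fun i _ => ?_
    rw [(hF1 i).adjoint.mul_unit, ConvAlg.star_unit, ← Complex.normSq_eq_conj_mul_self,
      Complex.normSq_eq_norm_sq]
  have hppos : ∀ g ∈ K, 0 < ‖p g‖ := fun g hg => by
    have hg' : ε ≤ ‖h g‖ := hg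
    have hgne : h g ≠ 0 := fun h0 => by rw [h0, norm_zero] at hg'; linarith
    obtain ⟨i, hi⟩ := mem_iUnion.1 (ht hg)
    obtain ⟨hit, hi⟩ := mem_iUnion.1 hi
    obtain ⟨x, rfl⟩ := hh g hgne
    rw [norm_pos_iff, hpval, Complex.ofReal_ne_zero]
    have : 0 < ‖F i (unit x)‖ ^ 2 := by
      have : 0 < ‖F i (unit x)‖ := norm_pos_iff.2 hi
      positivity
    exact (this.trans_le (Finset.single_le_sum (f := fun i => ‖F i (unit x)‖ ^ 2)
      (fun i _ => sq_nonneg _) hit)).ne'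
  obtain ⟨m, hm, hmK⟩ : ∃ m : ℝ, 0 < m ∧ ∀ g ∈ K, m ≤ ‖p g‖ := by
    rcases K.eq_empty_or_nonempty with hK | hK
    · exact ⟨1, one_pos, fun g hg => by rw [hK] at hg; exact absurd hg (notMem_empty _)⟩
    · obtain ⟨g0, hg0, hmin⟩ := hKc.exists_isMinOn hK p.continuous.norm.continuousOn
      exact ⟨_, hppos g0 hg0, fun g hg => hmin hg⟩
  -- It equals `1/p` on `K`, and `k` vanishes on the units outside `K`, so that `k = p (ψ k)`.
  let ψ : C(Total X, ℂ) := ⟨fun g => (((max ‖p g‖ m)⁻¹ : ℝ) : ℂ),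
    Complex.continuous_ofReal.comp (Continuous.inv₀ (p.continuous.norm.max continuous_const)
      fun g => (hm.trans_le (le_max_right _ _)).ne')⟩
  have hq : p * ConvAlg.pmul ψ k = k := by
    refine ConvAlg.UnitSupported.ext (hp.mul (hk.pmul ψ)) hk fun x => ?_
    rw [hp.mul_unit, ConvAlg.pmul_apply]
    by_cases hx : k (unit x) = 0
    · rw [hx, mul_zero, mul_zero]
    · have hxK : unit x ∈ K := by
        by_contra hcon
        have : ‖h (unit x)‖ ≤ ε := (not_le.1 hcon).le
        exact hx (hφ1 _ this)
      have h1 := hmK _ hxK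
      have h2 : p (unit x) = (‖p (unit x)‖ : ℂ) := by
        rw [hpval, Complex.norm_real, Real.norm_of_nonneg
          (Finset.sum_nonneg fun i _ => sq_nonneg _)]
      have h3 := hppos _ hxK
      simp only [ψ, ContinuousMap.coe_mk, max_eq_left h1]
      rw [← mul_assoc]
      conv_lhs => rw [h2]
      rw [Complex.norm_real, norm_norm, ← Complex.ofReal_mul, mul_inv_cancel₀ h3.ne',
        Complex.ofReal_one, one_mul]
  rw [← hq, map_mul, hπp, zero_mul]

/-- Truncating `h` at a height slightly above `c` does not change it on the hull, hence does not
change its image. The height is `c + ε` because it has to be nonzero. -/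
theorem norm_rep_le_of_hullSet {h : ConvAlg X} (hh : h.UnitSupported) {c : ℝ} (hc : 0 ≤ c)
    (hle : ∀ x ∈ (hullSet π).carrier, ‖h (unit x)‖ ≤ c) : ‖π h‖ ≤ c := by
  refine le_of_forall_pos_le_add fun ε hε => ?_
  let c' := c + ε
  have hc' : 0 < c' := by positivity
  let φ : C(ℂ, ℂ) := ⟨fun z => z * ((c' / max ‖z‖ c' : ℝ) : ℂ), by
    refine continuous_id.mul (Complex.continuous_ofReal.comp (Continuous.div (by fun_prop)
      (by fun_prop) fun z => ?_))
    exact (hc'.trans_le (le_max_right _ _)).ne'⟩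
  have hφ0 : φ 0 = 0 := by simp [φ]
  have hφ1 : ∀ z, ‖z‖ ≤ c' → φ z = z := fun z hz => by
    simp [φ, max_eq_right hz, hc'.ne']
  have hφ2 : ∀ z, ‖φ z‖ ≤ c' := fun z => by
    simp only [φ, ContinuousMap.coe_mk, norm_mul, Complex.norm_real]
    rw [Real.norm_of_nonneg (by positivity), ← mul_div_assoc, div_le_iff₀ (by positivity),
      mul_comm]
    exact mul_le_mul_of_nonneg_left (le_max_left _ _) hc'.le
  have h1 : π (h - ConvAlg.post φ hφ0 h) = 0 :=
    rep_eq_zero_of_hullSet (hh.sub (hh.post φ hφ0)) fun x hx => by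
      rw [ConvAlg.sub_apply, ConvAlg.post_apply, hφ1 _ ((hle x hx).trans (by simp [c', hε.le])),
        sub_self]
  rw [map_sub, sub_eq_zero] at h1
  rw [h1]
  exact ConvAlg.norm_apply_le_of_unitSupported π _ (hh.post φ hφ0) c' hc'.le fun g => hφ2 _

/-- If `|h(x)| > c = ‖π(h)‖`, then the square of `r = √(|h|² - c²)₊` lies in the kernel but does not
vanish at `x`. -/
theorem norm_apply_le_norm_rep {h : ConvAlg X} (hh : h.UnitSupported) {x : X}
    (hx : x ∈ (hullSet π).carrier) : ‖h (unit x)‖ ≤ ‖π h‖ := by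
  by_contra! hlt
  set c := ‖π h‖ with hcdef
  have hc : 0 ≤ c := norm_nonneg _
  let φ : C(ℂ, ℂ) := ⟨fun z => ((√(max (‖z‖ ^ 2 - c ^ 2) 0) : ℝ) : ℂ), by fun_prop⟩
  have hφ0 : φ 0 = 0 := by
    have : max (-c ^ 2) 0 = 0 := max_eq_right (by nlinarith)
    simp [φ, sq_nonneg]
  let r := ConvAlg.post φ hφ0 h
  have hr : r.UnitSupported := hh.post φ hφ0
  have hrr : ∀ y, conj (r (unit y)) = r (unit y) := fun y => Complex.conj_ofReal _
  -- Pointwise this is `|h|² r² = c² r² + r⁴`. Applied to a vector `v` it gives `‖π(hr)v‖² =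
  -- c²‖π(r)v‖² + ‖π(r²)v‖²`, while the left side is at most `c²‖π(r)v‖²`.
  have hid : star (h * r) * (h * r) = ((c ^ 2 : ℝ) : ℂ) • (star r * r) + star (r * r) * (r * r) := by
    refine ConvAlg.UnitSupported.ext ((hh.mul hr).adjoint.mul (hh.mul hr))
      (((hr.adjoint.mul hr).smul _).add ((hr.mul hr).adjoint.mul (hr.mul hr))) fun y => ?_
    rw [(hh.mul hr).adjoint.mul_unit, ConvAlg.add_apply, ConvAlg.smul_apply, hr.adjoint.mul_unit,
      (hr.mul hr).adjoint.mul_unit, ConvAlg.star_unit, ConvAlg.star_unit, ConvAlg.star_unit,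
      hh.mul_unit, hr.mul_unit, map_mul, map_mul, hrr]
    by_cases hy : ‖h (unit y)‖ ≤ c
    · have : r (unit y) = 0 := by
        have : max (‖h (unit y)‖ ^ 2 - c ^ 2) 0 = 0 :=
          max_eq_right (by nlinarith [norm_nonneg (h (unit y))])
        simp [r, φ, this]
      rw [this]; ring
    · have h1 : r (unit y) * r (unit y) = ((‖h (unit y)‖ ^ 2 - c ^ 2 : ℝ) : ℂ) := by
        have h2 : 0 ≤ ‖h (unit y)‖ ^ 2 - c ^ 2 := by nlinarith [not_le.1 hy]
        simp only [r, φ, ConvAlg.post_apply, ContinuousMap.coe_mk, max_eq_left h2]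
        rw [← Complex.ofReal_mul, Real.mul_self_sqrt h2]
      have h2 : conj (h (unit y)) * h (unit y) = ((‖h (unit y)‖ ^ 2 : ℝ) : ℂ) := by
        rw [← Complex.normSq_eq_conj_mul_self, Complex.normSq_eq_norm_sq]
      have h3 : conj (h (unit y)) * r (unit y) * (h (unit y) * r (unit y)) =
        (conj (h (unit y)) * h (unit y)) * (r (unit y) * r (unit y)) := by ring
      rw [h3, h2, h1]
      push_cast
      ring
  have h0 : π (r * r) = 0 := by
    ext v
    have h1 := norm_rep_apply_sq π (h * r) v
    rw [hid, map_add, map_smul, _root_.add_apply, _root_.smul_apply,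
      inner_add_right, inner_smul_right, Complex.add_re, Complex.re_ofReal_mul,
      ← norm_rep_apply_sq, ← norm_rep_apply_sq, map_mul π h r] at h1
    have h2 : ‖π h (π r v)‖ ≤ c * ‖π r v‖ := ContinuousLinearMap.le_opNorm _ _
    have h3 : ‖π h (π r v)‖ ^ 2 ≤ (c * ‖π r v‖) ^ 2 := pow_le_pow_left₀ (norm_nonneg _) h2 2
    rw [mul_pow] at h3
    have h4 : ‖(π h * π r) v‖ = ‖π h (π r v)‖ := rfl
    rw [h4] at h1
    have h5 : ‖π (r * r) v‖ ^ 2 ≤ 0 := by linarith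
    have h6 : ‖π (r * r) v‖ = 0 := by nlinarith [norm_nonneg (π (r * r) v)]
    simpa using h6
  have h1 := hx _ (hr.mul hr) h0
  rw [hr.mul_unit, mul_self_eq_zero] at h1
  have h2 : 0 < ‖h (unit x)‖ ^ 2 - c ^ 2 := by nlinarith
  have h3 : √(max (‖h (unit x)‖ ^ 2 - c ^ 2) 0) = 0 := by
    have : ((√(max (‖h (unit x)‖ ^ 2 - c ^ 2) 0) : ℝ) : ℂ) = 0 := h1
    exact_mod_cast this
  rw [max_eq_left h2.le] at h3
  exact (Real.sqrt_pos.2 h2).ne' h3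

end Hull

/-! ## Amenability: representations are bounded by the regular representations over the hull -/

section Positivity

variable {H : Type*} [NormedAddCommGroup H] [InnerProductSpace ℂ H]

/-- A positive semidefinite matrix of scalars defines a positive form on tuples of vectors. -/
theorem re_sum_mul_inner_nonneg {ι : Type*} [Fintype ι] (m : ι → ι → ℂ)
    (hm : ∀ z : ι → ℂ, 0 ≤ (∑ i, ∑ j, conj (z i) * z j * m i j).re) (a : ι → H) :
    0 ≤ (∑ i, ∑ j, m i j * inner ℂ (a i) (a j)).re := by
  -- In an orthonormal basis `e_k` of the span, the form splits into a sum over `k` of scalar forms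
  -- at `z_i = ⟨e_k, a_i⟩`.
  let S : Submodule ℂ H := Submodule.span ℂ (range a)
  have : FiniteDimensional ℂ S := FiniteDimensional.span_of_finite ℂ (finite_range a)
  let e := stdOrthonormalBasis ℂ S
  let a' : ι → S := fun i => ⟨a i, Submodule.subset_span ⟨i, rfl⟩⟩
  have h1 : ∀ i j, inner ℂ (a i) (a j) = ∑ k, inner ℂ (a' i) (e k) * inner ℂ (e k) (a' j) :=
    fun i j => (e.sum_inner_mul_inner (a' i) (a' j)).symm
  have h2 : ∑ i, ∑ j, m i j * inner ℂ (a i) (a j) =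
      ∑ k, ∑ i, ∑ j, conj (inner ℂ (e k) (a' i)) * inner ℂ (e k) (a' j) * m i j := by
    rw [Finset.sum_comm]
    simp only [h1, Finset.mul_sum]
    rw [Finset.sum_comm]
    have : ∀ i j, ∑ k, m i j * (inner ℂ (a' i) (e k) * inner ℂ (e k) (a' j)) =
        ∑ k, conj (inner ℂ (e k) (a' i)) * inner ℂ (e k) (a' j) * m i j := fun i j =>
      Finset.sum_congr rfl fun k _ => by rw [inner_conj_symm]; ring
    simp only [this]
    rw [Finset.sum_congr rfl fun i _ => Finset.sum_comm, Finset.sum_comm]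
  rw [h2, Complex.re_sum]
  exact Finset.sum_nonneg fun k _ => hm _

end Positivity

/-! ### Positive matrices of functions and pointwise multipliers -/

section Amenable

variable {X : Type u} [Groupoid.{v} X] [TopologicalSpace (Total X)] [TopologicalSpace X]
  [EtaleGroupoid X] {H : Type*} [NormedAddCommGroup H] [InnerProductSpace ℂ H] [CompleteSpace H]
  {π : ConvAlg X →⋆ₙₐ[ℂ] (H →L[ℂ] H)}

/-- Matrices of functions on the unit space can be approximated on the hull by combinations of
constant matrices. -/
theorem exists_partition_approx {ι : Type*} [Finite ι] (Y : ClosedInvariantSet X)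
    (c : ι → ConvAlg X) {ε : ℝ} (hε : 0 < ε) :
    ∃ (t : Finset (Total X)) (θ : t → ConvAlg X), (∀ k, (θ k).UnitSupported) ∧
      (∀ k : t, ∃ x ∈ Y.carrier, unit x = (k : Total X)) ∧
      ∀ i, ∀ x ∈ Y.carrier,
        ‖(c i - ∑ k : t, c i k • (star (θ k) * θ k)) (unit x)‖ ≤ ε := by
  have := Fintype.ofFinite ι
  let S : Set (Total X) := ⋃ i, tsupport (c i)
  have hS : IsCompact S := isCompact_iUnion fun i => (c i).hasCompactSupport
  -- The sample points are taken among the units over `Y`, as positivity is only known there.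
  let T : Set (Total X) := S ∩ (range unit ∩ rng ⁻¹' Y.carrier)
  have hT : IsCompact T :=
    hS.inter_right (isClosed_range_unit.inter (Y.isClosed.preimage ConvAlg.continuous_range))
  let O : Total X → Set (Total X) := fun g => ⋂ i, {g' | ‖c i g' - c i g‖ < ε}
  have hO : ∀ g, IsOpen (O g) := fun g => isOpen_iInter_of_finite fun i =>
    isOpen_lt ((c i).continuous.sub continuous_const).norm continuous_const
  have hgO : ∀ g, g ∈ O g := fun g => mem_iInter.2 fun i => by simpa using hε
  obtain ⟨t, htT, ht⟩ := hT.elim_nhds_subcover O fun g _ => (hO g).mem_nhds (hgO g)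
  obtain ⟨f, hf, hfc⟩ := PartitionOfUnity.exists_isSubordinate_of_locallyFinite_t2space hT
    (fun k : t => O k) (fun k => hO k) (locallyFinite_of_finite _) (by
      intro g hg
      obtain ⟨k, hk⟩ := mem_iUnion.1 (ht hg)
      obtain ⟨hkt, hk⟩ := mem_iUnion.1 hk
      exact mem_iUnion.2 ⟨⟨k, hkt⟩, hk⟩)
  -- Square roots are taken so that the partition functions have the form `θ⋆θ`, which can be moved
  -- to both sides of an inner product.
  let θ : t → ConvAlg X := fun k => ConvAlg.diag (ConvAlg.mk (fun g => ((√(f k g) : ℝ) : ℂ))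
    (Complex.continuous_ofReal.comp (Real.continuous_sqrt.comp (f k).continuous))
    ((hfc k).comp_left (g := fun r : ℝ => ((√r : ℝ) : ℂ)) (by simp)))
  have hθ : ∀ k, (θ k).UnitSupported := fun k => ConvAlg.diag_unitSupported _
  refine ⟨t, θ, hθ, fun k => ?_, fun i x hx => ?_⟩
  · obtain ⟨-, ⟨x, hx⟩, h2⟩ := htT k k.2
    refine ⟨x, ?_, hx⟩
    rw [← hx] at h2
    exact h2
  have hval : ∀ k, (star (θ k) * θ k) (unit x) = (f k (unit x) : ℂ) := fun k => by
    rw [(hθ k).adjoint.mul_unit, ConvAlg.star_unit]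
    simp only [θ, ConvAlg.diag_unit, ConvAlg.mk_apply, Complex.conj_ofReal]
    rw [← Complex.ofReal_mul, Real.mul_self_sqrt (f.nonneg k _)]
  have hle : ∑ k, f k (unit x) ≤ 1 := by
    have := f.sum_le_one (unit x)
    rwa [finsum_eq_sum_of_fintype] at this
  have hsum : (c i - ∑ k : t, c i k • (star (θ k) * θ k)) (unit x) =
      ∑ k : t, (f k (unit x) : ℂ) * (c i (unit x) - c i k) +
        (1 - ((∑ k, f k (unit x) : ℝ) : ℂ)) * c i (unit x) := by
    rw [ConvAlg.sub_apply, ConvAlg.sum_apply]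
    simp only [ConvAlg.smul_apply, hval, mul_sub, Finset.sum_sub_distrib, ← Finset.sum_mul]
    push_cast
    rw [Finset.sum_congr rfl fun (k : t) _ => mul_comm (c i k) _]
    ring
  -- Over `Y`, either the partition sums to `1`, or all the functions `c i` vanish.
  have h0 : (1 - ((∑ k, f k (unit x) : ℝ) : ℂ)) * c i (unit x) = 0 := by
    by_cases hxT : unit x ∈ T
    · have h1 := f.sum_eq_one hxT
      rw [finsum_eq_sum_of_fintype] at h1
      rw [h1]
      simp
    · have : c i (unit x) = 0 := by
        by_contra h0
        exact hxT ⟨mem_iUnion.2 ⟨i, subset_tsupport _ h0⟩, ⟨x, rfl⟩, hx⟩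
      rw [this, mul_zero]
  rw [hsum, h0, add_zero]
  calc ‖∑ k : t, (f k (unit x) : ℂ) * (c i (unit x) - c i k)‖
      ≤ ∑ k : t, f k (unit x) * ε := by
        refine norm_sum_le_of_le _ fun k _ => ?_
        rw [norm_mul, Complex.norm_real, Real.norm_of_nonneg (f.nonneg k _)]
        by_cases hk : f k (unit x) = 0
        · rw [hk, zero_mul, zero_mul]
        · have h1 : unit x ∈ O k := hf k (subset_tsupport _ hk)
          exact mul_le_mul_of_nonneg_left (mem_iInter.1 h1 i).le (f.nonneg k _)
    _ ≤ ε := by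
        rw [← Finset.sum_mul]
        exact mul_le_of_le_one_left hε.le hle

/-- A matrix of functions on the unit space that is positive semidefinite at the points of the hull
is mapped to a positive matrix of operators. -/
theorem re_sum_inner_rep_nonneg {ι : Type*} [Fintype ι] (c : ι → ι → ConvAlg X)
    (hc : ∀ i j, (c i j).UnitSupported)
    (hpos : ∀ x ∈ (hullSet π).carrier, ∀ z : ι → ℂ,
      0 ≤ (∑ i, ∑ j, conj (z i) * z j * c i j (unit x)).re) (a : ι → H) :
    0 ≤ (∑ i, ∑ j, inner ℂ (a i) (π (c i j) (a j))).re := by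
  -- Up to an error of norm `ε` over the hull, hence in the representation, the matrix is `∑ c(x_k)
  -- θ_k⋆θ_k` with scalar matrices `c(x_k)` that are positive since `x_k` is in the hull.
  have key : ∀ ε : ℝ, 0 < ε → -(ε * ∑ i, ∑ j, ‖a i‖ * ‖a j‖) ≤
      (∑ i, ∑ j, inner ℂ (a i) (π (c i j) (a j))).re := by
    intro ε hε
    obtain ⟨t, θ, hθ, htY, happ⟩ :=
      exists_partition_approx (hullSet π) (fun p : ι × ι => c p.1 p.2) hε
    let d : ι → ι → ConvAlg X := fun i j => c i j - ∑ k : t, c i j k • (star (θ k) * θ k)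
    have hd : ∀ i j, ‖π (d i j)‖ ≤ ε := fun i j =>
      norm_rep_le_of_hullSet ((hc i j).sub (ConvAlg.unitSupported_sum _ _ fun k _ =>
        ((hθ k).adjoint.mul (hθ k)).smul _)) hε.le (fun x hx => happ (i, j) x hx)
    have h1 : ∀ i j, inner ℂ (a i) (π (c i j) (a j)) = inner ℂ (a i) (π (d i j) (a j)) +
        ∑ k : t, c i j k * inner ℂ (π (θ k) (a i)) (π (θ k) (a j)) := fun i j => by
      have h2 : π (c i j) = π (d i j) + ∑ k : t, c i j k • π (star (θ k) * θ k) := by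
        simp only [d, map_sub, map_sum, map_smul, sub_add_cancel]
      rw [h2, _root_.add_apply, inner_add_right, _root_.sum_apply, inner_sum]
      congr 1
      refine Finset.sum_congr rfl fun k _ => ?_
      rw [_root_.smul_apply, inner_smul_right, map_mul]
      have h3 := inner_rep_star π (star (θ k)) (a i) (π (θ k) (a j))
      rw [star_star] at h3
      rw [h3]
      rfl
    simp only [h1, Finset.sum_add_distrib]
    have h3 : ∑ i, ∑ j, ∑ k : t, c i j k * inner ℂ (π (θ k) (a i)) (π (θ k) (a j)) =
        ∑ k : t, ∑ i, ∑ j, c i j k * inner ℂ (π (θ k) (a i)) (π (θ k) (a j)) := by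
      rw [Finset.sum_congr rfl fun i _ => Finset.sum_comm, Finset.sum_comm]
    rw [h3, Complex.add_re, Complex.re_sum Finset.univ (fun k : t => _)]
    have h4 : 0 ≤ ∑ k : t, (∑ i, ∑ j, c i j k * inner ℂ (π (θ k) (a i)) (π (θ k) (a j))).re := by
      refine Finset.sum_nonneg fun k _ => re_sum_mul_inner_nonneg _ (fun z => ?_) _
      obtain ⟨x, hx, hxk⟩ := htY k
      rw [← hxk]
      exact hpos x hx z
    have h5 : ‖∑ i, ∑ j, inner ℂ (a i) (π (d i j) (a j))‖ ≤ ε * ∑ i, ∑ j, ‖a i‖ * ‖a j‖ := by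
      rw [Finset.mul_sum]
      refine norm_sum_le_of_le _ fun i _ => ?_
      rw [Finset.mul_sum]
      refine norm_sum_le_of_le _ fun j _ => ?_
      calc _ ≤ ‖a i‖ * ‖π (d i j) (a j)‖ := norm_inner_le_norm _ _
        _ ≤ ‖a i‖ * (ε * ‖a j‖) := mul_le_mul_of_nonneg_left
            (ContinuousLinearMap.le_of_opNorm_le _ (hd i j) _) (norm_nonneg _)
        _ = _ := by ring
    have h6 := (abs_le.1 ((Complex.abs_re_le_norm _).trans h5)).1
    linarith
  by_contra! hneg
  set s := (∑ i, ∑ j, inner ℂ (a i) (π (c i j) (a j))).re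
  set C := ∑ i, ∑ j, ‖a i‖ * ‖a j‖
  have hC : 0 ≤ C := Finset.sum_nonneg fun i _ => Finset.sum_nonneg fun j _ => by positivity
  have h1 := key (-s / (2 * (C + 1))) (div_pos (by linarith) (by linarith))
  have h2 : -s / (2 * (C + 1)) * C ≤ -s / 2 := by
    rw [div_mul_eq_mul_div, div_le_div_iff₀ (by linarith) two_pos]
    nlinarith
  linarith

/-- Decomposition into functions supported on bisections, with local units. -/
theorem ConvAlg.exists_decomposition (f : ConvAlg X) :
    ∃ (ι : Type) (_ : Fintype ι) (F χ : ι → ConvAlg X) (W : ι → Set (Total X)),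
      f = ∑ i, F i ∧ ∀ i, (F i).SupportedOn (W i) ∧ (χ i).SupportedOn (W i) ∧
        ∀ g, F i g ≠ 0 → χ i g = 1 := by
  induction f using ConvAlg.induction with
  | h0 => exact ⟨Empty, inferInstance, Empty.elim, Empty.elim, Empty.elim, by simp, nofun⟩
  | hadd f g hf hg =>
    obtain ⟨ι, _, F, χ, W, h1, h2⟩ := hf
    obtain ⟨ι', _, F', χ', W', h1', h2'⟩ := hg
    refine ⟨ι ⊕ ι', inferInstance, Sum.elim F F', Sum.elim χ χ', Sum.elim W W', ?_, ?_⟩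
    · rw [h1, h1', Fintype.sum_sum_type]
      rfl
    · rintro (i | i)
      · exact h2 i
      · exact h2' i
  | hs f W hf =>
    obtain ⟨χ, h1, h2, -⟩ := ConvAlg.exists_bump f.hasCompactSupport.isCompact hf.isOpen
      hf.tsupport_subset
    exact ⟨Unit, inferInstance, fun _ => f, fun _ => χ, fun _ => W, by simp, fun _ =>
      ⟨hf, ⟨hf.isOpen, hf.isBisection, h2⟩, fun g hg => h1 g (subset_tsupport _ hg)⟩⟩

/-- Pointwise multiplication by `F F'⋆` factors through the unit space. An arrow `g = w w'⁻¹` with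
`w ∈ W`, `w' ∈ W'` is determined by its range, so `f(g)` is a value at a unit of `χ⋆ f χ'`, where
`χ` and `χ'` are local units on the two bisections. -/
theorem pmul_mul_star_eq {F F' χ χ' : ConvAlg X} {W W' : Set (Total X)} (hF : F.SupportedOn W)
    (hF' : F'.SupportedOn W') (hχ : χ.SupportedOn W) (hχ' : χ'.SupportedOn W')
    (h1 : ∀ g, F g ≠ 0 → χ g = 1) (h1' : ∀ g, F' g ≠ 0 → χ' g = 1) (f : ConvAlg X) :
    ConvAlg.pmul (F * star F').toCont f =
      F * (ConvAlg.diag (star χ * (f * χ')) * star F') := by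
  ext g
  obtain ⟨a, b, g⟩ := g
  rw [ConvAlg.pmul_apply, ConvAlg.toCont_apply]
  by_cases hw : ∃ t, ∃ w : a ⟶ t, (⟨a, t, w⟩ : Total X) ∈ W
  · obtain ⟨t, w, hw⟩ := hw
    rw [ConvAlg.mul_apply_of_mem hF _ w hw, ConvAlg.mul_apply_of_mem hF _ w hw,
      (ConvAlg.diag_unitSupported _).mul_apply, ConvAlg.diag_unit, ConvAlg.star_mk]
    by_cases hw0 : F ⟨a, t, w⟩ = 0
    · rw [hw0]; ring
    by_cases hw1 : F' ⟨b, t, Groupoid.inv (Groupoid.inv w ≫ g)⟩ = 0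
    · rw [hw1, map_zero]; ring
    rw [ConvAlg.star_mul_unit_of_mem hχ _ w hw, h1 _ hw0,
      ConvAlg.mul_apply_of_mem_right hχ' _ _ (hF'.mem hw1), h1' _ hw1]
    simp only [map_one, one_mul, mul_one]
    have : w ≫ Groupoid.inv (Groupoid.inv (Groupoid.inv w ≫ g)) = g := by simp
    rw [this]
    ring
  · have h0 : ∀ t (w : a ⟶ t), F ⟨a, t, w⟩ = 0 := fun t w => by
      by_contra h
      exact hw ⟨t, w, hF.mem h⟩
    rw [ConvAlg.mul_apply_eq_zero _ h0, ConvAlg.mul_apply_eq_zero _ h0, zero_mul]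

/-- With `ξ = ∑ F_i` on bisections, the left side is a form in the vectors `π(F_i⋆)v`, given by the
matrix of functions `χ_i⋆ f⋆f χ_j` on the unit space. The regular bound on linear combinations of
the `χ_j` dominates that matrix over the hull by `M²` times the matrix of `χ_i⋆χ_j`, and the latter
gives back a function on the unit space that is bounded by `s`. -/
theorem re_inner_pmul_le {M : ℝ} {f : ConvAlg X}
    (hf : ∀ x ∈ (hullSet π).carrier, RegBound M f x) (ξ : ConvAlg X) {s : ℝ} (hs : 0 ≤ s)
    (hξ : ∀ x, ‖(ξ * star ξ) (unit x)‖ ≤ s) (v : H) :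
    (inner ℂ v (π (ConvAlg.pmul (ξ * star ξ).toCont (star f * f)) v)).re ≤
      M ^ 2 * (s * ‖v‖ ^ 2) := by
  obtain ⟨ι, _, F, χ, W, hξF, hF⟩ := ξ.exists_decomposition
  -- A substitute for the unit of the algebra: it fixes all the local units `χ i` from the left.
  obtain ⟨κ, hκ, hκ1, -, hκ2⟩ := ConvAlg.exists_unit_bump (X := X)
    (K := ⋃ i, rng '' tsupport (χ i))
    (isCompact_iUnion fun i => (χ i).hasCompactSupport.isCompact.image ConvAlg.continuous_range)
    isOpen_univ (subset_univ _)
  have hκχ : ∀ i, κ * χ i = χ i := fun i => by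
    ext g
    rw [hκ.mul_apply]
    by_cases hg : χ i g = 0
    · rw [hg, mul_zero]
    · rw [hκ1 _ (mem_iUnion.2 ⟨i, g, subset_tsupport _ hg, rfl⟩), one_mul]
  let G : ConvAlg X → ι → ι → ConvAlg X := fun k i j => ConvAlg.diag (star (χ i) * (k * χ j))
  have hexp : ∀ k : ConvAlg X, inner ℂ v (π (ConvAlg.pmul (ξ * star ξ).toCont k) v) =
      ∑ i, ∑ j, inner ℂ (π (star (F i)) v) (π (G k i j) (π (star (F j)) v)) := fun k => by
    have h1 : ConvAlg.pmul (ξ * star ξ).toCont k = ∑ i, ∑ j, F i * (G k i j * star (F j)) := by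
      have h2 : ∀ i j, F i * (G k i j * star (F j)) = ConvAlg.pmul (F i * star (F j)).toCont k :=
        fun i j => (pmul_mul_star_eq (hF i).1 (hF j).1 (hF i).2.1 (hF j).2.1 (hF i).2.2
          (hF j).2.2 k).symm
      simp only [h2]
      ext g
      simp only [ConvAlg.sum_apply, ConvAlg.pmul_apply, ConvAlg.toCont_apply, ← Finset.sum_mul]
      congr 1
      conv_lhs => rw [hξF, star_sum, Finset.sum_mul_sum]
      simp only [ConvAlg.sum_apply]
    rw [h1, map_sum, _root_.sum_apply, inner_sum]
    refine Finset.sum_congr rfl fun i _ => ?_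
    rw [map_sum, _root_.sum_apply, inner_sum]
    refine Finset.sum_congr rfl fun j _ => ?_
    rw [map_mul, map_mul, inner_rep_star]
    rfl
  have hpsd := re_sum_inner_rep_nonneg (π := π)
    (fun i j => ((M ^ 2 : ℝ) : ℂ) • G κ i j - G (star f * f) i j)
    (fun i j => ((ConvAlg.diag_unitSupported _).smul _).sub (ConvAlg.diag_unitSupported _)) (by
      intro x hx z
      -- Positivity of the matrix at `x`, evaluated on `z`, is the regular bound tested on this
      -- combination.
      have hb := hf x hx (∑ j, z j • χ j)
      have h1 : ∀ k : ConvAlg X, ∑ i, ∑ j, conj (z i) * z j * G k i j (unit x) =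
          (star (∑ i, z i • χ i) * (k * ∑ j, z j • χ j)) (unit x) := fun k => by
        simp only [star_sum, star_smul, Finset.mul_sum, Finset.sum_mul, ConvAlg.sum_apply,
          mul_smul_comm, smul_mul_assoc, ConvAlg.smul_apply, G, ConvAlg.diag_unit]
        rw [Finset.sum_comm]
        refine Finset.sum_congr rfl fun j _ => Finset.sum_congr rfl fun i _ => ?_
        simp only [starRingEnd_apply]
        ring
      have h2 : ∑ i, ∑ j, conj (z i) * z j *
          (((M ^ 2 : ℝ) : ℂ) • G κ i j - G (star f * f) i j) (unit x) =
          ((M ^ 2 : ℝ) : ℂ) * (star (∑ i, z i • χ i) * (κ * ∑ j, z j • χ j)) (unit x) -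
          (star (∑ i, z i • χ i) * ((star f * f) * ∑ j, z j • χ j)) (unit x) := by
        rw [← h1, ← h1]
        simp only [Finset.mul_sum, ← Finset.sum_sub_distrib, ConvAlg.sub_apply,
          ConvAlg.smul_apply]
        exact Finset.sum_congr rfl fun i _ => Finset.sum_congr rfl fun j _ => by ring
      have h3 : κ * ∑ j, z j • χ j = ∑ j, z j • χ j := by
        simp only [Finset.mul_sum, mul_smul_comm, hκχ]
      rw [h2, h3, Complex.sub_re, Complex.re_ofReal_mul]
      rw [star_mul] at hb
      simp only [mul_assoc] at hb ⊢
      linarith) (fun i => π (star (F i)) v)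
  have h4 : (∑ i, ∑ j, inner ℂ (π (star (F i)) v)
      (π (((M ^ 2 : ℝ) : ℂ) • G κ i j - G (star f * f) i j) (π (star (F j)) v))) =
      ((M ^ 2 : ℝ) : ℂ) * inner ℂ v (π (ConvAlg.pmul (ξ * star ξ).toCont κ) v) -
        inner ℂ v (π (ConvAlg.pmul (ξ * star ξ).toCont (star f * f)) v) := by
    rw [hexp, hexp]
    simp only [Finset.mul_sum, ← Finset.sum_sub_distrib]
    refine Finset.sum_congr rfl fun i _ => Finset.sum_congr rfl fun j _ => ?_
    rw [map_sub, map_smul, _root_.sub_apply, _root_.smul_apply, inner_sub_right, inner_smul_right]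
  rw [h4, Complex.sub_re, Complex.re_ofReal_mul] at hpsd
  -- Since `κ` lives on the units, only the values of `ξξ⋆` at units enter, and these are bounded by
  -- `s`.
  have h5 : ‖π (ConvAlg.pmul (ξ * star ξ).toCont κ)‖ ≤ s := by
    refine norm_rep_le_of_hullSet (hκ.pmul _) hs fun x _ => ?_
    obtain ⟨r, hr0, hr1, hr⟩ := hκ2 (unit x)
    rw [ConvAlg.pmul_apply, ConvAlg.toCont_apply, norm_mul, hr, Complex.norm_real,
      Real.norm_of_nonneg hr0]
    exact (mul_le_of_le_one_right (norm_nonneg _) hr1).trans (hξ x)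
  have h6 : (inner ℂ v (π (ConvAlg.pmul (ξ * star ξ).toCont κ) v)).re ≤ s * ‖v‖ ^ 2 := by
    refine (Complex.re_le_norm _).trans ((norm_inner_le_norm _ _).trans ?_)
    have := ContinuousLinearMap.le_of_opNorm_le _ h5 v
    nlinarith [norm_nonneg v]
  nlinarith [sq_nonneg M]

end Amenable

/-! ### Norm bounds from amenability -/

section AmenableBound

variable {X : Type u} [Groupoid.{v} X] [TopologicalSpace (Total X)] [TopologicalSpace X]
  [EtaleGroupoid X]

/-- On one bisection every representation is bounded by the supremum norm, and pointwise
multiplication does not enlarge the bisection. The constant depends on `f` alone, so uniformly small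
multipliers give small operators. -/
theorem ConvAlg.exists_norm_rep_pmul_le (f : ConvAlg X) : ∃ C : ℝ, 0 ≤ C ∧
    ∀ (φ : C(Total X, ℂ)) (δ : ℝ), 0 ≤ δ → (∀ g, ‖φ g‖ ≤ δ) →
      ∀ {H : Type w} [NormedAddCommGroup H] [InnerProductSpace ℂ H] [CompleteSpace H]
        (π : ConvAlg X →⋆ₙₐ[ℂ] (H →L[ℂ] H)), ‖π (ConvAlg.pmul φ f)‖ ≤ C * δ := by
  induction f using ConvAlg.induction with
  | h0 =>
    refine ⟨0, le_rfl, fun φ δ hδ h H _ _ _ π => ?_⟩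
    have : ConvAlg.pmul φ 0 = 0 := by ext g; simp
    rw [this, map_zero, norm_zero, zero_mul]
  | hadd f g hf hg =>
    obtain ⟨C, hC, h1⟩ := hf
    obtain ⟨C', hC', h2⟩ := hg
    refine ⟨C + C', add_nonneg hC hC', fun φ δ hδ h H _ _ _ π => ?_⟩
    have : ConvAlg.pmul φ (f + g) = ConvAlg.pmul φ f + ConvAlg.pmul φ g := by
      ext g; simp [mul_add]
    rw [this, map_add, add_mul]
    exact (norm_add_le _ _).trans (add_le_add (h1 φ δ hδ h π) (h2 φ δ hδ h π))
  | hs f W hf =>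
    obtain ⟨c, hc, hfc⟩ := f.exists_norm_le
    refine ⟨c, hc, fun φ δ hδ h H _ _ _ π => ?_⟩
    have h1 : (ConvAlg.pmul φ f).SupportedOn W := ⟨hf.isOpen, hf.isBisection,
      (closure_mono fun g hg => right_ne_zero_of_mul hg).trans hf.tsupport_subset⟩
    refine h1.norm_rep_le (mul_nonneg hc hδ) (fun g => ?_) π
    rw [ConvAlg.pmul_apply, norm_mul, mul_comm]
    exact mul_le_mul (hfc g) (h g) (norm_nonneg _) hc

/-- Passes from the `ℓ¹` form of amenability to an `ℓ²` form. Termwise, `√a √b - a = √a(√b - √a)`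
and `b - a = (√a + √b)(√b - √a)`. -/
theorem abs_sum_sqrt_mul_sqrt_sub_le {ι : Type*} (s : Finset ι) (a b : ι → ℝ)
    (ha : ∀ i, 0 ≤ a i) (hb : ∀ i, 0 ≤ b i) :
    |∑ i ∈ s, √(a i) * √(b i) - ∑ i ∈ s, a i| ≤ ∑ i ∈ s, |b i - a i| := by
  rw [← Finset.sum_sub_distrib]
  refine (Finset.abs_sum_le_sum_abs _ _).trans (Finset.sum_le_sum fun i _ => ?_)
  have h1 := Real.sq_sqrt (ha i)
  have h2 := Real.sq_sqrt (hb i)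
  have h3 := Real.sqrt_nonneg (a i)
  have h4 := Real.sqrt_nonneg (b i)
  have h5 : √(a i) * √(b i) - a i = √(a i) * (√(b i) - √(a i)) := by nlinarith
  have h6 : b i - a i = (√(a i) + √(b i)) * (√(b i) - √(a i)) := by nlinarith
  rw [h5, h6, abs_mul, abs_mul, abs_of_nonneg h3, abs_of_nonneg (add_nonneg h3 h4)]
  exact mul_le_mul_of_nonneg_right (by linarith) (abs_nonneg _)

/-- The functions of positive type that witness amenability. -/
theorem IsAmenable.exists_mul_star_near_one (hX : IsAmenable X) {K : Set (Total X)}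
    (hK : IsCompact K) {δ : ℝ} (hδ : 0 < δ) :
    ∃ ξ : ConvAlg X, (∀ x, ‖(ξ * star ξ) (unit x)‖ ≤ 1 + δ) ∧
      ∀ g ∈ K, ‖(ξ * star ξ) g - 1‖ ≤ δ := by
  obtain ⟨κ, hκ, hκ1, -, hκ2⟩ := ConvAlg.exists_unit_bump (X := X) (K := rng '' K ∪ src '' K)
    ((hK.image ConvAlg.continuous_range).union (hK.image ConvAlg.continuous_source))
    isOpen_univ (subset_univ _)
  -- The sums of `f` are controlled only over a compact set. Including the support of `κ` and
  -- cutting down with `κ` afterwards makes the bound at units hold everywhere.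
  obtain ⟨f, hfc, hf0, hf⟩ := hX (K ∪ tsupport κ) (hK.union κ.hasCompactSupport) (δ / 2)
    (half_pos hδ)
  let η : ConvAlg X := ConvAlg.mk (fun g => ((√(f g) : ℝ) : ℂ))
    (Complex.continuous_ofReal.comp (Real.continuous_sqrt.comp f.continuous))
    (hfc.comp_left (g := fun r : ℝ => ((√r : ℝ) : ℂ)) (by simp))
  have hη : ∀ g ∈ K ∪ tsupport κ, ‖(η * star η) g - 1‖ ≤ δ := by
    intro g hg
    obtain ⟨h1, h2⟩ := hf g hg
    let a : RangeFiber (rng g) → ℝ := fun h => f ⟨rng g, h.1, h.2⟩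
    let b : RangeFiber (rng g) → ℝ := fun h => f ⟨src g, h.1, Groupoid.inv g.hom ≫ h.2⟩
    let fC : ConvAlg X := ConvAlg.mk (fun g => (f g : ℂ))
      (Complex.continuous_ofReal.comp f.continuous)
      (hfc.comp_left (g := fun r : ℝ => (r : ℂ)) Complex.ofReal_zero)
    have ha : {h | a h ≠ 0}.Finite :=
      (finite_rangeFiber fC (rng g)).subset fun h hh => Complex.ofReal_ne_zero.2 hh
    have hb : {h | b h ≠ 0}.Finite := by
      have := (finite_rangeFiber fC (src g)).preimage
        (f := (compRangeFiber (Groupoid.inv g.hom) : RangeFiber (rng g) → RangeFiber (src g)))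
        (Equiv.injective _).injOn
      exact this.subset fun h hh => Complex.ofReal_ne_zero.2 hh
    let s := (ha.union hb).toFinset
    have hs : ∀ h, h ∉ s → a h = 0 ∧ b h = 0 := fun h hh => by
      simp only [s, Finite.mem_toFinset, mem_union, mem_ofPred_eq, not_or, not_not] at hh
      exact hh
    have e1 : (∑ᶠ h : RangeFiber (rng g), f ⟨rng g, h.1, h.2⟩) = ∑ h ∈ s, a h := by
      refine finsum_eq_sum_of_support_subset _ fun h hh => ?_
      by_contra hcon
      exact hh (hs h (by simpa using hcon)).1
    have e2 : (∑ᶠ h : RangeFiber (rng g), |f ⟨src g, h.1, Groupoid.inv g.hom ≫ h.2⟩ -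
        f ⟨rng g, h.1, h.2⟩|) = ∑ h ∈ s, |b h - a h| := by
      refine finsum_eq_sum_of_support_subset _ fun h hh => ?_
      by_contra hcon
      obtain ⟨h3, h4⟩ := hs h (by simpa using hcon)
      apply hh
      change |b h - a h| = 0
      rw [h3, h4, sub_zero, abs_zero]
    -- The function `ηη⋆` at `g` is the inner product of `√f` on the range fibre of `r(g)` with its
    -- translate from that of `s(g)`.
    have e3 : (η * star η) g = ((∑ h ∈ s, √(a h) * √(b h) : ℝ) : ℂ) := by
      rw [ConvAlg.mul_apply, ConvAlg.conv, Complex.ofReal_sum]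
      have : ∀ h : RangeFiber (rng g), η ⟨rng g, h.1, h.2⟩ *
          star η ⟨h.1, src g, Groupoid.inv h.2 ≫ g.hom⟩ = ((√(a h) * √(b h) : ℝ) : ℂ) := by
        intro h
        rw [ConvAlg.star_mk]
        simp only [η, ConvAlg.mk_apply, Complex.conj_ofReal, a, b]
        rw [Complex.ofReal_mul]
        congr 5
        simp
      rw [finsum_congr this]
      refine finsum_eq_sum_of_support_subset _ fun h hh => ?_
      by_contra hcon
      obtain ⟨h3, h4⟩ := hs h (by simpa using hcon)
      apply hh
      change ((√(a h) * √(b h) : ℝ) : ℂ) = 0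
      rw [h3]
      simp
    rw [e1] at h1
    rw [e2] at h2
    have h3 := abs_sum_sqrt_mul_sqrt_sub_le s a b (fun _ => hf0 _) (fun _ => hf0 _)
    rw [e3, ← Complex.ofReal_one, ← Complex.ofReal_sub, Complex.norm_real, Real.norm_eq_abs]
    have h4 : ∑ h ∈ s, √(a h) * √(b h) - 1 =
      (∑ h ∈ s, √(a h) * √(b h) - ∑ h ∈ s, a h) + (∑ h ∈ s, a h - 1) := by ring
    rw [h4]
    refine (abs_add_le _ _).trans ?_
    linarith
  have hκc : ∀ x, conj (κ (unit x)) = κ (unit x) := fun x => by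
    obtain ⟨r, -, -, hr⟩ := hκ2 (unit x)
    rw [hr, Complex.conj_ofReal]
  have hval : ∀ g, ((κ * η) * star (κ * η)) g =
      κ (unit (rng g)) * (η * star η) g * κ (unit (src g)) := fun g => by
    have : (κ * η) * star (κ * η) = κ * ((η * star η) * star κ) := by
      rw [star_mul]; simp only [mul_assoc]
    rw [this, hκ.mul_apply, hκ.adjoint.mul_apply_right, ConvAlg.star_unit, hκc, mul_assoc]
  refine ⟨κ * η, fun x => ?_, fun g hg => ?_⟩
  · rw [hval]
    change ‖κ (unit x) * (η * star η) (unit x) * κ (unit x)‖ ≤ 1 + δ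
    obtain ⟨r, hr0, hr1, hr⟩ := hκ2 (unit x)
    by_cases h0 : κ (unit x) = 0
    · rw [h0, mul_zero, norm_zero]
      positivity
    · have h1 := hη _ (Or.inr (subset_tsupport _ h0))
      have h2 : ‖(η * star η) (unit x)‖ ≤ 1 + δ := by
        have := norm_add_le ((η * star η) (unit x) - 1) 1
        rw [sub_add_cancel, norm_one] at this
        linarith
      rw [hr, norm_mul, norm_mul, Complex.norm_real, Real.norm_of_nonneg hr0]
      have h3 : r * ‖(η * star η) (unit x)‖ ≤ ‖(η * star η) (unit x)‖ :=
        mul_le_of_le_one_left (norm_nonneg _) hr1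
      exact (mul_le_of_le_one_right (by positivity) hr1).trans (h3.trans h2)
  · rw [hval, hκ1 _ (Or.inl ⟨g, hg, rfl⟩), hκ1 _ (Or.inr ⟨g, hg, rfl⟩), one_mul, mul_one]
    exact hη g (Or.inl hg)

/-- For amenable groupoids every representation is bounded by the regular representations over
its hull. -/
theorem IsAmenable.norm_rep_le (hX : IsAmenable X) {H : Type w} [NormedAddCommGroup H]
    [InnerProductSpace ℂ H] [CompleteSpace H] {π : ConvAlg X →⋆ₙₐ[ℂ] (H →L[ℂ] H)} {M : ℝ}
    (hM : 0 ≤ M) {f : ConvAlg X} (hf : ∀ x ∈ (hullSet π).carrier, RegBound M f x) :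
    ‖π f‖ ≤ M := by
  set a := star f * f with ha
  obtain ⟨C, hC, hCa⟩ := ConvAlg.exists_norm_rep_pmul_le.{u, v, w} a
  obtain ⟨k, hk1, -, hk2⟩ := ConvAlg.exists_bump (X := X) a.hasCompactSupport.isCompact
    isOpen_univ (subset_univ _)
  have key : ∀ (v : H) (δ : ℝ), 0 < δ → ‖π f v‖ ^ 2 ≤
      M ^ 2 * ‖v‖ ^ 2 + δ * (C * ‖v‖ ^ 2 + M ^ 2 * ‖v‖ ^ 2) := by
    intro v δ hδ
    obtain ⟨ξ, h1, h2⟩ := hX.exists_mul_star_near_one k.hasCompactSupport.isCompact hδ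
    have h3 := re_inner_pmul_le hf ξ (by positivity) h1 v
    -- The deviation of `ξξ⋆` from `1` is small only on a compact set. The cutoff `k`, equal to `1`
    -- on the support of `a`, makes it uniformly small and does not affect its product with `a`.
    let φ : C(Total X, ℂ) := k.toCont * ((ξ * star ξ).toCont - 1)
    have h4 : ∀ g, ‖φ g‖ ≤ δ := fun g => by
      change ‖k g * ((ξ * star ξ) g - 1)‖ ≤ δ
      by_cases hg : k g = 0
      · rw [hg, zero_mul, norm_zero]; exact hδ.le
      · obtain ⟨r, hr0, hr1, hr⟩ := hk2 g
        rw [norm_mul, hr, Complex.norm_real, Real.norm_of_nonneg hr0]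
        exact (mul_le_of_le_one_left (norm_nonneg _) hr1).trans (h2 g (subset_tsupport _ hg))
    have h5 : a = ConvAlg.pmul (ξ * star ξ).toCont a - ConvAlg.pmul φ a := by
      ext g
      change a g = (ξ * star ξ) g * a g - k g * ((ξ * star ξ) g - 1) * a g
      by_cases hg : a g = 0
      · rw [hg]; ring
      · rw [hk1 g (subset_tsupport _ hg)]; ring
    have h6 := norm_rep_apply_sq π f v
    rw [← ha, h5, map_sub, _root_.sub_apply, inner_sub_right, Complex.sub_re] at h6
    have h7 : |(inner ℂ v (π (ConvAlg.pmul φ a) v)).re| ≤ C * δ * ‖v‖ ^ 2 := by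
      refine (Complex.abs_re_le_norm _).trans ((norm_inner_le_norm _ _).trans ?_)
      have := ContinuousLinearMap.le_of_opNorm_le _ (hCa φ δ hδ.le h4 π) v
      nlinarith [norm_nonneg v]
    have h8 := (abs_le.1 h7).1
    rw [h6]
    nlinarith
  refine ContinuousLinearMap.opNorm_le_bound _ hM fun v => ?_
  refine le_of_sq_le_sq ?_ (by positivity)
  rw [mul_pow]
  have hlim : Filter.Tendsto (fun δ : ℝ => M ^ 2 * ‖v‖ ^ 2 + δ * (C * ‖v‖ ^ 2 + M ^ 2 * ‖v‖ ^ 2))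
      (𝓝[>] 0) (𝓝 (M ^ 2 * ‖v‖ ^ 2 + 0 * (C * ‖v‖ ^ 2 + M ^ 2 * ‖v‖ ^ 2))) :=
    (Continuous.tendsto (by fun_prop) 0).mono_left nhdsWithin_le_nhds
  rw [zero_mul, add_zero] at hlim
  exact ge_of_tendsto hlim (Filter.eventually_of_mem self_mem_nhdsWithin fun δ hδ => key v δ hδ)

end AmenableBound

/-! ## Restriction to reductions -/

/-- Tietze's extension theorem for compactly supported functions on locally compact spaces. -/
theorem exists_compactlySupported_extension {A B : Type*} [TopologicalSpace A] [TopologicalSpace B]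
    [T2Space B] [LocallyCompactSpace B] {i : A → B} (hi : Topology.IsClosedEmbedding i)
    (f : A → ℂ) (hf : Continuous f) (hfc : HasCompactSupport f) :
    ∃ F : B → ℂ, Continuous F ∧ HasCompactSupport F ∧ ∀ a, F (i a) = f a := by
  have hK : IsCompact (i '' tsupport f) := hfc.isCompact.image hi.continuous
  -- Tietze's theorem is applied on a compact neighbourhood `K'` of the image of the support, which
  -- is normal. The cutoff `k` then allows extension by zero.
  obtain ⟨K', hK', hKK'⟩ := exists_compact_superset hK
  obtain ⟨k, hk1, hkc, hks, -⟩ :=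
    exists_continuousMap_one_of_isCompact_subset_isOpen hK isOpen_interior hKK'
  have : CompactSpace K' := isCompact_iff_compactSpace.1 hK'
  let e : i ⁻¹' K' → K' := fun a => ⟨i a, a.2⟩
  have he : Topology.IsClosedEmbedding e := by
    refine Topology.IsClosedEmbedding.of_continuous_injective_isClosedMap ?_ ?_ ?_
    · exact (hi.continuous.comp continuous_subtype_val).subtype_mk _
    · intro a b h
      exact Subtype.ext (hi.injective (congrArg Subtype.val h))
    · have hc : IsClosed (i ⁻¹' K') := hK'.isClosed.preimage hi.continuous
      have h1 : IsClosedMap (i ∘ ((↑) : i ⁻¹' K' → A)) :=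
        hi.isClosedMap.comp hc.isClosedEmbedding_subtypeVal.isClosedMap
      intro S hS
      have h2 : e '' S = ((↑) : K' → B) ⁻¹' ((i ∘ ((↑) : i ⁻¹' K' → A)) '' S) := by
        ext b
        constructor
        · rintro ⟨a, ha, rfl⟩
          exact ⟨a, ha, rfl⟩
        · rintro ⟨a, ha, hab⟩
          exact ⟨a, ha, Subtype.ext hab⟩
      rw [h2]
      exact (h1 S hS).preimage continuous_subtype_val
  obtain ⟨F, hF⟩ := ContinuousMap.exists_extension' (Y := ℂ) he
    ⟨fun a : i ⁻¹' K' => f a, hf.comp continuous_subtype_val⟩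
  have hF' : ∀ a (ha : i a ∈ K'), F ⟨i a, ha⟩ = f a := fun a ha => congrFun hF ⟨a, ha⟩
  classical
  let G : B → ℂ := fun b => if h : b ∈ K' then (k b : ℂ) * F ⟨b, h⟩ else 0
  have hG0 : ∀ b, b ∉ tsupport k → G b = 0 := fun b hb => by
    simp only [G]
    split_ifs
    · rw [image_eq_zero_of_notMem_tsupport hb]; simp
    · rfl
  refine ⟨G, ?_, HasCompactSupport.intro (K := tsupport k) hkc (fun b hb => hG0 b hb),
    fun a => ?_⟩
  · rw [continuous_iff_continuousAt]
    intro b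
    by_cases hb : b ∈ tsupport k
    · have h1 : ContinuousOn G (interior K') := by
        rw [continuousOn_iff_continuous_domRestrict]
        have h2 : (interior K').domRestrict G = fun b : interior K' =>
            (k b : ℂ) * F ⟨b, interior_subset b.2⟩ := by
          funext b
          exact dif_pos (interior_subset b.2)
        rw [h2]
        exact (Complex.continuous_ofReal.comp (k.continuous.comp continuous_subtype_val)).mul
          (F.continuous.comp (continuous_subtype_val.subtype_mk _))
      exact h1.continuousAt (isOpen_interior.mem_nhds (hks hb))
    · have h1 : G =ᶠ[𝓝 b] fun _ => 0 := by
        filter_upwards [(isClosed_tsupport k).isOpen_compl.mem_nhds hb] with b' hb'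
        exact hG0 b' hb'
      exact (continuousAt_congr h1).2 continuousAt_const
  · by_cases ha : a ∈ tsupport f
    · have h1 : i a ∈ K' := interior_subset (hKK' ⟨a, ha, rfl⟩)
      simp only [G, dif_pos h1, hF', hk1 (mem_image_of_mem i ha)]
      simp
    · have h0 : f a = 0 := image_eq_zero_of_notMem_tsupport ha
      simp only [G]
      split_ifs with h
      · rw [hF', h0, mul_zero]
      · exact h0.symm

section Restriction

variable {X : Type u} [TopologicalSpace X] [Groupoid.{v} X] [TopologicalSpace (Total X)]
  [EtaleGroupoid X] (Y : ClosedInvariantSet X)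

theorem Reduction.isClosedEmbedding_incl : Topology.IsClosedEmbedding (Reduction.incl Y) :=
  ⟨Reduction.isEmbedding_incl Y, by
    rw [Reduction.range_incl_range]
    exact Y.isClosed.preimage ConvAlg.continuous_range⟩

/-- The range fibres of a reduction. -/
def Reduction.rangeFiberEquiv (x : Reduction Y) :
    RangeFiber x ≃ RangeFiber (X := X) x.1 where
  toFun h := ⟨h.1.1, h.2⟩
  invFun h := ⟨⟨h.1, Y.invariant h.2 x.2⟩, h.2⟩
  left_inv _ := rfl
  right_inv _ := rfl

/-- The restriction of functions on a groupoid to a reduction. -/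
noncomputable def restr : ConvAlg X →⋆ₙₐ[ℂ] ConvAlg (Reduction Y) where
  toFun f := ConvAlg.mk (fun g => f (Reduction.incl Y g))
    (f.continuous.comp (Reduction.isEmbedding_incl Y).continuous)
    (f.hasCompactSupport.comp_isClosedEmbedding (Reduction.isClosedEmbedding_incl Y))
  map_smul' _ _ := rfl
  map_zero' := rfl
  map_add' _ _ := rfl
  map_mul' f f' := by
    ext ⟨a, b, g⟩
    exact (finsum_comp_equiv (Reduction.rangeFiberEquiv Y a)
      (f := fun h : RangeFiber (X := X) a.1 => f ⟨a.1, h.1, h.2⟩ *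
        f' ⟨h.1, b.1, CategoryStruct.comp (obj := X) (Groupoid.inv (obj := X) h.2) g⟩)).symm
  map_star' f := rfl

theorem restr_unit (f : ConvAlg X) (x : Reduction Y) :
    restr Y f (unit x) = f (unit x.1) := rfl

theorem restr_surjective : Function.Surjective (restr Y) := fun f => by
  obtain ⟨F, h1, h2, h3⟩ := exists_compactlySupported_extension
    (Reduction.isClosedEmbedding_incl Y) f f.continuous f.hasCompactSupport
  exact ⟨ConvAlg.mk F h1 h2, ConvAlg.ext h3⟩

theorem restr_unitSupported {f : ConvAlg X} (hf : f.UnitSupported) :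
    (restr Y f).UnitSupported := fun g hg => by
  obtain ⟨x, hx⟩ := hf _ hg
  have h1 : x = g.left.1 := congrArg Total.left hx
  refine ⟨g.left, Reduction.incl_injective Y ?_⟩
  rw [← hx, h1]
  rfl

theorem exists_restr_eq_of_unitSupported {f : ConvAlg (Reduction Y)} (hf : f.UnitSupported) :
    ∃ F : ConvAlg X, F.UnitSupported ∧ restr Y F = f := by
  obtain ⟨F, rfl⟩ := restr_surjective Y f
  refine ⟨ConvAlg.diag F, ConvAlg.diag_unitSupported F, ?_⟩
  refine ConvAlg.UnitSupported.ext (restr_unitSupported Y (ConvAlg.diag_unitSupported F)) hf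
    fun x => ?_
  rw [restr_unit, restr_unit, ConvAlg.diag_unit]

/-- Restriction is a surjective ⋆-homomorphism that preserves values at units of `Y`, and both sides
only involve such values. -/
theorem regBound_restr_iff (c : ℝ) (f : ConvAlg X) (x : Reduction Y) :
    RegBound c (restr Y f) x ↔ RegBound c f x.1 := by
  have key : ∀ b : ConvAlg X,
      ((star (restr Y f * restr Y b) * (restr Y f * restr Y b)) (unit x)).re ≤
        c ^ 2 * ((star (restr Y b) * restr Y b) (unit x)).re ↔
      ((star (f * b) * (f * b)) (unit x.1)).re ≤ c ^ 2 * ((star b * b) (unit x.1)).re := fun b => by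
    rw [← restr_unit, ← restr_unit]
    simp only [map_mul, map_star]
  constructor
  · exact fun h b => (key b).1 (h _)
  · intro h b
    obtain ⟨b, rfl⟩ := restr_surjective Y b
    exact (key b).2 (h b)

end Restriction

/-! ### The norm formula for arbitrary representations -/

section Hulls

variable {X : Type u} [TopologicalSpace X] [Groupoid.{v} X] [TopologicalSpace (Total X)]
  [EtaleGroupoid X]

/-- If all reductions have the ideal intersection property and the groupoid is amenable, then the
norm of an element of the convolution algebra in a representation depends only on the hull of
the representation. -/
theorem norm_rep_le_iff (hX : IsAmenable X) (hI : ResidualIntersectionProperty X)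
    {H : Type w} [NormedAddCommGroup H] [InnerProductSpace ℂ H] [CompleteSpace H]
    (π : ConvAlg X →⋆ₙₐ[ℂ] (H →L[ℂ] H)) {c : ℝ} (hc : 0 ≤ c) (f : ConvAlg X) :
    ‖π f‖ ≤ c ↔ ∀ x ∈ (hullSet π).carrier, RegBound c f x := by
  refine ⟨fun hle => ?_, fun h => hX.norm_rep_le hc h⟩
  let Y := hullSet π
  let p := reducedSeminorm (Reduction Y)
  have hp : ∀ {c : ℝ}, 0 ≤ c → ∀ f : ConvAlg X, p.toFun (restr Y f) ≤ c ↔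
      ∀ x ∈ Y.carrier, RegBound c f x := fun hc f => by
    rw [reducedSeminorm_le_iff hc]
    exact ⟨fun h x hx => (regBound_restr_iff Y _ f ⟨x, hx⟩).1 (h _),
      fun h x => (regBound_restr_iff Y _ f x).2 (h x.1 x.2)⟩
  -- Amenability enters here: `π` is dominated by the reduced norm of the reduction to its hull, so
  -- it factors through restriction and extends to `C⋆_r(G_Y)`.
  have hπp : ∀ f, ‖π f‖ ≤ p.toFun (restr Y f) := fun f =>
    hX.norm_rep_le (p.toFun_nonneg _) ((hp (p.toFun_nonneg _) f).1 le_rfl)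
  have hfac : ∀ f f', restr Y f = restr Y f' → π f = π f' := fun f f' h => by
    rw [← sub_eq_zero, ← map_sub, ← norm_le_zero_iff]
    refine (hπp _).trans ?_
    rw [map_sub, h, sub_self]
    exact (map_zero p.toSeminorm).le
  let s := Function.surjInv (restr_surjective Y)
  have hs : ∀ f, restr Y (s f) = f := Function.surjInv_eq (restr_surjective Y)
  let π' : ConvAlg (Reduction Y) →⋆ₙₐ[ℂ] (H →L[ℂ] H) :=
    { toFun := fun f => π (s f)
      map_smul' := fun c f => by
        rw [hfac (s (c • f)) (c • s f) (by rw [map_smul, hs, hs]), map_smul]; rfl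
      map_zero' := by rw [hfac (s 0) 0 (by rw [map_zero, hs]), map_zero]
      map_add' := fun f g => by
        rw [hfac (s (f + g)) (s f + s g) (by rw [map_add, hs, hs, hs]), map_add]
      map_mul' := fun f g => by
        rw [hfac (s (f * g)) (s f * s g) (by rw [map_mul, hs, hs, hs]), map_mul]
      map_star' := fun f => by
        rw [hfac (s (star f)) (star (s f)) (by rw [map_star, hs, hs]), map_star] }
  have hπ' : ∀ f, π' (restr Y f) = π f := fun f => hfac _ _ (hs _)
  let L := CStarSeminorm.Completion.lift (p := p) π' (fun f => by
    obtain ⟨f, rfl⟩ := restr_surjective Y f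
    rw [hπ']
    exact hπp f)
  have hL : ∀ f, L (CStarSeminorm.Completion.of p f) = π' f :=
    CStarSeminorm.Completion.lift_of _ _
  have hLc : Continuous L := CStarSeminorm.Completion.continuous_lift _ _
  -- A function on `Y` has reduced norm at most its supremum, and by the choice of the hull its
  -- values on `Y` are bounded by the norm in `π`.
  have hiso : ∀ a ∈ unitSubalgebra (Reduction Y), ‖a‖ ≤ ‖L a‖ := by
    intro a ha
    refine closure_minimal (t := {a | ‖a‖ ≤ ‖L a‖}) ?_ (isClosed_le continuous_norm hLc.norm) ha
    rintro _ ⟨h, hh, rfl⟩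
    obtain ⟨F, hF, rfl⟩ := exists_restr_eq_of_unitSupported Y hh
    change ‖_‖ ≤ ‖L _‖
    rw [hL, hπ', CStarSeminorm.Completion.norm_of]
    change (⨆ x, ‖(regularRep (Reduction Y) x).rep (restr Y F)‖) ≤ _
    refine Real.iSup_le (fun x => ?_) (norm_nonneg _)
    refine ConvAlg.norm_apply_le_of_unitSupported _ _ hh _ (norm_nonneg _) fun g => ?_
    by_cases hg : g ∈ range (unit : Reduction Y → _)
    · obtain ⟨y, rfl⟩ := hg
      exact norm_apply_le_norm_rep hF y.2
    · rw [ConvAlg.UnitSupported.eq_zero hh hg, norm_zero]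
      exact norm_nonneg _
  -- The kernel meets `C₀(Y)` only in `0`, so it is zero by the intersection property of the
  -- reduction. An injective ⋆-homomorphism of C⋆-algebras is isometric, which reverses the
  -- amenability bound.
  have hinj : Function.Injective L := by
    have hbot : TwoSidedIdeal.ker L = ⊥ := by
      by_contra hne
      obtain ⟨a, ha, haI, ha0⟩ := hI Y (TwoSidedIdeal.ker L) (isClosed_ker L) hne
      have h1 := hiso a ha
      rw [(TwoSidedIdeal.mem_ker _).1 haI, norm_zero] at h1
      exact ha0 (norm_le_zero_iff.1 h1)
    intro a b hab
    have : a - b ∈ TwoSidedIdeal.ker L := by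
      rw [TwoSidedIdeal.mem_ker, map_sub, hab, sub_self]
    rw [hbot] at this
    exact sub_eq_zero.1 ((TwoSidedIdeal.mem_bot _).1 this)
  refine (hp hc f).1 ?_
  rw [← CStarSeminorm.Completion.norm_of, ← NonUnitalStarAlgHom.norm_map L hinj, hL, hπ']
  exact hle

end Hulls

/-! ## Vectors in induced representations -/

section IndVec

variable {X : Type u} [Groupoid.{v} X] {x : X} {S : Subgroup (x ⟶ x)}
  {H : Type w} [NormedAddCommGroup H] [InnerProductSpace ℂ H] [CompleteSpace H]

theorem unitary_star_apply_apply (u : unitary (H →L[ℂ] H)) (ξ : H) :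
    star (u : H →L[ℂ] H) ((u : H →L[ℂ] H) ξ) = ξ :=
  congrArg (fun T : H →L[ℂ] H => T ξ) (Unitary.coe_star_mul_self u)

theorem unitary_apply_star_apply (u : unitary (H →L[ℂ] H)) (ξ : H) :
    (u : H →L[ℂ] H) (star (u : H →L[ℂ] H) ξ) = ξ :=
  congrArg (fun T : H →L[ℂ] H => T ξ) (Unitary.coe_mul_star_self u)

open Classical in
/-- The element of the induced Hilbert space that is supported on the coset of `g` and has the
value `ξ` at `g`. -/
noncomputable def indVec (π : S →* unitary (H →L[ℂ] H)) (g : SourceFiber x) (ξ : H) :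
    IndSpace π :=
  (IndSpace.toL2 π).symm (lp.single 2 (Quotient.mk (cosetSetoid S) g)
    ((π (IndSpace.outElt g) : H →L[ℂ] H) ξ))

variable {π : S →* unitary (H →L[ℂ] H)}

open Classical in
theorem indVec_toFun (g g' : SourceFiber x) (ξ : H) : (indVec π g ξ).toFun g' =
    star (π (IndSpace.outElt g') : H →L[ℂ] H) ((lp.single (E := fun _ => H) 2
      (Quotient.mk (cosetSetoid S) g)
      ((π (IndSpace.outElt g) : H →L[ℂ] H) ξ) : CosetSpace S → H)
        (Quotient.mk (cosetSetoid S) g')) := rfl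

theorem indVec_self (g : SourceFiber x) (ξ : H) : (indVec π g ξ).toFun g = ξ := by
  classical
  rw [indVec_toFun]
  simp only [lp.coeFn_single, Pi.single_eq_same]
  exact unitary_star_apply_apply _ _

theorem indVec_of_not_rel {g g' : SourceFiber x} (h : ¬ (cosetSetoid S).r g g') (ξ : H) :
    (indVec π g ξ).toFun g' = 0 := by
  classical
  rw [indVec_toFun]
  have : Quotient.mk (cosetSetoid S) g' ≠ Quotient.mk (cosetSetoid S) g := fun h' =>
    h (Quotient.exact h'.symm)
  rw [lp.coeFn_single, Pi.single_eq_of_ne this, map_zero]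

theorem indVec_add (g : SourceFiber x) (ξ η : H) :
    indVec π g (ξ + η) = indVec π g ξ + indVec π g η := by
  simp only [indVec, map_add, lp.single_add]

theorem indVec_smul (g : SourceFiber x) (c : ℂ) (ξ : H) :
    indVec π g (c • ξ) = c • indVec π g ξ := by
  simp only [indVec, map_smul, lp.single_smul]

theorem inner_indVec_left (g : SourceFiber x) (ξ : H) (η : IndSpace π) :
    inner ℂ (indVec π g ξ) η = inner ℂ ξ (η.toFun g) := by
  rw [IndSpace.inner_def, tsum_eq_single (Quotient.mk (cosetSetoid S) g)]
  · rw [IndSpace.inner_eq_of_rel _ _ (IndSpace.out_rel g), indVec_self]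
  · intro q hq
    rw [indVec_of_not_rel (fun h => hq ?_), inner_zero_left]
    rw [← Quotient.out_eq q]
    exact (Quotient.sound (s := cosetSetoid S) h).symm

theorem norm_indVec (g : SourceFiber x) (ξ : H) : ‖indVec π g ξ‖ = ‖ξ‖ := by
  have h1 := inner_indVec_left (π := π) g ξ (indVec π g ξ)
  rw [indVec_self, inner_self_eq_norm_sq_to_K, inner_self_eq_norm_sq_to_K] at h1
  have h2 : ‖indVec π g ξ‖ ^ 2 = ‖ξ‖ ^ 2 := by exact_mod_cast h1
  exact (sq_eq_sq₀ (norm_nonneg _) (norm_nonneg _)).1 h2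

theorem continuous_indVec (g : SourceFiber x) : Continuous (indVec π g) := by
  let L : H →ₗ[ℂ] IndSpace π :=
    { toFun := indVec π g, map_add' := indVec_add g, map_smul' := fun c ξ => indVec_smul g c ξ }
  exact (L.mkContinuous 1 fun ξ => by rw [one_mul]; exact (norm_indVec g ξ).le).continuous

/-- A closed subspace that contains all vectors supported on single cosets is everything. -/
theorem eq_top_of_indVec_mem {K : Submodule ℂ (IndSpace π)} (hK : IsClosed (K : Set (IndSpace π)))
    (h : ∀ g ξ, indVec π g ξ ∈ K) : K = ⊤ := by
  have h1 : Kᗮ = ⊥ := by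
    rw [eq_bot_iff]
    intro η hη
    rw [Submodule.mem_bot]
    refine IndSpace.ext fun g => ?_
    have h2 := (Submodule.mem_orthogonal K η).1 hη _ (h g (η.toFun g))
    rw [inner_indVec_left] at h2
    exact inner_self_eq_zero.1 h2
  rw [← hK.submodule_topologicalClosure_eq]
  exact (Submodule.topologicalClosure_eq_top_iff (K := K)).2 h1

/-- An element of the induced space that is supported on one coset. -/
theorem eq_indVec {η : IndSpace π} {g : SourceFiber x}
    (h : ∀ g', ¬ (cosetSetoid S).r g g' → η.toFun g' = 0) : η = indVec π g (η.toFun g) := by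
  refine IndSpace.ext fun g' => ?_
  by_cases hg : (cosetSetoid S).r g g'
  · obtain ⟨k, hk, rfl⟩ := hg
    have h1 := η.covariant g ⟨k, hk⟩
    have h2 := (indVec π g (η.toFun g)).covariant g ⟨k, hk⟩
    rw [indVec_self] at h2
    exact h1.trans h2.symm
  · rw [h g' hg, indVec_of_not_rel hg]

end IndVec

/-! ### Representations induced from full isotropy groups -/

section IndIsotropy

variable {X : Type u} [TopologicalSpace X] [Groupoid.{v} X] [TopologicalSpace (Total X)]
  [EtaleGroupoid X] {x : X} {H : Type w} [NormedAddCommGroup H] [InnerProductSpace ℂ H]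
  [CompleteSpace H] {π : (⊤ : Subgroup (x ⟶ x)) →* unitary (H →L[ℂ] H)}

/-- Cosets of the full isotropy group are the points of the orbit, so functions on the unit space
can separate them. -/
theorem cosetSetoid_top_iff {g g' : SourceFiber x} :
    (cosetSetoid (⊤ : Subgroup (x ⟶ x))).r g g' ↔ g'.1 = g.1 := by
  constructor
  · rintro ⟨h, -, rfl⟩
    rfl
  · obtain ⟨a, g⟩ := g
    obtain ⟨b, g'⟩ := g'
    rintro h
    obtain rfl : b = a := h
    exact ⟨Groupoid.inv g ≫ g', trivial, by simp⟩

theorem indVec_of_ne {g g' : SourceFiber x} (h : g'.1 ≠ g.1) (ξ : H) :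
    (indVec π g ξ).toFun g' = 0 :=
  indVec_of_not_rel (fun h' => h (cosetSetoid_top_iff.1 h')) ξ

theorem indVec_vertex (k : x ⟶ x) (ξ : H) :
    indVec π ⟨x, k⟩ ξ = indVec π ⟨x, 𝟙 x⟩ ((π ⟨k, trivial⟩ : H →L[ℂ] H) ξ) := by
  have h1 : indVec π ⟨x, k⟩ ξ = indVec π ⟨x, 𝟙 x⟩ ((indVec π ⟨x, k⟩ ξ).toFun ⟨x, 𝟙 x⟩) := by
    refine eq_indVec fun g' hg' => indVec_of_ne (fun h => hg' ?_) ξ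
    exact cosetSetoid_top_iff.2 h
  have h2 := (indVec π ⟨x, k⟩ ξ).covariant ⟨x, 𝟙 x⟩ ⟨k, trivial⟩
  have h3 : (⟨x, 𝟙 x ≫ k⟩ : SourceFiber x) = ⟨x, k⟩ := by rw [Category.id_comp]
  have h4 := (congrArg (indVec π ⟨x, k⟩ ξ).toFun h3).symm.trans h2
  rw [indVec_self] at h4
  rw [h1]
  congr 1
  exact (unitary_apply_star_apply (π ⟨k, trivial⟩) _).symm.trans
    (congrArg (π ⟨k, trivial⟩ : H →L[ℂ] H) h4.symm)

theorem act_unitSupported {h : ConvAlg X} (hh : h.UnitSupported) {E : Type*} [AddCommGroup E]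
    [Module ℂ E] (ξ : SourceFiber x → E) (g : SourceFiber x) :
    act h ξ g = h (unit g.1) • ξ g := by
  obtain ⟨a, g⟩ := g
  refine (finsum_eq_single _ (⟨a, 𝟙 a⟩ : RangeFiber a) ?_).trans ?_
  · intro k hk
    rw [hh.eq_zero, zero_smul]
    rintro ⟨y, hy⟩
    apply hk
    obtain ⟨z, k⟩ := k
    simp only [unit, Total.mk.injEq] at hy
    obtain ⟨rfl, rfl, h3⟩ := hy
    rw [eq_of_heq h3]
  · have : (⟨a, Groupoid.inv (𝟙 a) ≫ g⟩ : SourceFiber x) = ⟨a, g⟩ := by simp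
    exact congrArg (fun k => h (unit a) • ξ k) this

theorem indRep_unitSupported {h : ConvAlg X} (hh : h.UnitSupported) (ξ : IndSpace π)
    (g : SourceFiber x) : (indRep π h ξ).toFun g = h (unit g.1) • ξ.toFun g :=
  act_unitSupported hh ξ.toFun g

theorem indRep_indVec {f : ConvAlg X} {W : Set (Total X)} (hf : f.SupportedOn W)
    (g : SourceFiber x) {z : X} (w : z ⟶ g.1) (hw : (⟨z, g.1, w⟩ : Total X) ∈ W) (ξ : H) :
    indRep π f (indVec π g ξ) = f ⟨z, g.1, w⟩ • indVec π ⟨z, w ≫ g.2⟩ ξ := by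
  rw [← indVec_smul]
  have h1 := eq_indVec (η := indRep π f (indVec π g ξ)) (g := ⟨z, w ≫ g.2⟩) (by
    intro g' hg'
    rw [indRep_apply]
    refine (finsum_congr fun k => ?_).trans finsum_zero
    by_cases hk : k.1 = g.1
    · obtain ⟨b, g'⟩ := g'
      obtain ⟨t, k⟩ := k
      have hk' : t = g.1 := hk
      subst hk'
      by_cases h0 : f ⟨b, g.1, k⟩ = 0
      · change f ⟨b, g.1, k⟩ • _ = _
        rw [h0, zero_smul]
      · have h2 := hf.isBisection.2 (hf.mem h0) hw rfl
        exact absurd (cosetSetoid_top_iff.2 (congrArg Total.left h2)) hg'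
    · rw [indVec_of_ne (by exact hk), smul_zero])
  rw [h1]
  congr 1
  have h2 := act_eq_single hf (indVec π g ξ).toFun ⟨z, w ≫ g.2⟩ ⟨g.1, w⟩ hw
  refine h2.trans ?_
  have h3 : (⟨g.1, Groupoid.inv w ≫ w ≫ g.2⟩ : SourceFiber x) = g := by simp
  rw [h3, indVec_self]

/-- A function on the unit space acts on the fibre over `y` as multiplication by its value at `y`,
and each fibre over the orbit is a copy of `H`. -/
theorem indRep_eq_zero_iff [Nontrivial H] {h : ConvAlg X} (hh : h.UnitSupported) :
    indRep π h = 0 ↔ ∀ y : X, Nonempty (y ⟶ x) → h (unit y) = 0 := by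
  constructor
  · rintro h0 y ⟨g⟩
    obtain ⟨ξ, hξ⟩ := exists_ne (0 : H)
    have h1 := indRep_unitSupported hh (indVec π ⟨y, g⟩ ξ) ⟨y, g⟩
    rw [h0, indVec_self] at h1
    exact (smul_eq_zero.1 h1.symm).resolve_right hξ
  · intro h0
    ext ξ
    refine IndSpace.ext fun g => ?_
    rw [indRep_unitSupported hh, h0 g.1 ⟨g.2⟩, zero_smul]
    rfl

/-- The kernel on the unit space consists of the functions that vanish on the orbit. A bump off the
closure of the orbit excludes all other points. -/
theorem hullSet_indRep [Nontrivial H] :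
    (hullSet (indRep π)).carrier = closure {y : X | Nonempty (y ⟶ x)} := by
  apply Subset.antisymm
  · intro y hy
    by_contra hcl
    obtain ⟨h, hh, h1, h2, -⟩ := ConvAlg.exists_unit_bump (X := X) (isCompact_singleton (x := y))
      isClosed_closure.isOpen_compl (singleton_subset_iff.2 hcl)
    have h3 := hy h hh ((indRep_eq_zero_iff hh).2 fun z hz => by
      by_contra h0
      exact h2 z h0 (subset_closure hz))
    rw [h1 y rfl] at h3
    exact one_ne_zero h3
  · refine closure_minimal (fun y hy h hh h0 => ?_) (hullSet (indRep π)).isClosed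
    exact (indRep_eq_zero_iff hh).1 h0 y hy

/-- The norm in a representation induced from an isotropy group. -/
theorem norm_indRep_le_iff [Nontrivial H] (hX : IsAmenable X)
    (hI : ResidualIntersectionProperty X) {c : ℝ} (hc : 0 ≤ c) (f : ConvAlg X) :
    ‖indRep π f‖ ≤ c ↔ RegBound c f x := by
  rw [norm_rep_le_iff hX hI _ hc, hullSet_indRep]
  constructor
  · exact fun h => h x (subset_closure ⟨𝟙 x⟩)
  · intro h y hy
    refine closure_minimal (t := {y | RegBound c f y}) ?_ (isClosed_regBound c f) hy
    rintro y ⟨g⟩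
    exact h.of_hom g

/-- Cutting a vector down to the fibre over one point of the orbit. -/
theorem indVec_mem_of_mem {K : Submodule ℂ (IndSpace π)} (hK : IsClosed (K : Set (IndSpace π)))
    (hinv : ∀ f, ∀ ξ ∈ K, indRep π f ξ ∈ K) {ξ : IndSpace π} (hξ : ξ ∈ K) (g : SourceFiber x) :
    indVec π g (ξ.toFun g) ∈ K := by
  have hT2 := ConvAlg.t2Space_units (X := X)
  refine hK.closure_subset (Metric.mem_closure_iff.2 fun ε hε => ?_)
  have hlim := tendsto_tsum_compl_atTop_zero
    (fun q : CosetSpace (⊤ : Subgroup (x ⟶ x)) => ‖ξ.toFun q.out‖ ^ 2)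
  -- Outside the finite set `s` of cosets the vector is small. A bump equal to `1` at the chosen
  -- point and `0` at the other points of `s` leaves only that fibre and part of the tail.
  obtain ⟨s, hs⟩ := ((hlim.eventually (gt_mem_nhds (show (0 : ℝ) < ε ^ 2 by positivity))).exists)
  let F : Set X := (fun q : CosetSpace (⊤ : Subgroup (x ⟶ x)) => q.out.1) '' s \ {g.1}
  have hF : F.Finite := (s.finite_toSet.image _).sdiff
  obtain ⟨h, hh, h1, h2, h3⟩ := ConvAlg.exists_unit_bump (X := X) (isCompact_singleton (x := g.1))
    hF.isClosed.isOpen_compl (singleton_subset_iff.2 fun hg => hg.2 rfl)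
  refine ⟨_, hinv h ξ hξ, ?_⟩
  set η := indVec π g (ξ.toFun g) - indRep π h ξ with hη
  have hηval : ∀ g', η.toFun g' = (indVec π g (ξ.toFun g)).toFun g' - (indRep π h ξ).toFun g' :=
    fun _ => rfl
  have h4 : ∀ g' : SourceFiber x, g'.1 = g.1 → η.toFun g' = 0 := by
    intro g' hg'
    obtain ⟨k, hk, rfl⟩ := cosetSetoid_top_iff.2 hg'
    have e1 := (indVec π g (ξ.toFun g)).covariant g ⟨k, hk⟩
    have e2 := ξ.covariant g ⟨k, hk⟩
    rw [indVec_self] at e1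
    rw [hηval, indRep_unitSupported hh, h1 _ rfl, one_smul, sub_eq_zero]
    exact e1.trans e2.symm
  have h5 : ∀ g' : SourceFiber x, ‖η.toFun g'‖ ≤ ‖ξ.toFun g'‖ := by
    intro g'
    by_cases hg' : g'.1 = g.1
    · rw [h4 g' hg', norm_zero]; positivity
    · obtain ⟨r, hr0, hr1, hr⟩ := h3 (unit g'.1)
      rw [hηval, indVec_of_ne hg', zero_sub, norm_neg, indRep_unitSupported hh, hr, norm_smul,
        Complex.norm_real, Real.norm_of_nonneg hr0]
      exact mul_le_of_le_one_left (norm_nonneg _) hr1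
  have h6 : ∀ q : CosetSpace (⊤ : Subgroup (x ⟶ x)), q ∈ s → η.toFun q.out = 0 := by
    intro q hq
    by_cases hg' : q.out.1 = g.1
    · exact h4 _ hg'
    · have : h (unit q.out.1) = 0 := by
        by_contra h0
        exact h2 _ h0 ⟨⟨q, hq, rfl⟩, hg'⟩
      rw [hηval, indVec_of_ne hg', indRep_unitSupported hh, this, zero_smul, sub_zero]
  have h7 : ‖η‖ ^ 2 < ε ^ 2 := by
    rw [IndSpace.norm_sq_def]
    refine lt_of_le_of_lt ?_ hs
    have hsupp : Function.support (fun q : CosetSpace (⊤ : Subgroup (x ⟶ x)) =>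
        ‖η.toFun q.out‖ ^ 2) ⊆ range ((↑) : {q // q ∉ s} → _) := fun q hq =>
      ⟨⟨q, fun hqs => hq (by
        change ‖η.toFun q.out‖ ^ 2 = 0
        rw [h6 q hqs, norm_zero, zero_pow two_ne_zero])⟩, rfl⟩
    rw [← Function.Injective.tsum_eq Subtype.val_injective hsupp]
    refine Summable.tsum_le_tsum (fun q => pow_le_pow_left₀ (norm_nonneg _) (h5 _) 2) ?_ ?_
    · exact η.summable.comp_injective Subtype.val_injective
    · exact ξ.summable.comp_injective Subtype.val_injective
  rw [dist_eq_norm]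
  exact lt_of_pow_lt_pow_left₀ 2 hε.le h7

end IndIsotropy

/-! ### Irreducibility of induced representations -/

section Irreducible

variable {X : Type u} [TopologicalSpace X] [Groupoid.{v} X] [TopologicalSpace (Total X)]
  [EtaleGroupoid X] {x : X}

theorem IsIrreducibleRep.nontrivial {A : Type*} [NonUnitalRing A] [StarRing A] [Module ℂ A]
    {H : Type*} [NormedAddCommGroup H] [InnerProductSpace ℂ H] [CompleteSpace H]
    {π : A →⋆ₙₐ[ℂ] (H →L[ℂ] H)} (h : IsIrreducibleRep π) : Nontrivial H := by
  obtain ⟨a, ha⟩ := h.1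
  by_contra hn
  rw [not_nontrivial_iff_subsingleton] at hn
  exact ha (by ext ξ; exact Subsingleton.elim _ _)

/-- Closed subspaces invariant under a group are invariant under its C⋆-algebra. -/
theorem UnitaryRep.toCStar_mem {Γ : Type w} [Group Γ] (π : UnitaryRep Γ) {K : Submodule ℂ π.H}
    (hK : IsClosed (K : Set π.H)) (hinv : ∀ g, ∀ ξ ∈ K, (π.rep g : π.H →L[ℂ] π.H) ξ ∈ K)
    (a : GroupCStar Γ) (ξ : π.H) (hξ : ξ ∈ K) : π.toCStar a ξ ∈ K := by
  refine CStarSeminorm.Completion.induction_on _ a (hK.preimage (f := fun a => π.toCStar a ξ)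
    ((continuous_extendRep π.toGroupAlgebra).clm_apply continuous_const)) fun a => ?_
  change extendRep π.toGroupAlgebra _ ξ ∈ K
  rw [extendRep_of]
  refine monoidAlgebra_induction a ?_ (fun g c => ?_) fun f₁ f₂ h₁ h₂ => ?_
  · rw [map_zero]; exact K.zero_mem
  · rw [UnitaryRep.toGroupAlgebra_single]
    exact K.smul_mem _ (hinv g ξ hξ)
  · rw [map_add]; exact K.add_mem h₁ h₂

section

variable {H : Type w} [NormedAddCommGroup H] [InnerProductSpace ℂ H] [CompleteSpace H]
  {π : (⊤ : Subgroup (x ⟶ x)) →* unitary (H →L[ℂ] H)}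

/-- A bump at an arrow translates a vector supported on one fibre to another fibre. -/
theorem indVec_comp_mem {K : Submodule ℂ (IndSpace π)}
    (hinv : ∀ f, ∀ ξ ∈ K, indRep π f ξ ∈ K) {g : SourceFiber x} {ξ : H} (hK : indVec π g ξ ∈ K)
    {z : X} (w : z ⟶ g.1) : indVec π ⟨z, w ≫ g.2⟩ ξ ∈ K := by
  obtain ⟨β, W, -, hβ, h1, hg⟩ :=
    ConvAlg.exists_bump_supportedOn (⟨z, g.1, w⟩ : Total X) isOpen_univ trivial
  have h2 := hinv β _ hK
  rwa [indRep_indVec hβ g w hg, h1, one_smul] at h2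

theorem exists_indRep_ne_zero [Nontrivial H] : ∃ f, indRep π f ≠ 0 := by
  obtain ⟨ξ, hξ⟩ := exists_ne (0 : H)
  obtain ⟨β, W, -, hβ, h1, hg⟩ :=
    ConvAlg.exists_bump_supportedOn (⟨x, x, 𝟙 x⟩ : Total X) isOpen_univ trivial
  refine ⟨β, fun h0 => hξ ?_⟩
  have h2 := indRep_indVec (π := π) hβ ⟨x, 𝟙 x⟩ (𝟙 x) hg ξ
  rw [h0, h1, one_smul] at h2
  rw [← norm_eq_zero, ← norm_indVec (π := π) ⟨x, 𝟙 x ≫ 𝟙 x⟩ ξ, ← h2]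
  exact norm_zero

/-- Closed invariant subspaces of a representation induced from an irreducible one are trivial. -/
theorem eq_bot_or_eq_top_of_invariant
    (hπ : ∀ K : Submodule ℂ H, IsClosed (K : Set H) →
      (∀ g, ∀ ξ ∈ K, (π g : H →L[ℂ] H) ξ ∈ K) → K = ⊥ ∨ K = ⊤)
    {K : Submodule ℂ (IndSpace π)} (hK : IsClosed (K : Set (IndSpace π)))
    (hinv : ∀ f, ∀ ξ ∈ K, indRep π f ξ ∈ K) : K = ⊥ ∨ K = ⊤ := by
  rw [or_iff_not_imp_left]
  intro hne
  obtain ⟨ξ, hξK, hξ0⟩ := (Submodule.ne_bot_iff K).1 hne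
  obtain ⟨g, hg⟩ : ∃ g, ξ.toFun g ≠ 0 := by
    by_contra! h
    exact hξ0 (IndSpace.ext h)
  -- A nonzero component of a vector in `K` is moved to the fibre over `x`. The vectors of `H` whose
  -- copy over `x` lies in `K` form a closed invariant subspace, now nonzero, hence all of `H`.
  have h1 := indVec_comp_mem hinv (indVec_mem_of_mem hK hinv hξK g) (Groupoid.inv g.2)
  rw [Groupoid.inv_comp] at h1
  let L : H →ₗ[ℂ] IndSpace π :=
    { toFun := indVec π ⟨x, 𝟙 x⟩, map_add' := indVec_add _, map_smul' := indVec_smul _ }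
  have hcl : IsClosed ((K.comap L : Submodule ℂ H) : Set H) :=
    hK.preimage (continuous_indVec (π := π) ⟨x, 𝟙 x⟩)
  rcases hπ (K.comap L) hcl (fun k v hv => by
    have h2 := indVec_comp_mem hinv (g := ⟨x, 𝟙 x⟩) hv k.1
    rw [Category.comp_id, indVec_vertex] at h2
    exact h2) with h | h
  · have : ξ.toFun g ∈ K.comap L := h1
    rw [h, Submodule.mem_bot] at this
    exact absurd this hg
  · refine eq_top_of_indVec_mem hK fun g v => ?_
    have h2 : v ∈ K.comap L := by rw [h]; trivial
    have h3 := indVec_comp_mem hinv (g := ⟨x, 𝟙 x⟩) h2 g.2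
    rwa [Category.comp_id] at h3

end

theorem isotropyInd_of (π : UnitaryRep (x ⟶ x)) (f : ConvAlg X) :
    isotropyInd π (CStarSeminorm.Completion.of _ f) = indRep (π.rep.comp (Subgroup.subtype ⊤)) f :=
  extendRep_of _ f

/-- Representations induced from irreducible representations of isotropy groups are irreducible. -/
theorem isIrreducibleRep_isotropyInd (π : UnitaryRep (x ⟶ x)) (hπ : IsIrreducibleRep π.toCStar) :
    IsIrreducibleRep (isotropyInd π) := by
  have hnt := hπ.nontrivial
  constructor
  · obtain ⟨f, hf⟩ := exists_indRep_ne_zero (π := π.rep.comp (⊤ : Subgroup (x ⟶ x)).subtype)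
    exact ⟨_, fun h => hf ((isotropyInd_of π f).symm.trans h)⟩
  · intro K hK hinv
    refine eq_bot_or_eq_top_of_invariant (fun K hK hinv => ?_) hK fun f ξ hξ => ?_
    · exact hπ.2 K hK (π.toCStar_mem hK fun k => hinv ⟨k, trivial⟩)
    · rw [← isotropyInd_of]
      exact hinv _ ξ hξ

end Irreducible

/-! ## Effective groupoids have the ideal intersection property -/

section Hereditary

variable {A : Type*} [NonUnitalCStarAlgebra A] [PartialOrder A] [StarOrderedRing A]

/-- The function is `t (1 - e(t))²` with `e(t) = t²/(t² + η²)`, the error made by the approximate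
unit `e(y)`. The bound follows from `|t| η ≤ t² + η²`. -/
theorem norm_cfcₙ_approx_le (y : A) {η : ℝ} (hη : 0 < η) :
    ‖cfcₙ (fun t : ℝ => t * (η ^ 2 / (t ^ 2 + η ^ 2)) ^ 2) y‖ ≤ η := by
  refine norm_cfcₙ_le fun t _ => ?_
  have h0 : 0 < t ^ 2 + η ^ 2 := by positivity
  rw [norm_mul, Real.norm_of_nonneg (by positivity : (0 : ℝ) ≤ (η ^ 2 / (t ^ 2 + η ^ 2)) ^ 2),
    Real.norm_eq_abs, div_pow, mul_div_assoc', div_le_iff₀ (by positivity)]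
  have h1 : |t| * η ≤ t ^ 2 + η ^ 2 := by
    rw [← sq_abs t]
    nlinarith [sq_nonneg (|t| - η), sq_nonneg |t|, sq_nonneg η]
  have h2 : η ^ 2 ≤ t ^ 2 + η ^ 2 := by nlinarith [sq_nonneg t]
  calc |t| * (η ^ 2) ^ 2 = η * ((|t| * η) * η ^ 2) := by ring
    _ ≤ η * ((t ^ 2 + η ^ 2) * (t ^ 2 + η ^ 2)) := by gcongr
    _ = _ := by ring

/-- Closed two-sided ideals are hereditary. -/
theorem TwoSidedIdeal.mem_of_star_mul_self_le {I : TwoSidedIdeal A} (hI : IsClosed (I : Set A))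
    {y z : A} (hy : y ∈ I) (hzy : star z * z ≤ y) : z ∈ I := by
  have hy0 : 0 ≤ y := (star_mul_self_nonneg z).trans hzy
  have hsa : IsSelfAdjoint y := IsSelfAdjoint.of_nonneg hy0
  refine hI.closure_subset (Metric.mem_closure_iff.2 fun ε hε => ?_)
  obtain ⟨η, hη, hηε⟩ : ∃ η : ℝ, 0 < η ∧ η < ε ^ 2 := exists_between (by positivity)
  have hden : ∀ t : ℝ, t ^ 2 + η ^ 2 ≠ 0 := fun t => by positivity
  let k : ℝ → ℝ := fun t => t / (t ^ 2 + η ^ 2)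
  have hk : Continuous k := by fun_prop (disch := exact hden _)
  -- An approximate unit made from `y`: it is a multiple of `y`, so it lies in `I`, and `z e`
  -- approximates `z`. Since the algebra need not have a unit, products with `1 - e` are written
  -- out.
  let e : A := cfcₙ (fun t : ℝ => t * k t) y
  have he : e = y * cfcₙ k y := by
    rw [show e = cfcₙ (fun t : ℝ => id t * k t) y from rfl,
      cfcₙ_mul _ _ y (by fun_prop) rfl (by fun_prop) (by simp [k]), cfcₙ_id ℝ y]
  have hesa : star e = e := (cfcₙ_predicate (R := ℝ) (p := IsSelfAdjoint) _ y).star_eq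
  have heI : e ∈ I := by
    rw [he]
    exact I.mul_mem_right _ _ hy
  refine ⟨z * e, I.mul_mem_left _ _ heI, ?_⟩
  have hexp : ∀ a : A, star (a - a * e) * (a - a * e) =
      star a * a - star a * a * e - e * (star a * a) + e * (star a * a) * e := fun a => by
    rw [star_sub, star_mul, hesa]
    noncomm_ring
  obtain ⟨w, hw⟩ := CStarAlgebra.nonneg_iff_eq_star_mul_self.1 (sub_nonneg.2 hzy)
  -- Conjugation of `z⋆z ≤ y` by `1 - e`: the difference is `(1 - e) w⋆w (1 - e)`.
  have h1 : star (z - z * e) * (z - z * e) ≤ y - y * e - e * y + e * y * e := by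
    rw [← sub_nonneg]
    have : y - y * e - e * y + e * y * e - star (z - z * e) * (z - z * e) =
        star (w - w * e) * (w - w * e) := by
      rw [hexp, hexp, ← hw]
      noncomm_ring
    rw [this]
    exact star_mul_self_nonneg _
  have h2 : y - y * e - e * y + e * y * e =
      cfcₙ (fun t : ℝ => t * (η ^ 2 / (t ^ 2 + η ^ 2)) ^ 2) y := by
    have c1 : cfcₙ (fun t : ℝ => t - t * (t * k t)) y = y - y * e := by
      rw [cfcₙ_sub _ _ y (by fun_prop) rfl (by fun_prop) (by simp [k]),
        cfcₙ_mul _ _ y (by fun_prop) rfl (by fun_prop) (by simp [k]), cfcₙ_id' ℝ y]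
    have c2 : cfcₙ (fun t : ℝ => (t * k t) * (t - t * (t * k t))) y = e * (y - y * e) := by
      rw [cfcₙ_mul _ _ y (by fun_prop) (by simp [k]) (by fun_prop) (by simp [k]), c1]
    have c3 : cfcₙ (fun t : ℝ => (t - t * (t * k t)) - (t * k t) * (t - t * (t * k t))) y =
        (y - y * e) - e * (y - y * e) := by
      rw [cfcₙ_sub _ _ y (by fun_prop) (by simp [k]) (by fun_prop) (by simp [k]), c1, c2]
    have c4 : (fun t : ℝ => t * (η ^ 2 / (t ^ 2 + η ^ 2)) ^ 2) =
        fun t : ℝ => (t - t * (t * k t)) - (t * k t) * (t - t * (t * k t)) := by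
      funext t
      have := hden t
      simp only [k]
      field_simp
      ring
    rw [c4, c3]
    noncomm_ring
  have h3 : ‖z - z * e‖ * ‖z - z * e‖ ≤ η := by
    rw [← CStarRing.norm_star_mul_self]
    refine (CStarAlgebra.norm_le_norm_of_nonneg_of_le (star_mul_self_nonneg _) h1).trans ?_
    rw [h2]
    exact norm_cfcₙ_approx_le y hη
  rw [dist_eq_norm]
  refine lt_of_pow_lt_pow_left₀ 2 hε.le ?_
  rw [sq]
  exact h3.trans_lt hηε

end Hereditary

/-! ### Avoiding arrows that are not units -/

section Effective

variable {X : Type u} [TopologicalSpace X] [Groupoid.{v} X] [TopologicalSpace (Total X)]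
  [EtaleGroupoid X]

/-- In an effective groupoid, a compact set of arrows that are not units can be avoided by
restricting to a small open set of units. -/
theorem IsEffective.exists_isOpen_subset (hX : IsEffective X) {K : Set (Total X)}
    (hK : IsCompact K) : ∀ U : Set X, IsOpen U → U.Nonempty → ∃ V ⊆ U, IsOpen V ∧ V.Nonempty ∧
      ∀ g ∈ K, g ∉ range (unit : X → Total X) → rng g ∈ V → src g ∉ V := by
  have hT2 := ConvAlg.t2Space_units (X := X)
  refine hK.induction_on (p := fun K => ∀ U : Set X, IsOpen U → U.Nonempty → ∃ V ⊆ U, IsOpen V ∧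
    V.Nonempty ∧ ∀ g ∈ K, g ∉ range (unit : X → Total X) → rng g ∈ V → src g ∉ V) ?_ ?_ ?_ ?_
  · exact fun U hU hne => ⟨U, Subset.rfl, hU, hne, fun g hg => absurd hg (notMem_empty g)⟩
  · intro s t hst ht U hU hne
    obtain ⟨V, hVU, hV, hVne, h⟩ := ht U hU hne
    exact ⟨V, hVU, hV, hVne, fun g hg => h g (hst hg)⟩
  · intro s t hs ht U hU hne
    obtain ⟨V, hVU, hV, hVne, h⟩ := hs U hU hne
    obtain ⟨V', hVV', hV', hVne', h'⟩ := ht V hV hVne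
    refine ⟨V', hVV'.trans hVU, hV', hVne', fun g hg hu h1 h2 => ?_⟩
    rcases hg with hg | hg
    · exact h g hg hu (hVV' h1) (hVV' h2)
    · exact h' g hg hu h1 h2
  · intro g _
    obtain ⟨W, hW, hWb, hgW⟩ := ConvAlg.exists_isBisection g
    refine ⟨W, mem_nhdsWithin_of_mem_nhds (hW.mem_nhds hgW), fun U hU hne => ?_⟩
    let O := (W \ range (unit : X → Total X)) ∩ rng ⁻¹' U
    have hO : IsOpen O := (hW.sdiff isClosed_range_unit).inter (hU.preimage ConvAlg.continuous_range)
    -- If all of `O` is isotropy, effectiveness forces it to be empty and `U` itself works.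
    -- Otherwise some arrow of `O` moves a point of `U`, and the ranges of nearby arrows form a set
    -- that is disjoint from its image.
    by_cases hOiso : O ⊆ {g | rng g = src g}
    · refine ⟨U, Subset.rfl, hU, hne, fun k hk hku h1 _ => ?_⟩
      have h2 : k ∈ interior {g : Total X | rng g = src g} :=
        interior_maximal hOiso hO ⟨⟨hk, hku⟩, h1⟩
      rw [hX] at h2
      exact hku h2
    · obtain ⟨k, hkO, hk⟩ := not_subset.1 hOiso
      obtain ⟨A, B, hA, hB, hkA, hkB, hAB⟩ := t2_separation hk
      refine ⟨rng '' (O ∩ rng ⁻¹' A ∩ src ⁻¹' B), ?_, ?_, ⟨_, k, ⟨⟨hkO, hkA⟩, hkB⟩, rfl⟩, ?_⟩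
      · rintro _ ⟨l, hl, rfl⟩
        exact hl.1.1.2
      · exact isOpenMap_range _ ((hO.inter (hA.preimage ConvAlg.continuous_range)).inter
          (hB.preimage ConvAlg.continuous_source))
      · rintro l hl - ⟨l', hl', h1⟩ ⟨l'', hl'', h2⟩
        have h3 : l' = l := hWb.1 hl'.1.1.1.1 hl h1
        subst h3
        have h3 : src l' ∈ A := by
          rw [← h2]
          exact hl''.1.2
        exact disjoint_left.1 hAB h3 hl'.2

end Effective

/-! ### The intersection property of effective groupoids -/

section Reduced

variable (X : Type u) [TopologicalSpace X] [Groupoid.{v} X] [TopologicalSpace (Total X)]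
  [EtaleGroupoid X]

/-- The regular representation of the reduced C⋆-algebra. -/
noncomputable def regularRepExt (x : X) :
    ReducedCStar X →⋆ₙₐ[ℂ] ((RegSpace x) →L[ℂ] (RegSpace x)) :=
  CStarSeminorm.Completion.lift
    (indRep (1 : (⊥ : Subgroup (x ⟶ x)) →* unitary (ℂ →L[ℂ] ℂ)))
    (fun a => CStarSeminorm.norm_rep_le_ofFamily (regularRep X) _ x a)

variable {X}

theorem regularRepExt_of (x : X) (f : ConvAlg X) :
    regularRepExt X x (CStarSeminorm.Completion.of _ f) =
      indRep (1 : (⊥ : Subgroup (x ⟶ x)) →* unitary (ℂ →L[ℂ] ℂ)) f :=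
  CStarSeminorm.Completion.lift_of _ _ f

theorem regularRepExt_regVec (x : X) (f b : ConvAlg X) :
    regularRepExt X x (CStarSeminorm.Completion.of _ f) (regVec b x) = regVec (f * b) x := by
  rw [regularRepExt_of]
  rfl

/-- The regular representations are jointly faithful on the completion: if all of them kill `a`, any
`f` near `a` has small reduced norm. -/
theorem exists_regularRepExt_ne_zero {a : ReducedCStar X} (ha : a ≠ 0) :
    ∃ (x : X) (β : ConvAlg X), regularRepExt X x a (regVec β x) ≠ 0 := by
  by_contra! h
  have h0 : ∀ x, regularRepExt X x a = 0 := fun x => by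
    ext ξ
    refine (dense_range_regVec x).induction (P := fun ξ : RegSpace x =>
      regularRepExt X x a ξ = 0) ?_ ?_ ξ
    · rintro _ ⟨β, rfl⟩
      exact h x β
    · exact isClosed_eq (regularRepExt X x a).continuous continuous_const
  apply ha
  rw [← norm_le_zero_iff]
  refine le_of_forall_pos_lt_add fun ε hε => ?_
  obtain ⟨f, hf⟩ := (CStarSeminorm.Completion.denseRange_of (reducedSeminorm X)).exists_dist_lt a
    (half_pos hε)
  rw [dist_eq_norm] at hf
  have h1 : ‖CStarSeminorm.Completion.of (reducedSeminorm X) f‖ ≤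
      ‖a - CStarSeminorm.Completion.of _ f‖ := by
    rw [CStarSeminorm.Completion.norm_of, reducedSeminorm_le_iff (norm_nonneg _)]
    intro x
    rw [regBound_iff (norm_nonneg _)]
    have h2 := NonUnitalStarAlgHom.norm_apply_le (regularRepExt X x)
      (a - CStarSeminorm.Completion.of _ f)
    rw [map_sub, h0 x, zero_sub, norm_neg, regularRepExt_of] at h2
    exact h2
  have h2 := norm_sub_le (a - CStarSeminorm.Completion.of (reducedSeminorm X) f)
    (-CStarSeminorm.Completion.of (reducedSeminorm X) f)
  rw [sub_neg_eq_add, sub_add_cancel, norm_neg] at h2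
  linarith

/-- The conditional expectation onto functions on the unit space, evaluated at one unit. -/
theorem exists_expectation (x : X) : ∃ E : ReducedCStar X → ℂ,
    (∀ a b, ‖E a - E b‖ ≤ ‖a - b‖) ∧
    (∀ f, E (CStarSeminorm.Completion.of _ f) = f (unit x)) ∧
    ∀ (a : ReducedCStar X) (β : ConvAlg X),
      E (star (a * CStarSeminorm.Completion.of _ β) * (a * CStarSeminorm.Completion.of _ β)) =
        (‖regularRepExt X x a (regVec β x)‖ ^ 2 : ℝ) := by
  -- The restriction of `κ` to `G_x` is the basis vector at the unit `x`, and the expectation is the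
  -- corresponding diagonal matrix coefficient.
  obtain ⟨κ, hκ, h1, -, -⟩ := ConvAlg.exists_unit_bump (X := X) (isCompact_singleton (x := x))
    isOpen_univ (subset_univ _)
  have hκ1 : κ (unit x) = 1 := h1 x rfl
  have hnorm : ‖regVec κ x‖ = 1 := by
    have h2 := norm_regVec_sq κ x
    rw [hκ.adjoint.mul_unit, ConvAlg.star_unit, hκ1] at h2
    have h3 : ‖regVec κ x‖ ^ 2 = 1 := by simpa using h2
    exact (pow_eq_one_iff_of_nonneg (norm_nonneg _) two_ne_zero).1 h3
  refine ⟨fun a => inner ℂ (regVec κ x) (regularRepExt X x a (regVec κ x)), fun a b => ?_,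
    fun f => ?_, fun a β => ?_⟩
  · rw [← inner_sub_right, ← sub_apply, ← map_sub]
    refine (norm_inner_le_norm _ _).trans ?_
    rw [hnorm, one_mul]
    refine (ContinuousLinearMap.le_opNorm _ _).trans ?_
    rw [hnorm, mul_one]
    exact NonUnitalStarAlgHom.norm_apply_le _ _
  · change inner ℂ _ (regularRepExt X x _ _) = _
    rw [regularRepExt_regVec, inner_regVec, hκ.adjoint.mul_unit, ConvAlg.star_unit,
      hκ.mul_apply_right, hκ1, map_one, one_mul]
    change _ * κ (unit x) = _
    rw [hκ1, mul_one]
  · have h2 : regularRepExt X x (CStarSeminorm.Completion.of _ β) (regVec κ x) = regVec β x := by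
      rw [regularRepExt_regVec]
      refine IndSpace.ext fun g => ?_
      rw [regVec_toFun, regVec_toFun, hκ.mul_apply_right]
      change _ * κ (unit x) = _
      rw [hκ1, mul_one]
    change inner ℂ _ (regularRepExt X x _ _) = _
    rw [map_mul, mul_apply_eq_comp, ← inner_rep_star, star_star, map_mul,
      mul_apply_eq_comp, h2, inner_self_eq_norm_sq_to_K]
    norm_cast

/-- Effective groupoids have the ideal intersection property. -/
theorem IsEffective.idealIntersectionProperty (hX : IsEffective X) :
    IdealIntersectionProperty X := by
  intro I hI hne
  let _ := CStarAlgebra.spectralOrder (ReducedCStar X)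
  have := CStarAlgebra.spectralOrderedRing (ReducedCStar X)
  obtain ⟨b, hbI, hb⟩ : ∃ b ∈ I, b ≠ 0 := by
    by_contra! h
    exact hne (eq_bot_iff.2 fun b hb => (TwoSidedIdeal.mem_bot _).2 (h b hb))
  let ι : ConvAlg X →⋆ₙₐ[ℂ] ReducedCStar X := CStarSeminorm.Completion.ofHom _
  obtain ⟨x, β, hxβ⟩ := exists_regularRepExt_ne_zero hb
  obtain ⟨E, hE1, hE2, hE3⟩ := exists_expectation x
  set a : ReducedCStar X := star (b * ι β) * (b * ι β) with ha
  have haI : a ∈ I := I.mul_mem_left _ _ (I.mul_mem_right _ _ hbI)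
  have hasa : star a = a := (IsSelfAdjoint.star_mul_self _).star_eq
  -- The factor `4` leaves room: approximation within `ε` gives `f(x) > 3ε`, the set `U` uses the
  -- threshold `2ε`, and the return from `f` to `a` costs another `ε`.
  obtain ⟨ε, hε, hEa⟩ : ∃ ε : ℝ, 0 < ε ∧ E a = (4 * ε : ℝ) := by
    refine ⟨‖regularRepExt X x b (regVec β x)‖ ^ 2 / 4, by positivity, ?_⟩
    refine (hE3 b β).trans ?_
    congr 1
    ring
  obtain ⟨f, hfsa, hf⟩ : ∃ f : ConvAlg X, star f = f ∧ ‖ι f - a‖ < ε := by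
    obtain ⟨f, hf⟩ := (CStarSeminorm.Completion.denseRange_of (reducedSeminorm X)).exists_dist_lt a hε
    -- The self-adjoint part is as close to `a` as `f` is. It is real at the units, and its
    -- difference from `a` is self-adjoint, as the operator inequality below requires.
    refine ⟨(2⁻¹ : ℂ) • (f + star f), ?_, ?_⟩
    · rw [star_smul, star_add, star_star, add_comm]
      congr 1
      simp
    · rw [dist_comm, dist_eq_norm] at hf
      change ‖ι f - a‖ < ε at hf
      have h1 : ι ((2⁻¹ : ℂ) • (f + star f)) - a =
          (2⁻¹ : ℂ) • (ι f - a) + (2⁻¹ : ℂ) • star (ι f - a) := by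
        rw [map_smul, map_add, map_star, star_sub, hasa]
        module
      rw [h1]
      refine (norm_add_le _ _).trans_lt ?_
      rw [norm_smul, norm_smul, norm_star]
      norm_num
      linarith
  have hfreal : ∀ y, ((f (unit y)).re : ℂ) = f (unit y) := fun y => by
    have h1 := ConvAlg.star_unit f y
    rw [hfsa] at h1
    exact Complex.conj_eq_iff_re.1 h1.symm
  let U : Set X := {y | 2 * ε < (f (unit y)).re}
  have hU : IsOpen U := isOpen_lt continuous_const
    (Complex.continuous_re.comp (ConvAlg.continuous_unit_apply f))
  have hxU : x ∈ U := by
    have h1 := (hE1 (ι f) a).trans_lt hf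
    have h2 := hE2 f
    change E (ι f) = _ at h2
    rw [h2, hEa] at h1
    have h3 := (Complex.abs_re_le_norm _).trans_lt h1
    rw [Complex.sub_re, Complex.ofReal_re, abs_lt] at h3
    change 2 * ε < _
    linarith [h3.1]
  obtain ⟨V, hVU, hV, ⟨y, hy⟩, hVK⟩ := hX.exists_isOpen_subset f.hasCompactSupport U hU ⟨x, hxU⟩
  obtain ⟨h, hh, hh1, hhV, hh2⟩ := ConvAlg.exists_unit_bump (X := X) (isCompact_singleton (x := y)) hV
    (singleton_subset_iff.2 hy)
  let φ : C(Total X, ℂ) := ⟨fun g => ((√((f (unit (rng g))).re - 2 * ε) : ℝ) : ℂ),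
    Complex.continuous_ofReal.comp (Real.continuous_sqrt.comp ((Complex.continuous_re.comp
      ((ConvAlg.continuous_unit_apply f).comp ConvAlg.continuous_range)).sub continuous_const))⟩
  let m : ConvAlg X := ConvAlg.pmul φ h
  have hm : m.UnitSupported := hh.pmul φ
  -- By the choice of `V`, compression by `h` removes all arrows of `f` except for units. What
  -- remains is a function `|h|² f` with `f > 2ε` where `h ≠ 0`, and `m = √(f - 2ε) h`.
  have hdecomp : star h * f * h = star m * m + ((2 * ε : ℝ) : ℂ) • (star h * h) := by
    ext g
    rw [hh.mul_apply_right, hh.adjoint.mul_apply, ConvAlg.star_unit, ConvAlg.add_apply,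
      ConvAlg.smul_apply]
    by_cases hg : g ∈ range (unit : X → Total X)
    · obtain ⟨z, rfl⟩ := hg
      change conj (h (unit z)) * f (unit z) * h (unit z) = _
      rw [hm.adjoint.mul_unit, hh.adjoint.mul_unit, ConvAlg.star_unit, ConvAlg.star_unit]
      have hmz : m (unit z) = ((√((f (unit z)).re - 2 * ε) : ℝ) : ℂ) * h (unit z) := rfl
      rw [hmz, map_mul, Complex.conj_ofReal]
      by_cases hz : h (unit z) = 0
      · rw [hz]; simp
      · have h1 : 2 * ε < (f (unit z)).re := hVU (hhV z hz)
        have h2 : ((√((f (unit z)).re - 2 * ε) : ℝ) : ℂ) * ((√((f (unit z)).re - 2 * ε) : ℝ) : ℂ) =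
            f (unit z) - (2 * ε : ℝ) := by
          rw [← Complex.ofReal_mul, Real.mul_self_sqrt (by linarith), Complex.ofReal_sub, hfreal]
        linear_combination (-(conj (h (unit z)) * h (unit z))) * h2
    · rw [(hm.adjoint.mul hm).eq_zero hg, (hh.adjoint.mul hh).eq_zero hg, mul_zero, add_zero]
      by_contra hne
      have h1 : h (unit (src g)) ≠ 0 := right_ne_zero_of_mul hne
      have h2 : conj (h (unit (rng g))) ≠ 0 := left_ne_zero_of_mul (left_ne_zero_of_mul hne)
      have h3 : f g ≠ 0 := right_ne_zero_of_mul (left_ne_zero_of_mul hne)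
      refine hVK g (subset_tsupport _ h3) hg (hhV _ ?_) (hhV _ h1)
      intro h0
      exact h2 (by rw [h0, map_zero])
  have hdecomp' : star (ι h) * ι f * ι h = star (ι m) * ι m + (2 * ε) • (star (ι h) * ι h) := by
    have := congrArg ι hdecomp
    rw [map_add, map_smul, map_mul, map_mul, map_mul, map_mul, map_star, map_star] at this
    rw [this]
    rfl
  have hle : star (ι h) * (ι f - a) * ι h ≤ ε • (star (ι h) * ι h) := by
    refine (CStarAlgebra.star_left_conjugate_le_norm_smul (a := ι h) (b := ι f - a) ?_).trans ?_
    · change star _ = _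
      rw [star_sub, hasa, ← map_star, hfsa]
    · exact smul_le_smul_of_nonneg_right hf.le (star_mul_self_nonneg _)
  let z : ReducedCStar X := (√ε) • ι h
  have hzz : star z * z = ε • (star (ι h) * ι h) := by
    simp only [z, star_smul, smul_mul_smul_comm, star_trivial]
    rw [Real.mul_self_sqrt hε.le]
  have hzI : z ∈ I := by
    refine TwoSidedIdeal.mem_of_star_mul_self_le hI (y := star (ι h) * a * ι h)
      (I.mul_mem_right _ _ (I.mul_mem_left _ _ haI)) ?_
    -- Of the `2ε`, one `ε` absorbs the error `h⋆(f - a)h`, and the other one is `z⋆z`.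
    have h1 : star (ι h) * a * ι h = star (ι m) * ι m + ε • (star (ι h) * ι h) +
        (ε • (star (ι h) * ι h) - star (ι h) * (ι f - a) * ι h) := by
      have h2 : star (ι h) * a * ι h = star (ι h) * ι f * ι h - star (ι h) * (ι f - a) * ι h := by
        noncomm_ring
      rw [h2, hdecomp']
      module
    rw [h1, hzz]
    have h3 := star_mul_self_nonneg (ι m)
    have h4 := sub_nonneg.2 hle
    calc ε • (star (ι h) * ι h) = 0 + ε • (star (ι h) * ι h) + 0 := by rw [zero_add, add_zero]
      _ ≤ _ := by gcongr
  refine ⟨z, subset_closure ⟨((√ε : ℝ) : ℂ) • h, hh.smul _, ?_⟩, hzI, ?_⟩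
  · rw [CStarSeminorm.Completion.of_smul]
    rfl
  · intro h0
    have h1 : ι h = 0 := (smul_eq_zero.1 h0).resolve_left (Real.sqrt_pos.2 hε).ne'
    obtain ⟨E', -, hE', -⟩ := exists_expectation y
    have h2 : h (unit y) = 0 := by
      rw [← hE' h, ← hE' 0 |>.trans (ConvAlg.zero_apply _)]
      exact congrArg E' (h1.trans (CStarSeminorm.Completion.of_zero _).symm)
    rw [hh1 y rfl] at h2
    exact one_ne_zero h2

/-- Strongly effective groupoids have the residual intersection property. -/
theorem StronglyEffective.residualIntersectionProperty (hX : StronglyEffective X) :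
    ResidualIntersectionProperty X := fun Y => (hX Y).idealIntersectionProperty

end Reduced

/-! ## Kernels of induced representations -/

section Kernels

variable {X : Type u} [TopologicalSpace X] [Groupoid.{v} X] [TopologicalSpace (Total X)]
  [EtaleGroupoid X]

/-- A description of the kernel of a representation of the enveloping C⋆-algebra, in terms of its
norm on a dense subalgebra. -/
theorem mem_ker_iff_of_norm_iff {A : Type w} [NonUnitalRing A] [StarRing A] [Module ℂ A]
    [IsScalarTower ℂ A A] [SMulCommClass ℂ A A] [StarModule ℂ A] [HasEnvelope A] {H : Type*}
    [NormedAddCommGroup H] [InnerProductSpace ℂ H] [CompleteSpace H]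
    (σ : Envelope A →⋆ₙₐ[ℂ] (H →L[ℂ] H)) {P : ℝ → A → Prop}
    (hP : ∀ c f, 0 ≤ c → (‖σ (CStarSeminorm.Completion.of _ f)‖ ≤ c ↔ P c f)) (a : Envelope A) :
    a ∈ TwoSidedIdeal.ker σ ↔
      ∀ f c, 0 ≤ c → ‖a - CStarSeminorm.Completion.of _ f‖ ≤ c → P c f := by
  rw [TwoSidedIdeal.mem_ker]
  constructor
  · intro ha f c hc hf
    rw [← hP c f hc]
    have h1 := NonUnitalStarAlgHom.norm_apply_le σ (a - CStarSeminorm.Completion.of _ f)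
    rw [map_sub, ha, zero_sub, norm_neg] at h1
    exact h1.trans hf
  · intro h
    rw [← norm_le_zero_iff]
    refine le_of_forall_pos_lt_add fun ε hε => ?_
    obtain ⟨f, hf⟩ := (CStarSeminorm.Completion.denseRange_of (fullSeminorm A)).exists_dist_lt a
      (half_pos hε)
    rw [dist_eq_norm] at hf
    have h1 := (hP _ f (norm_nonneg _)).2 (h f _ (norm_nonneg _) le_rfl)
    have h2 := NonUnitalStarAlgHom.norm_apply_le σ (a - CStarSeminorm.Completion.of _ f)
    have h3 : σ a = σ (a - CStarSeminorm.Completion.of _ f) +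
        σ (CStarSeminorm.Completion.of _ f) := by rw [← map_add, sub_add_cancel]
    rw [h3]
    refine (norm_add_le _ _).trans_lt ?_
    linarith

/-- The condition that `a` lies in the kernel of the regular representation at `x`. -/
def RegNull (a : GroupoidCStar X) (x : X) : Prop :=
  ∀ (f : ConvAlg X) (c : ℝ), 0 ≤ c → ‖a - CStarSeminorm.Completion.of _ f‖ ≤ c → RegBound c f x

theorem isClosed_regNull (a : GroupoidCStar X) : IsClosed {x | RegNull a x} := by
  simp only [RegNull, ofPred_forall]
  exact isClosed_iInter fun f => isClosed_iInter fun c => isClosed_iInter fun _ =>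
    isClosed_iInter fun _ => isClosed_regBound c f

theorem RegNull.of_hom {a : GroupoidCStar X} {x y : X} (h : RegNull a x) (g : y ⟶ x) :
    RegNull a y := fun f c hc hf => (h f c hc hf).of_hom g

/-- The right side does not mention `π`. This is the independence of `J`. -/
theorem mem_ker_isotropyInd_iff (hX : IsAmenable X) (hI : ResidualIntersectionProperty X) {x : X}
    (π : UnitaryRep (x ⟶ x)) [Nontrivial π.H] (a : GroupoidCStar X) :
    a ∈ TwoSidedIdeal.ker (isotropyInd π) ↔ RegNull a x :=
  mem_ker_iff_of_norm_iff (isotropyInd π) (P := fun c f => RegBound c f x) (fun c f hc => by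
    rw [isotropyInd_of]
    exact norm_indRep_le_iff hX hI hc f) a

/-- The ideals `Ind(x, J)`, assuming amenability and the residual intersection property. -/
theorem mem_Ind_iff (hX : IsAmenable X) (hI : ResidualIntersectionProperty X) (p : StabPrim X)
    (a : GroupoidCStar X) : a ∈ EtaleCStar.Ind p ↔ RegNull a p.1 := by
  have := (exists_unitaryRep p.2).choose_spec.1.nontrivial
  rw [EtaleCStar.Ind]
  exact mem_ker_isotropyInd_iff hX hI _ a

theorem Ind_eq_of_residualIntersectionProperty (hX : IsAmenable X)
    (hI : ResidualIntersectionProperty X) (x : X) (J J' : Prim (GroupCStar (x ⟶ x))) :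
    EtaleCStar.Ind ⟨x, J⟩ = EtaleCStar.Ind ⟨x, J'⟩ := by
  ext a
  rw [mem_Ind_iff hX hI, mem_Ind_iff hX hI]

/-- The kernel of an arbitrary representation, assuming amenability and the residual intersection
property. -/
theorem mem_ker_iff (hX : IsAmenable X) (hI : ResidualIntersectionProperty X)
    {H : Type (max u v)} [NormedAddCommGroup H] [InnerProductSpace ℂ H] [CompleteSpace H]
    (σ : GroupoidCStar X →⋆ₙₐ[ℂ] (H →L[ℂ] H)) (a : GroupoidCStar X) :
    a ∈ TwoSidedIdeal.ker σ ↔ ∀ x ∈ (hullSet (σ.comp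
      (CStarSeminorm.Completion.ofHom (fullSeminorm (ConvAlg X))))).carrier, RegNull a x := by
  rw [mem_ker_iff_of_norm_iff σ fun c f hc => norm_rep_le_iff hX hI (σ.comp
      (CStarSeminorm.Completion.ofHom (fullSeminorm (ConvAlg X)))) hc f]
  exact ⟨fun h x hx f c hc hf => h f c hc hf x hx, fun h f c hc hf x hx => h x hx f c hc hf⟩

end Kernels

/-! ## Irreducible representations of group C⋆-algebras -/

section States

variable {A : Type w} [NonUnitalCStarAlgebra A]

/-- The states of a C⋆-algebra with unit `e`. -/
def stateSet (e : A) : Set (A → ℂ) :=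
  {f | (∀ a b, f (a + b) = f a + f b) ∧ (∀ (c : ℂ) a, f (c • a) = c * f a) ∧
    (∀ a, ‖f a‖ ≤ ‖a‖) ∧ (∀ a, 0 ≤ (f (star a * a)).re ∧ (f (star a * a)).im = 0) ∧ f e = 1}

/-- Banach-Alaoglu in its elementary form: a closed subset of a product of discs, for the topology
of pointwise convergence. -/
theorem isCompact_stateSet (e : A) : IsCompact (stateSet e) := by
  have h1 : IsCompact (Set.pi univ fun a : A => Metric.closedBall (0 : ℂ) ‖a‖) :=
    isCompact_univ_pi fun a => isCompact_closedBall _ _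
  refine h1.of_isClosed_subset ?_ fun f hf a _ => by
    rw [mem_closedBall_zero_iff]; exact hf.2.2.1 a
  have hev : ∀ a : A, Continuous fun f : A → ℂ => f a := fun a => continuous_apply a
  simp only [stateSet, ofPred_and, ofPred_forall]
  refine (isClosed_iInter fun a => isClosed_iInter fun b => isClosed_eq (hev _)
    ((hev _).add (hev _))).inter ((isClosed_iInter fun c => isClosed_iInter fun a =>
    isClosed_eq (hev _) (continuous_const.mul (hev _))).inter ((isClosed_iInter fun a =>
    isClosed_le (hev _).norm continuous_const).inter ((isClosed_iInter fun a => ?_).inter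
    (isClosed_eq (hev _) continuous_const))))
  exact (isClosed_le continuous_const (Complex.continuous_re.comp (hev _))).inter
    (isClosed_eq (Complex.continuous_im.comp (hev _)) continuous_const)

theorem convex_stateSet (e : A) : Convex ℝ (stateSet e) := by
  rintro f ⟨f1, f2, f3, f4, f5⟩ g ⟨g1, g2, g3, g4, g5⟩ s t hs ht hst
  have hval : ∀ a, (s • f + t • g) a = (s : ℂ) * f a + (t : ℂ) * g a := fun a => by simp
  refine ⟨fun a b => ?_, fun c a => ?_, fun a => ?_, fun a => ⟨?_, ?_⟩, ?_⟩
  · rw [hval, hval, hval, f1, g1]; ring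
  · rw [hval, hval, f2, g2]; ring
  · rw [hval]
    refine (norm_add_le _ _).trans ?_
    rw [norm_mul, norm_mul, Complex.norm_real, Complex.norm_real, Real.norm_of_nonneg hs,
      Real.norm_of_nonneg ht]
    calc s * ‖f a‖ + t * ‖g a‖ ≤ s * ‖a‖ + t * ‖a‖ := by
          gcongr
          · exact f3 a
          · exact g3 a
      _ = ‖a‖ := by rw [← add_mul, hst, one_mul]
  · rw [hval, Complex.add_re, Complex.re_ofReal_mul, Complex.re_ofReal_mul]
    have := (f4 a).1
    have := (g4 a).1
    positivity
  · rw [hval, Complex.add_im, Complex.im_ofReal_mul, Complex.im_ofReal_mul, (f4 a).2, (g4 a).2]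
    ring
  · rw [hval, f5, g5, mul_one, mul_one, ← Complex.ofReal_add, hst, Complex.ofReal_one]

section Vector

variable {H : Type*} [NormedAddCommGroup H] [InnerProductSpace ℂ H] [CompleteSpace H]
  (π : A →⋆ₙₐ[ℂ] (H →L[ℂ] H))

theorem inner_rep_star_mul_self (a : A) (ξ : H) :
    inner ℂ ξ (π (star a * a) ξ) = (‖π a ξ‖ ^ 2 : ℝ) := by
  rw [map_mul, mul_apply_eq_comp, ← inner_rep_star, star_star, inner_self_eq_norm_sq_to_K]
  norm_cast

/-- Normalized vector functionals are states. -/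
theorem vector_mem_stateSet {e : A} {ξ : H} (hξ : ξ ≠ 0) (he : π e ξ = ξ) :
    (fun a => ((‖ξ‖ ^ 2)⁻¹ : ℝ) * inner ℂ ξ (π a ξ)) ∈ stateSet e := by
  have hpos : 0 < ‖ξ‖ ^ 2 := by have := norm_pos_iff.2 hξ; positivity
  refine ⟨fun a b => ?_, fun c a => ?_, fun a => ?_, fun a => ?_, ?_⟩
  · change _ * inner ℂ ξ (π (a + b) ξ) = _ * inner ℂ ξ (π a ξ) + _ * inner ℂ ξ (π b ξ)
    rw [map_add, add_apply, inner_add_right, mul_add]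
  · change _ * inner ℂ ξ (π (c • a) ξ) = _ * (_ * inner ℂ ξ (π a ξ))
    rw [map_smul, smul_apply, inner_smul_right]
    ring
  · rw [norm_mul, Complex.norm_real, Real.norm_of_nonneg (inv_nonneg.2 hpos.le),
      inv_mul_le_iff₀ hpos]
    calc ‖inner ℂ ξ (π a ξ)‖ ≤ ‖ξ‖ * ‖π a ξ‖ := norm_inner_le_norm _ _
      _ ≤ ‖ξ‖ * (‖a‖ * ‖ξ‖) := by
        gcongr
        exact ContinuousLinearMap.le_of_opNorm_le _ (NonUnitalStarAlgHom.norm_apply_le π a) _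
      _ = _ := by ring
  · change 0 ≤ (_ * inner ℂ ξ (π (star a * a) ξ)).re ∧ (_ * inner ℂ ξ (π (star a * a) ξ)).im = 0
    rw [inner_rep_star_mul_self, ← Complex.ofReal_mul, Complex.ofReal_re, Complex.ofReal_im]
    exact ⟨by positivity, rfl⟩
  · change _ * inner ℂ ξ (π e ξ) = 1
    rw [he, inner_self_eq_norm_sq_to_K, Complex.ofReal_inv]
    have : ((‖ξ‖ ^ 2 : ℝ) : ℂ) ≠ 0 := by exact_mod_cast hpos.ne'
    convert inv_mul_cancel₀ this
    norm_cast

/-- The cyclic representation of an extreme state is irreducible. -/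
theorem eq_bot_or_eq_top_of_extreme {e : A} {v : H} (hcyc : Dense (range fun a => π a v))
    (he : ∀ ξ, π e ξ = ξ) (hv : (fun a => inner ℂ v (π a v)) ∈ (stateSet e).extremePoints ℝ)
    {K : Submodule ℂ H} (hK : IsClosed (K : Set H)) (hinv : ∀ a, ∀ ξ ∈ K, π a ξ ∈ K) :
    K = ⊥ ∨ K = ⊤ := by
  have hcompl : CompleteSpace K := hK.completeSpace_coe
  have hinv' : ∀ a, ∀ ξ ∈ Kᗮ, π a ξ ∈ Kᗮ := fun a ξ hξ => by
    rw [Submodule.mem_orthogonal] at hξ ⊢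
    intro η hη
    rw [← inner_rep_star]
    exact hξ _ (hinv _ _ hη)
  have htop : ∀ L : Submodule ℂ H, IsClosed (L : Set H) → (∀ a, ∀ ξ ∈ L, π a ξ ∈ L) → v ∈ L →
      L = ⊤ := fun L hL hLinv hvL => by
    rw [eq_top_iff]
    intro ξ _
    have : closure (range fun a => π a v) ⊆ L := closure_minimal (by
      rintro _ ⟨a, rfl⟩
      exact hLinv a v hvL) hL
    exact this (hcyc ξ)
  -- If both components of the cyclic vector are nonzero, its state is a convex combination, with
  -- weights `‖p‖²` and `‖q‖²`, of their normalized states.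
  obtain ⟨p, hp, q, hq, hpq⟩ : ∃ p ∈ K, ∃ q ∈ Kᗮ, v = p + q :=
    Submodule.exists_add_mem_mem_orthogonal (K := K) v
  by_cases hp0 : p = 0
  · left
    have h1 : Kᗮ = ⊤ := htop _ (Submodule.isClosed_orthogonal K) hinv' (by
      rw [hpq, hp0, zero_add]; exact hq)
    rwa [Submodule.orthogonal_eq_top_iff] at h1
  by_cases hq0 : q = 0
  · right
    exact htop K hK hinv (by rw [hpq, hq0, add_zero]; exact hp)
  exfalso
  have hcross : ∀ a, inner ℂ q (π a p) = 0 := fun a =>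
    Submodule.inner_left_of_mem_orthogonal (hinv a p hp) hq
  have hcross' : ∀ a, inner ℂ p (π a q) = 0 := fun a =>
    Submodule.inner_right_of_mem_orthogonal hp (hinv' a q hq)
  have hsum : ∀ a, inner ℂ v (π a v) = inner ℂ p (π a p) + inner ℂ q (π a q) := fun a => by
    rw [hpq, map_add, inner_add_left, inner_add_right, inner_add_right, hcross, hcross']
    ring
  have hp1 : 0 < ‖p‖ ^ 2 := by have := norm_pos_iff.2 hp0; positivity
  have hq1 : 0 < ‖q‖ ^ 2 := by have := norm_pos_iff.2 hq0; positivity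
  have hpq1 : ‖p‖ ^ 2 + ‖q‖ ^ 2 = 1 := by
    have h1 := hv.1.2.2.2.2
    have h2 := hsum e
    simp only [he] at h2
    change inner ℂ v (π e v) = 1 at h1
    rw [he, h2, inner_self_eq_norm_sq_to_K, inner_self_eq_norm_sq_to_K] at h1
    exact Complex.ofReal_injective (by rw [Complex.ofReal_one, ← h1]; push_cast; rfl)
  have hext := (mem_extremePoints_iff_left.1 hv).2 _ (vector_mem_stateSet π hp0 (he p)) _
    (vector_mem_stateSet π hq0 (he q)) ⟨‖p‖ ^ 2, ‖q‖ ^ 2, hp1, hq1, hpq1, by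
      funext a
      change (‖p‖ ^ 2) • (((‖p‖ ^ 2)⁻¹ : ℝ) * inner ℂ p (π a p)) +
        (‖q‖ ^ 2) • (((‖q‖ ^ 2)⁻¹ : ℝ) * inner ℂ q (π a q)) = inner ℂ v (π a v)
      rw [hsum, Complex.real_smul, Complex.real_smul, ← mul_assoc, ← mul_assoc,
        ← Complex.ofReal_mul, ← Complex.ofReal_mul, mul_inv_cancel₀ hp1.ne',
        mul_inv_cancel₀ hq1.ne', Complex.ofReal_one, one_mul, one_mul]⟩
  -- By extremality the normalized state of `p` is that of `v`. By cyclicity `p = ‖p‖² v`, so that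
  -- `v ∈ K` and `q = 0`.
  have h1 : ∀ a, inner ℂ (p - ((‖p‖ ^ 2 : ℝ) : ℂ) • v) (π a v) = 0 := fun a => by
    have h2 : ((‖p‖ ^ 2)⁻¹ : ℝ) * inner ℂ p (π a p) = inner ℂ v (π a v) := congrFun hext a
    have h3 : inner ℂ p (π a v) = inner ℂ p (π a p) := by
      rw [hpq, map_add, inner_add_right, hcross', add_zero]
    rw [inner_sub_left, inner_smul_left, h3, ← h2, Complex.conj_ofReal, ← mul_assoc,
      ← Complex.ofReal_mul, mul_inv_cancel₀ hp1.ne', Complex.ofReal_one, one_mul, sub_self]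
  have h2 : p - ((‖p‖ ^ 2 : ℝ) : ℂ) • v = 0 := by
    refine hcyc.eq_zero_of_inner_left ℂ ?_
    rintro _ ⟨a, rfl⟩
    exact h1 a
  have h3 : v ∈ K := by
    have h4 : v = ((‖p‖ ^ 2 : ℝ) : ℂ)⁻¹ • p := by
      rw [eq_inv_smul_iff₀ (by exact_mod_cast hp1.ne')]
      exact (sub_eq_zero.1 h2).symm
    rw [h4]
    exact K.smul_mem _ hp
  have h4 : q = 0 := by
    have h5 : q ∈ K := by
      have := K.sub_mem h3 hp
      rwa [hpq, add_sub_cancel_left] at this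
    exact inner_self_eq_zero.1 (Submodule.inner_left_of_mem_orthogonal h5 hq)
  exact hq0 h4

end Vector

open scoped ComplexOrder in
/-- The representation of Gelfand, Naimark and Segal. -/
theorem exists_cyclic_rep {e : A} (he : ∀ a, e * a = a) (he' : ∀ a, a * e = a) {f : A → ℂ}
    (hf : f ∈ stateSet e) : ∃ (π : HilbertRep A) (v : π.H), (Dense (range fun a => π.rep a v)) ∧
      (∀ ξ, π.rep e ξ = ξ) ∧ ∀ a, f a = inner ℂ v (π.rep a v) := by
  let _ := CStarAlgebra.spectralOrder A
  have := CStarAlgebra.spectralOrderedRing A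
  have hse : star e = e := by
    have h1 : e * star e = star e := he _
    have h2 := congrArg star h1
    rw [star_mul, star_star] at h2
    rw [← h1, h2]
  let F : A →ₚ[ℂ] ℂ := PositiveLinearMap.mk₀
    { toFun := f, map_add' := hf.1, map_smul' := hf.2.1 } fun a ha => by
      obtain ⟨b, rfl⟩ := CStarAlgebra.nonneg_iff_eq_star_mul_self.1 ha
      exact Complex.nonneg_iff.2 ⟨(hf.2.2.2.1 b).1, (hf.2.2.2.1 b).2.symm⟩
  let v : F.GNS := ((F.toPreGNS e : F.PreGNS) : UniformSpace.Completion F.PreGNS)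
  have hval : ∀ a, F.gnsNonUnitalStarAlgHom a v =
      ((F.toPreGNS a : F.PreGNS) : UniformSpace.Completion F.PreGNS) := fun a => by
    simp only [v, PositiveLinearMap.gnsNonUnitalStarAlgHom_apply_coe,
      PositiveLinearMap.leftMulMapPreGNS_apply, PositiveLinearMap.ofPreGNS_toPreGNS, he']
  have hdense : Dense (range fun a => F.gnsNonUnitalStarAlgHom a v) := by
    have h1 : (range fun a => F.gnsNonUnitalStarAlgHom a v) =
        range ((↑) : F.PreGNS → UniformSpace.Completion F.PreGNS) := by
      ext ξ
      constructor
      · rintro ⟨a, rfl⟩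
        exact ⟨_, (hval a).symm⟩
      · rintro ⟨a, rfl⟩
        exact ⟨F.ofPreGNS a, hval _⟩
    rw [h1]
    exact UniformSpace.Completion.denseRange_coe
  refine ⟨⟨F.GNS, F.gnsNonUnitalStarAlgHom⟩, v, hdense, fun ξ => ?_, fun a => ?_⟩
  · refine hdense.induction (P := fun ξ => F.gnsNonUnitalStarAlgHom e ξ = ξ) ?_
      (isClosed_eq (F.gnsNonUnitalStarAlgHom e).continuous continuous_id) ξ
    rintro _ ⟨a, rfl⟩
    rw [← mul_apply_eq_comp, ← map_mul, he]
  · change _ = inner ℂ v (F.gnsNonUnitalStarAlgHom a v)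
    rw [hval, UniformSpace.Completion.inner_coe, PositiveLinearMap.preGNS_inner_def]
    simp only [PositiveLinearMap.ofPreGNS_toPreGNS, hse, he]
    rfl

/-- Elements detected by a state are detected by an irreducible representation. -/
theorem exists_prim_notMem {e : A} (he : ∀ a, e * a = a) (he' : ∀ a, a * e = a) {f : A → ℂ}
    (hf : f ∈ stateSet e) {b : A} (hb : f b ≠ 0) : ∃ J : Prim A, b ∉ J.1 := by
  -- Krein-Milman: vanishing at `b` is a closed convex condition, so it would pass from the extreme
  -- states to all states.
  obtain ⟨g, hg, hgb⟩ : ∃ g ∈ (stateSet e).extremePoints ℝ, g b ≠ 0 := by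
    by_contra! h
    have h1 := closure_convexHull_extremePoints (isCompact_stateSet e) (convex_stateSet e)
    have h2 : closure (convexHull ℝ ((stateSet e).extremePoints ℝ)) ⊆ {g : A → ℂ | g b = 0} := by
      refine closure_minimal (convexHull_min h ?_) (isClosed_eq (continuous_apply b) continuous_const)
      intro g₁ h₁ g₂ h₂ s t _ _ _
      have h₁' : g₁ b = 0 := h₁
      have h₂' : g₂ b = 0 := h₂
      simp [h₁', h₂']
    rw [h1] at h2
    exact hb (h2 hf)
  obtain ⟨π, v, hcyc, hπe, hgv⟩ := exists_cyclic_rep he he' hg.1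
  have hgeq : g = fun a => inner ℂ v (π.rep a v) := funext hgv
  have hπb : π.rep b ≠ 0 := fun h0 => hgb (by
    rw [hgv, h0]
    exact inner_zero_right _)
  refine ⟨⟨TwoSidedIdeal.ker π.rep, π, ⟨⟨b, hπb⟩, fun K hK hinv => ?_⟩, rfl⟩, fun h =>
    hπb ((TwoSidedIdeal.mem_ker _).1 h)⟩
  exact eq_bot_or_eq_top_of_extreme π.rep hcyc hπe (hgeq ▸ hg) hK hinv

end States

/-! ### Irreducible representations separate the elements of a discrete group -/

section Group

variable {Γ : Type w} [Group Γ]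

theorem GroupCStar.one_mul' (a : GroupCStar Γ) : CStarSeminorm.Completion.of _ 1 * a = a := by
  refine CStarSeminorm.Completion.induction_on _ a
    (isClosed_eq (continuous_const.mul continuous_id) continuous_id) fun a => ?_
  rw [← CStarSeminorm.Completion.of_mul, one_mul]

theorem GroupCStar.mul_one' (a : GroupCStar Γ) : a * CStarSeminorm.Completion.of _ 1 = a := by
  refine CStarSeminorm.Completion.induction_on _ a
    (isClosed_eq (continuous_id.mul continuous_const) continuous_id) fun a => ?_
  rw [← CStarSeminorm.Completion.of_mul, mul_one]

theorem memℓp_two_iff {ι : Type*} (f : ι → ℂ) : Memℓp f 2 ↔ Summable fun i => ‖f i‖ ^ 2 := by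
  rw [memℓp_gen_iff (by norm_num)]
  simp

theorem memℓp_two_leftTranslation (g : Γ) (ξ : lp (fun _ : Γ => ℂ) 2) :
    Memℓp (fun h => ξ (g⁻¹ * h)) 2 := by
  rw [memℓp_two_iff]
  have h1 := (memℓp_two_iff _).1 ξ.2
  exact (Equiv.mulLeft g⁻¹).summable_iff (f := fun i => ‖ξ i‖ ^ 2) |>.2 h1

/-- Left translation on `ℓ²(Γ)`. -/
noncomputable def leftTranslation (g : Γ) :
    lp (fun _ : Γ => ℂ) 2 →ₗ[ℂ] lp (fun _ : Γ => ℂ) 2 where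
  toFun ξ := ⟨fun h => ξ (g⁻¹ * h), memℓp_two_leftTranslation g ξ⟩
  map_add' _ _ := rfl
  map_smul' _ _ := rfl

theorem leftTranslation_apply (g h : Γ) (ξ : lp (fun _ : Γ => ℂ) 2) :
    leftTranslation g ξ h = ξ (g⁻¹ * h) := rfl

theorem norm_leftTranslation (g : Γ) (ξ : lp (fun _ : Γ => ℂ) 2) :
    ‖leftTranslation g ξ‖ = ‖ξ‖ := by
  have h1 : ∀ ξ : lp (fun _ : Γ => ℂ) 2, ‖ξ‖ ^ 2 = ∑' h, ‖ξ h‖ ^ 2 := fun ξ => by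
    have h := lp.norm_rpow_eq_tsum (p := 2) (by norm_num) ξ
    simpa using h
  rw [← sq_eq_sq₀ (norm_nonneg _) (norm_nonneg _), h1, h1]
  exact (Equiv.mulLeft g⁻¹).tsum_eq fun h => ‖ξ h‖ ^ 2

variable (Γ) in
/-- The left regular representation. -/
noncomputable def leftRegularRep : UnitaryRep Γ where
  H := lp (fun _ : Γ => ℂ) 2
  rep := (Unitary.linearIsometryEquiv (𝕜 := ℂ) (H := lp (fun _ : Γ => ℂ) 2)).symm.toMonoidHom.comp
    { toFun := fun g =>
        { toLinearEquiv := LinearEquiv.ofLinearMap (leftTranslation g) (leftTranslation g⁻¹)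
            (by ext ξ h; simp [leftTranslation_apply]) (by ext ξ h; simp [leftTranslation_apply])
          norm_map' := norm_leftTranslation g }
      map_one' := by ext ξ h; simp [leftTranslation_apply]
      map_mul' := fun g g' => by
        ext ξ h
        change ξ ((g * g')⁻¹ * h) = ξ (g'⁻¹ * (g⁻¹ * h))
        rw [mul_inv_rev, mul_assoc] }

/-- The irreducible representations separate the elements of a discrete group. -/
theorem exists_prim_single_sub_notMem {g : Γ} (hg : g ≠ 1) : ∃ J : Prim (GroupCStar Γ),
    CStarSeminorm.Completion.of _ (MonoidAlgebra.single g 1 - 1 : MonoidAlgebra ℂ Γ) ∉ J.1 := by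
  classical
  let δ : (leftRegularRep Γ).H := (lp.single 2 (1 : Γ) (1 : ℂ) : lp (fun _ : Γ => ℂ) 2)
  have hδ : δ ≠ 0 := by
    have h1 : ‖δ‖ = ‖(1 : ℂ)‖ := lp.norm_single (by norm_num) _ _
    rw [norm_one] at h1
    exact norm_ne_zero_iff.1 (by rw [h1]; exact one_ne_zero)
  let d : GroupCStar Γ := CStarSeminorm.Completion.of _ (MonoidAlgebra.single g 1 - 1)
  have hone : (1 : MonoidAlgebra ℂ Γ) = MonoidAlgebra.single 1 1 := rfl
  have he : (leftRegularRep Γ).toCStar (CStarSeminorm.Completion.of _ 1) δ = δ := by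
    rw [UnitaryRep.toCStar, extendRep_of, hone, UnitaryRep.toGroupAlgebra_single, map_one, one_smul]
    rfl
  have hd : (leftRegularRep Γ).toCStar d δ ≠ 0 := by
    rw [UnitaryRep.toCStar, extendRep_of, map_sub, hone, UnitaryRep.toGroupAlgebra_single,
      UnitaryRep.toGroupAlgebra_single, one_smul, one_smul]
    intro h0
    have h1 : (leftTranslation g (lp.single 2 (1 : Γ) (1 : ℂ)) : Γ → ℂ) 1 -
        (leftTranslation (1 : Γ) (lp.single 2 (1 : Γ) (1 : ℂ)) : Γ → ℂ) 1 = 0 :=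
      congrArg (fun ξ : lp (fun _ : Γ => ℂ) 2 => ξ (1 : Γ)) h0
    rw [leftTranslation_apply, leftTranslation_apply, mul_one, inv_one, mul_one,
      lp.single_apply_self, lp.single_apply_ne _ _ _ (inv_ne_one.2 hg)] at h1
    norm_num at h1
  have hst := vector_mem_stateSet (leftRegularRep Γ).toCStar hδ he
  -- The positive element `d⋆d` is used because the vector state at `δ` takes on it a multiple of
  -- `‖dδ‖²`, which is nonzero as translation by `g ≠ 1` moves the basis vector.
  obtain ⟨J, hJ⟩ := exists_prim_notMem GroupCStar.one_mul' GroupCStar.mul_one' hst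
    (b := star d * d) (by
      rw [inner_rep_star_mul_self, ← Complex.ofReal_mul]
      have h1 := norm_pos_iff.2 hδ
      have h2 := norm_pos_iff.2 hd
      exact_mod_cast (by positivity : (0 : ℝ) <
        (‖δ‖ ^ 2)⁻¹ * ‖(leftRegularRep Γ).toCStar d δ‖ ^ 2).ne')
  exact ⟨J, fun h => hJ (J.1.mul_mem_left _ _ h)⟩

variable (Γ) in
/-- The trivial representation. -/
noncomputable def trivialRep : UnitaryRep Γ where
  H := EuclideanSpace ℂ PUnit.{w + 1}
  rep := 1

theorem isIrreducibleRep_trivialRep : IsIrreducibleRep (trivialRep Γ).toCStar := by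
  have hnt : Nontrivial (trivialRep Γ).H := inferInstanceAs (Nontrivial (EuclideanSpace ℂ PUnit))
  constructor
  · refine ⟨CStarSeminorm.Completion.of _ 1, fun h => ?_⟩
    rw [UnitaryRep.toCStar, extendRep_of, show (1 : MonoidAlgebra ℂ Γ) = MonoidAlgebra.single 1 1
      from rfl, UnitaryRep.toGroupAlgebra_single, map_one, one_smul] at h
    exact one_ne_zero h
  · intro K _ _
    have : IsSimpleModule ℂ (trivialRep Γ).H := isSimpleModule_iff_finrank_eq_one.2
      (by change Module.finrank ℂ (EuclideanSpace ℂ PUnit) = 1; simp)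
    exact eq_bot_or_eq_top K

variable (Γ) in
/-- The kernel of the trivial representation. -/
noncomputable def trivialPrim : Prim (GroupCStar Γ) :=
  ⟨TwoSidedIdeal.ker (trivialRep Γ).toCStar, ⟨_, (trivialRep Γ).toCStar⟩,
    isIrreducibleRep_trivialRep, rfl⟩

theorem UnitaryRep.single_sub_mem_ker_iff (π : UnitaryRep Γ) (g : Γ) :
    CStarSeminorm.Completion.of _ (MonoidAlgebra.single g 1 - 1 : MonoidAlgebra ℂ Γ) ∈
      TwoSidedIdeal.ker π.toCStar ↔ (π.rep g : π.H →L[ℂ] π.H) = 1 := by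
  rw [TwoSidedIdeal.mem_ker, UnitaryRep.toCStar, extendRep_of, map_sub,
    show (1 : MonoidAlgebra ℂ Γ) = MonoidAlgebra.single 1 1 from rfl,
    UnitaryRep.toGroupAlgebra_single, UnitaryRep.toGroupAlgebra_single, map_one, one_smul, one_smul,
    sub_eq_zero]
  rfl

theorem single_sub_mem_trivialPrim (g : Γ) :
    CStarSeminorm.Completion.of _ (MonoidAlgebra.single g 1 - 1 : MonoidAlgebra ℂ Γ) ∈
      (trivialPrim Γ).1 :=
  ((trivialRep Γ).single_sub_mem_ker_iff g).2 rfl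

end Group

/-! ### Equal kernels force strong effectiveness -/

section StronglyEffective

variable {X : Type u} [TopologicalSpace X] [Groupoid.{v} X] [TopologicalSpace (Total X)]
  [EtaleGroupoid X] {x : X}

theorem indRep_mul_sub_apply {H : Type w} [NormedAddCommGroup H] [InnerProductSpace ℂ H]
    [CompleteSpace H] {π : (⊤ : Subgroup (x ⟶ x)) →* unitary (H →L[ℂ] H)} {h : ConvAlg X}
    (hh : h.UnitSupported) (χ : ConvAlg X) (ξ : IndSpace π) (g : SourceFiber x) :
    (indRep π (h * χ - h) ξ).toFun g = h (unit g.1) • (act χ ξ.toFun g - ξ.toFun g) := by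
  have h1 : indRep π (h * χ - h) ξ = indRep π h (indRep π χ ξ - ξ) := by
    rw [map_sub, map_mul, map_sub]
    rfl
  rw [h1, indRep_unitSupported hh]
  rfl

theorem exists_Ind_eq_ker (x : X) (J : Prim (GroupCStar (x ⟶ x))) : ∃ τ : UnitaryRep (x ⟶ x),
    IsIrreducibleRep τ.toCStar ∧ TwoSidedIdeal.ker τ.toCStar = J.1 ∧
      EtaleCStar.Ind ⟨x, J⟩ = TwoSidedIdeal.ker (isotropyInd τ) :=
  ⟨_, (exists_unitaryRep J).choose_spec.1, (exists_unitaryRep J).choose_spec.2, rfl⟩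

theorem of_mem_ker_isotropyInd_iff (τ : UnitaryRep (x ⟶ x)) (f : ConvAlg X) :
    CStarSeminorm.Completion.of _ f ∈ TwoSidedIdeal.ker (isotropyInd τ) ↔
      indRep (τ.rep.comp (Subgroup.subtype ⊤)) f = 0 := by
  rw [TwoSidedIdeal.mem_ker, isotropyInd_of]

section

variable {H : Type w} [NormedAddCommGroup H] [InnerProductSpace ℂ H] [CompleteSpace H]
  {π : (⊤ : Subgroup (x ⟶ x)) →* unitary (H →L[ℂ] H)} {W : Set (Total X)} {h χ : ConvAlg X}

/-- For trivial `π`, vectors are functions of the range alone. Where `h` is nonzero on the orbit,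
`χ` translates along a loop, which does not change the range, so it acts as the identity. -/
theorem indRep_mul_sub_eq_zero (hπ : ∀ k, (π k : H →L[ℂ] H) = 1) (hh : h.UnitSupported)
    (hχ : χ.SupportedOn W) (hloop : ∀ y, Nonempty (y ⟶ x) → h (unit y) ≠ 0 →
      ∃ w : y ⟶ y, (⟨y, y, w⟩ : Total X) ∈ W ∧ χ ⟨y, y, w⟩ = 1) :
    indRep π (h * χ - h) = 0 := by
  ext ξ
  refine IndSpace.ext fun g => ?_
  rw [indRep_mul_sub_apply hh]
  change _ = (0 : H)
  by_cases h0 : h (unit g.1) = 0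
  · rw [h0, zero_smul]
  obtain ⟨y, g⟩ := g
  obtain ⟨w, hw, hw1⟩ := hloop y ⟨g⟩ h0
  have h2 := act_eq_single hχ ξ.toFun ⟨y, g⟩ ⟨y, w⟩ hw
  have h3 := ξ.covariant ⟨y, g⟩ ⟨Groupoid.inv g ≫ Groupoid.inv w ≫ g, trivial⟩
  have h4 : (⟨y, g ≫ Groupoid.inv g ≫ Groupoid.inv w ≫ g⟩ : SourceFiber x) =
      ⟨y, Groupoid.inv w ≫ g⟩ := by simp
  have h5 := (congrArg ξ.toFun h4).symm.trans h3
  rw [hπ, star_one] at h5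
  rw [h2, hw1, one_smul, h5]
  change _ • (ξ.toFun ⟨y, g⟩ - ξ.toFun ⟨y, g⟩) = 0
  rw [sub_self, smul_zero]

/-- Applied to the vector with value `v` at the unit `x` and evaluated at `γ`, the operator gives `v
- π(γ)⋆v`. -/
theorem apply_eq_of_indRep_mul_sub_eq_zero (hh : h.UnitSupported) (hχ : χ.SupportedOn W)
    {γ : x ⟶ x} (hγ : (⟨x, x, γ⟩ : Total X) ∈ W) (hχ1 : χ ⟨x, x, γ⟩ = 1) (hh1 : h (unit x) = 1)
    (h0 : indRep π (h * χ - h) = 0) (v : H) : (π ⟨γ, trivial⟩ : H →L[ℂ] H) v = v := by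
  have h1 := indRep_mul_sub_apply hh χ (indVec π ⟨x, 𝟙 x⟩ v) ⟨x, γ⟩
  have h2 := act_eq_single hχ (indVec π ⟨x, 𝟙 x⟩ v).toFun ⟨x, γ⟩ ⟨x, γ⟩ hγ
  have h3 : (⟨x, Groupoid.inv γ ≫ γ⟩ : SourceFiber x) = ⟨x, 𝟙 x⟩ := by simp
  rw [h0, h2, hχ1, hh1, one_smul, one_smul] at h1
  change (0 : H) = (indVec π ⟨x, 𝟙 x⟩ v).toFun ⟨x, Groupoid.inv γ ≫ γ⟩ - _ at h1
  rw [h3, indVec_self] at h1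
  have h4 := (indVec π ⟨x, 𝟙 x⟩ v).covariant ⟨x, 𝟙 x⟩ ⟨γ, trivial⟩
  have h5 : (⟨x, 𝟙 x ≫ γ⟩ : SourceFiber x) = ⟨x, γ⟩ := by rw [Category.id_comp]
  rw [indVec_self] at h4
  have h6 := h4.symm.trans (congrArg (indVec π ⟨x, 𝟙 x⟩ v).toFun h5)
  rw [← sub_eq_zero.1 h1.symm] at h6
  have h7 := unitary_apply_star_apply (π ⟨γ, trivial⟩) v
  rwa [h6] at h7

end

/-- A groupoid that is not strongly effective has an arrow `γ` in an isotropy group such that all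
arrows near `γ` with range in the orbit of its range are loops. -/
theorem exists_loop_of_not_stronglyEffective (hX : ¬ StronglyEffective X) :
    ∃ (x : X) (γ : x ⟶ x) (O : Set (Total X)), γ ≠ 𝟙 x ∧ IsOpen O ∧ (⟨x, x, γ⟩ : Total X) ∈ O ∧
      ∀ g ∈ O, Nonempty (rng g ⟶ x) → src g = rng g := by
  simp only [StronglyEffective, not_forall] at hX
  obtain ⟨Y, hY⟩ := hX
  have hsub : range unit ⊆ interior {g : Quiver.Total (Reduction Y) | rng g = src g} := by
    refine interior_maximal ?_ isOpen_range_unit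
    rintro _ ⟨y, rfl⟩
    rfl
  obtain ⟨g₀, hg₀, hunit⟩ : ∃ g₀ ∈ interior {g : Quiver.Total (Reduction Y) | rng g = src g},
      g₀ ∉ range (unit : Reduction Y → Quiver.Total (Reduction Y)) := by
    by_contra! h
    exact hY (Subset.antisymm h hsub)
  -- An open set of the ambient groupoid that cuts out the interior of the isotropy of the
  -- reduction. Arrows in it with range in the orbit belong to the reduction, as `Y` is invariant,
  -- so they are loops.
  obtain ⟨O, hO, hOeq⟩ := isOpen_induced_iff.1
    (isOpen_interior (s := {g : Quiver.Total (Reduction Y) | rng g = src g}))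
  have hg₀O : Reduction.incl Y g₀ ∈ O := by
    rw [← hOeq] at hg₀
    exact hg₀
  have hiso : g₀ ∈ {g : Quiver.Total (Reduction Y) | rng g = src g} := interior_subset hg₀
  obtain ⟨a, b, γ⟩ := g₀
  obtain rfl : a = b := hiso
  refine ⟨a.1, γ, O, fun h => hunit ⟨a, ?_⟩, hO, hg₀O, ?_⟩
  · exact congrArg (fun k : a ⟶ a => (⟨a, a, k⟩ : Quiver.Total (Reduction Y))) h.symm
  · rintro ⟨y, t, k⟩ hk ⟨g⟩
    have hy : y ∈ Y.carrier := Y.invariant (Groupoid.inv g) a.2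
    let k' : Quiver.Total (Reduction Y) := ⟨⟨y, hy⟩, ⟨t, Y.invariant k hy⟩, k⟩
    have h1 : k' ∈ Reduction.incl Y ⁻¹' O := hk
    rw [hOeq] at h1
    have h2 : k' ∈ {g : Quiver.Total (Reduction Y) | rng g = src g} := interior_subset h1
    exact (congrArg (fun z : Reduction Y => z.1) h2).symm

/-- If the ideals `Ind(x, J)` only depend on `x`, then the groupoid is strongly effective. -/
theorem stronglyEffective_of_Ind_eq
    (hInd : ∀ (x : X) (J J' : Prim (GroupCStar (x ⟶ x))),
      EtaleCStar.Ind ⟨x, J⟩ = EtaleCStar.Ind ⟨x, J'⟩) : StronglyEffective X := by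
  by_contra hX
  obtain ⟨x, γ, O, hγ, hO, hγO, hloop⟩ := exists_loop_of_not_stronglyEffective hX
  obtain ⟨W, hW, hWb, hγW⟩ := ConvAlg.exists_isBisection (⟨x, x, γ⟩ : Total X)
  have := EtaleGroupoid.locallyCompactSpace (X := X)
  have := EtaleGroupoid.t2Space (X := X)
  obtain ⟨N, hN, hγN, hNW⟩ := exists_compact_subset (hW.inter hO) ⟨hγW, hγO⟩
  obtain ⟨χ, hχ1, hχ2, -⟩ := ConvAlg.exists_bump hN (hW.inter hO) hNW
  have hχ : χ.SupportedOn (W ∩ O) := ⟨hW.inter hO, ⟨hWb.1.mono inter_subset_left,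
    hWb.2.mono inter_subset_left⟩, hχ2⟩
  -- Every unit in the support of `h` is the range of an arrow in `N`, where `χ = 1`.
  obtain ⟨h, hh, hh1, hh2, -⟩ := ConvAlg.exists_unit_bump (isCompact_singleton (x := x))
    (isOpenMap_range _ (isOpen_interior (s := N)))
    (singleton_subset_iff.2 ⟨⟨x, x, γ⟩, hγN, rfl⟩)
  obtain ⟨J, hJ⟩ := exists_prim_single_sub_notMem (Γ := x ⟶ x) hγ
  obtain ⟨τ, -, hτ, hIndτ⟩ := exists_Ind_eq_ker x (trivialPrim (x ⟶ x))
  obtain ⟨σ, -, hσ, hIndσ⟩ := exists_Ind_eq_ker x J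
  have h1 : indRep (τ.rep.comp (Subgroup.subtype (⊤ : Subgroup (x ⟶ x)))) (h * χ - h) = 0 := by
    refine indRep_mul_sub_eq_zero (fun k => ?_) hh hχ fun y hy h0 => ?_
    · refine (τ.single_sub_mem_ker_iff k.1).1 ?_
      rw [hτ]
      exact single_sub_mem_trivialPrim _
    · obtain ⟨⟨y', t, w⟩, hw, hwy⟩ := hh2 y h0
      obtain rfl : y' = y := hwy
      have hwO := hNW (interior_subset hw)
      obtain rfl : t = y' := hloop _ hwO.2 hy
      exact ⟨w, hwO, hχ1 _ (interior_subset hw)⟩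
  -- The hypothesis transfers the vanishing of `hχ - h` from the trivial representation to `σ`, and
  -- this forces `σ(γ) = 1`.
  rw [← of_mem_ker_isotropyInd_iff, ← hIndτ, hInd x _ J, hIndσ, of_mem_ker_isotropyInd_iff] at h1
  apply hJ
  rw [← hσ, σ.single_sub_mem_ker_iff]
  ext v
  exact apply_eq_of_indRep_mul_sub_eq_zero hh hχ ⟨hγW, hγO⟩ (hχ1 _ (interior_subset hγN))
    (hh1 x rfl) h1 v

end StronglyEffective

/-! ## The quasi-orbit space in the primitive ideal space -/

instance {A : Type w} [NonUnitalCStarAlgebra A] : T0Space (Prim A) where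
  t0 P Q h := by
    have key : ∀ P Q : Prim A, Inseparable P Q → P.1 ≤ Q.1 := fun P Q h => by
      have hcl : IsClosed (hull P.1) := Prim.isClosed_iff.2 ⟨P.1, P.isClosed, rfl⟩
      exact (h.mem_closed_iff hcl).1 (mem_hull.2 le_rfl)
    exact Subtype.ext (le_antisymm (key P Q h) (key Q P h.symm))

section IndZero

variable {X : Type u} [TopologicalSpace X] [Groupoid.{v} X] [TopologicalSpace (Total X)]
  [EtaleGroupoid X]

/-- The primitive ideal induced from the trivial representation of the isotropy group at `x`. -/
noncomputable def indZero (x : X) : Prim (GroupoidCStar X) :=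
  ⟨EtaleCStar.Ind ⟨x, trivialPrim (x ⟶ x)⟩, by
    obtain ⟨τ, hτ, -, hInd⟩ := exists_Ind_eq_ker x (trivialPrim (x ⟶ x))
    exact ⟨⟨_, isotropyInd τ⟩, isIrreducibleRep_isotropyInd τ hτ, hInd.symm⟩⟩

theorem mem_indZero_iff (hX : IsAmenable X) (hI : ResidualIntersectionProperty X) (x : X)
    (a : GroupoidCStar X) : a ∈ (indZero x).1 ↔ RegNull a x :=
  mem_Ind_iff hX hI ⟨x, trivialPrim (x ⟶ x)⟩ a

theorem indZero_eq_of_hom (hX : IsAmenable X) (hI : ResidualIntersectionProperty X) {x y : X}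
    (g : x ⟶ y) : indZero x = indZero y := by
  refine Subtype.ext (TwoSidedIdeal.ext fun a => ?_)
  rw [mem_indZero_iff hX hI, mem_indZero_iff hX hI]
  exact ⟨fun h => h.of_hom (Groupoid.inv g), fun h => h.of_hom g⟩

/-- The preimage of a hull is an intersection of the sets `{x | RegNull a x}`, which are closed. -/
theorem continuous_indZero (hX : IsAmenable X) (hI : ResidualIntersectionProperty X) :
    Continuous (indZero : X → Prim (GroupoidCStar X)) := by
  refine continuous_iff_isClosed.2 fun Ω hΩ => ?_
  obtain ⟨J, -, rfl⟩ := Prim.isClosed_iff.1 hΩ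
  have h1 : indZero ⁻¹' hull J = ⋂ a ∈ J, {x : X | RegNull a x} := by
    ext x
    simp only [mem_preimage, mem_hull, mem_iInter, mem_ofPred_eq]
    exact forall₂_congr fun a _ => mem_indZero_iff hX hI x a
  rw [h1]
  exact isClosed_biInter fun a _ => isClosed_regNull a

theorem of_mem_indZero_iff (x : X) {h : ConvAlg X} (hh : h.UnitSupported) :
    CStarSeminorm.Completion.of _ h ∈ (indZero x).1 ↔
      ∀ y : X, Nonempty (y ⟶ x) → h (unit y) = 0 := by
  obtain ⟨τ, hτ, -, hInd⟩ := exists_Ind_eq_ker x (trivialPrim (x ⟶ x))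
  have := hτ.nontrivial
  change _ ∈ EtaleCStar.Ind ⟨x, trivialPrim (x ⟶ x)⟩ ↔ _
  rw [hInd, of_mem_ker_isotropyInd_iff, indRep_eq_zero_iff hh]

/-- Closed invariant sets of units are preimages of closed sets of primitive ideals. -/
theorem exists_isClosed_preimage_indZero (Y : ClosedInvariantSet X) :
    ∃ Ω : Set (Prim (GroupoidCStar X)), IsClosed Ω ∧ indZero ⁻¹' Ω = Y.carrier := by
  refine ⟨closure (indZero '' Y.carrier), isClosed_closure, Subset.antisymm (fun x hx => ?_)
    fun y hy => subset_closure ⟨y, hy, rfl⟩⟩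
  obtain ⟨J, -, hJ⟩ := Prim.isClosed_iff.1 (isClosed_closure (s := indZero '' Y.carrier))
  by_contra hxY
  obtain ⟨h, hh, hh1, hh2, -⟩ := ConvAlg.exists_unit_bump (isCompact_singleton (x := x))
    Y.isClosed.isOpen_compl (singleton_subset_iff.2 hxY)
  let a : GroupoidCStar X := CStarSeminorm.Completion.of _ h
  have h1 : ∀ y ∈ Y.carrier, a ∈ (indZero y).1 := fun y hy => by
    rw [of_mem_indZero_iff y hh]
    rintro z ⟨g⟩
    by_contra h0
    exact hh2 z h0 (Y.invariant (Groupoid.inv g) hy)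
  -- It is the hull of the smallest closed ideal containing `a`. The bump `a` lies in the ideals of
  -- all points of `Y`, hence in that of every point whose ideal is in the closure, but not in the
  -- ideal of `x`.
  have h2 : IsClosed {P : Prim (GroupoidCStar X) | a ∈ P.1} := by
    let I : TwoSidedIdeal (GroupoidCStar X) := sInf {I | IsClosed (I : Set (GroupoidCStar X)) ∧ a ∈ I}
    refine Prim.isClosed_iff.2 ⟨I, ?_, ?_⟩
    · have : (I : Set (GroupoidCStar X)) = ⋂ I' ∈ {I : TwoSidedIdeal (GroupoidCStar X) |
          IsClosed (I : Set (GroupoidCStar X)) ∧ a ∈ I}, (I' : Set (GroupoidCStar X)) := by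
        ext b
        simp [I, TwoSidedIdeal.mem_sInf]
      rw [this]
      exact isClosed_biInter fun I' hI' => hI'.1
    · ext P
      rw [mem_hull]
      constructor
      · intro hP
        exact hP ((TwoSidedIdeal.mem_sInf _).2 fun I' hI' => hI'.2)
      · intro hP
        exact sInf_le ⟨P.isClosed, hP⟩
  have h3 : a ∈ (indZero x).1 := closure_minimal (by
    rintro _ ⟨y, hy, rfl⟩
    exact h1 y hy) h2 hx
  rw [of_mem_indZero_iff x hh] at h3
  have h4 := h3 x ⟨𝟙 x⟩
  rw [hh1 x rfl] at h4
  exact one_ne_zero h4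

/-- Closed sets of the orbit space are closed invariant sets of units, so the induced map on the
`T₀` quotient carries the induced topology. A topology-inducing map on a `T₀` space is an embedding.
-/
theorem exists_homeomorph_range_indZero (hX : IsAmenable X)
    (hI : ResidualIntersectionProperty X) :
    ∃ Φ : QuasiOrbitSpace X ≃ₜ range (indZero : X → Prim (GroupoidCStar X)),
      ∀ x : X, (Φ (quasiOrbit x) : Prim (GroupoidCStar X)) = indZero x := by
  let φ : OrbitSpace X → Prim (GroupoidCStar X) :=
    Quotient.lift indZero fun x y ⟨g⟩ => indZero_eq_of_hom hX hI g
  have hφc : Continuous φ := (continuous_indZero hX hI).quotient_lift _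
  have hφ : ∀ C : Set (OrbitSpace X), IsClosed C → ∃ Ω, IsClosed Ω ∧ φ ⁻¹' Ω = C := by
    intro C hC
    obtain ⟨Ω, hΩ, hpre⟩ := exists_isClosed_preimage_indZero
      ⟨Quotient.mk (orbitSetoid X) ⁻¹' C, hC.preimage continuous_quotient_mk', fun {x y} g hx => by
        have : Quotient.mk (orbitSetoid X) x = Quotient.mk (orbitSetoid X) y := Quotient.sound ⟨g⟩
        rwa [mem_preimage, ← this]⟩
    refine ⟨Ω, hΩ, ?_⟩
    ext q
    induction q using Quotient.inductionOn with
    | h x => exact Set.ext_iff.1 hpre x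
  let ψ : QuasiOrbitSpace X → Prim (GroupoidCStar X) :=
    -- A continuous map identifies inseparable points since the primitive ideal space is `T₀`.
    SeparationQuotient.lift φ fun p q h => (h.map hφc).eq
  have hψc : Continuous ψ := SeparationQuotient.continuous_lift hφc
  have hψ : Topology.IsInducing ψ := by
    refine ⟨TopologicalSpace.ext_iff_isClosed.2 fun C => ?_⟩
    rw [isClosed_induced_iff]
    constructor
    · intro hC
      obtain ⟨Ω, hΩ, hpre⟩ := hφ _ (hC.preimage SeparationQuotient.continuous_mk)
      refine ⟨Ω, hΩ, ?_⟩
      ext q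
      obtain ⟨p, rfl⟩ := SeparationQuotient.surjective_mk q
      exact Set.ext_iff.1 hpre p
    · rintro ⟨Ω, hΩ, rfl⟩
      exact hΩ.preimage hψc
  have hrange : range ψ = range (indZero : X → Prim (GroupoidCStar X)) := by
    ext P
    constructor
    · rintro ⟨q, rfl⟩
      obtain ⟨p, rfl⟩ := SeparationQuotient.surjective_mk q
      induction p using Quotient.inductionOn with
      | h x => exact ⟨x, rfl⟩
    · rintro ⟨x, rfl⟩
      exact ⟨quasiOrbit x, rfl⟩
  exact ⟨hψ.isEmbedding.toHomeomorph.trans (Homeomorph.setCongr hrange), fun x => rfl⟩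

/-- A primitive ideal `P` is the intersection of the ideals `Ind₀(x)` over the hull of a
representation with kernel `P`. These contain `P`, so they lie in `Ω`, and an ideal contained in all
of them is contained in `P`. -/
theorem subset_closure_range_indZero (hX : IsAmenable X) (hI : ResidualIntersectionProperty X)
    {Ω : Set (Prim (GroupoidCStar X))} (hΩ : IsClosed Ω) :
    Ω ⊆ closure (range indZero ∩ Ω) := by
  intro P hP
  obtain ⟨J, -, hJ⟩ := Prim.isClosed_iff.1 hΩ
  obtain ⟨J', -, hJ'⟩ := Prim.isClosed_iff.1 (isClosed_closure (s := range indZero ∩ Ω))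
  obtain ⟨σ, -, hσ⟩ := P.2
  rw [← hJ']
  intro a ha
  rw [← hσ, mem_ker_iff hX hI]
  intro x hx
  rw [← mem_indZero_iff hX hI]
  have h1 : P.1 ≤ (indZero x).1 := fun b hb => by
    rw [← hσ, mem_ker_iff hX hI] at hb
    exact (mem_indZero_iff hX hI x b).2 (hb x hx)
  have h2 : indZero x ∈ Ω := by
    rw [← hJ] at hP ⊢
    exact (mem_hull.1 hP).trans h1
  have h3 : indZero x ∈ closure (range indZero ∩ Ω) := subset_closure ⟨⟨x, rfl⟩, h2⟩
  rw [← hJ'] at h3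
  exact h3 ha

end IndZero

end EtaleCStar

/-! ### The main theorem -/

open EtaleCStar CategoryTheory
theorem proposition3p19 (X : Type u) [TopologicalSpace X] [Groupoid.{v} X]
    [TopologicalSpace (Quiver.Total X)] [EtaleGroupoid X] (hX : IsAmenable X) :
    List.TFAE [StronglyEffective X, ResidualIntersectionProperty X,
      ∀ (x : X) (J J' : Prim (GroupCStar (x ⟶ x))), EtaleCStar.Ind ⟨x, J⟩ = EtaleCStar.Ind ⟨x, J'⟩] ∧
    (StronglyEffective X →
      ∃ Ind₀ : X → Prim (GroupoidCStar X),
        (∀ (x : X) (J : Prim (GroupCStar (x ⟶ x))), (Ind₀ x).1 = EtaleCStar.Ind ⟨x, J⟩) ∧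
        (∃ Φ : QuasiOrbitSpace X ≃ₜ Set.range Ind₀,
          ∀ x : X, (Φ (quasiOrbit x) : Prim (GroupoidCStar X)) = Ind₀ x) ∧
        ∀ Ω : Set (Prim (GroupoidCStar X)), IsClosed Ω → Ω ⊆ closure (Set.range Ind₀ ∩ Ω)) := by
  refine ⟨?_, fun hS => ?_⟩
  · tfae_have 1 → 2 := StronglyEffective.residualIntersectionProperty
    tfae_have 2 → 3 := Ind_eq_of_residualIntersectionProperty hX
    tfae_have 3 → 1 := stronglyEffective_of_Ind_eq
    tfae_finish
  · have hI := hS.residualIntersectionProperty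
    exact ⟨indZero, fun x J => Ind_eq_of_residualIntersectionProperty hX hI x _ J,
      exists_homeomorph_range_indZero hX hI, fun Ω => subset_closure_range_indZero hX hI⟩
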